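/- \textbf{Setting.} Fix function symbols, predicate symbols of given arities, and an arity-preserving duality $P\mapsto\overline P$ on predicate symbols with $\overline{\overline P}=P$ and $\overline P\ne P$. Formulas are generated from atoms $Pt_1\ldots t_n$ by $\otimes$ (tensor), $\wp$ (par), $\forall x$, $\exists x$; the dual $\overline A$ is given by $\overline{Pt_1\ldots t_n}=\overline P t_1\ldots t_n$, $\overline{A\otimes B}=\overline A \wp \overline B$, $\overline{A \wp B}=\overline A\otimes\overline B$, $\overline{\exists xA}=\forall x\overline A$, $\overline{\forall xA}=\exists x\overline A$. Formulas are identified with their parse trees, with edges directed from arguments to connectives and quantifiers. A \emph{sequent} is a finite disjoint union of formulas. A \emph{cut} is an unordered pair $[A\mid\overline A]$ of dual formulas $A$ and $\overline A$ joined by a cut edge, in which the free variables of $A$ are regarded as bound. A \emph{cut sequent} is a disjoint union of a sequent and finitely many (possibly zero) cuts. A \emph{link} is a pair of leaves with dual predicate symbols, and a \emph{linking} on a cut sequent is a set of disjoint links whose union contains every leaf. \textbf{Unification nets.} Let $\lambda$ be a linking on a (cut-free) sequent $\Gamma$ whose bound variables have been renamed so as to be distinct from each other and from all free variables. A \emph{unifier}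 assigns to each non-vacuous existential variable a term over the free and universal variables (which are treated as constants) so that, after substitution, the two ends of every link carry the same sequence of terms. A \emph{most general unifier} (mgu) is a unifier that yields every other one by substituting terms for free variables. The \emph{graph} of $\lambda$ is the forest $\Gamma$ together with an undirected edge for each link and a directed edge, called a \emph{leap}, from $\exists x$ to $\forall y$ whenever the mgu assigns to $x$ a term containing $y$. A \emph{switching} is obtained from the graph by deleting all but one of the edges into each $\wp$ and each $\forall$, and undirecting the remaining edges. The linking $\lambda$ is \emph{correct} if it has a unifier and all of its switchings are trees (connected and acyclic, as multigraphs). The \emph{encoding} of a cut sequent $\Delta$ is the sequent obtained by replacing each cut $[A\mid\overline A]$ by $\exists x_1\ldots\exists x_n(A\otimes\overline A)$, with the same leaves, where $x_1,\ldots,x_n$ are the free variables of $A$. A \emph{unification net} on $\Delta$ is a linking on $\Delta$ that is correct as a linking on the encoding of $\Delta$. \textbf{Cut reduction.} A linking $\theta$ on a cut sequent reduces to $\theta'$ in one step in each of the following cases. \begin{itemize} \item (atomic) $\theta$ is a linking on $\Gamma,\;[P\vec t\mid\overline P\vec t]$ in which the two leaves $P\vec t$ and $\overline P\vec t$ of the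 cut are linked to leaves $a$ and $d$ of $\Gamma$ respectively; $\theta'$ is the linking on $\Gamma$ obtained by replacing these two links by the single link $\{a,d\}$. \item (multiplicative) $\theta$ is a linking on $\Gamma,\;[\overline A \wp \overline B\mid A\otimes B]$; $\theta'$ consists of the same links, on $\Gamma,\;[\overline A\mid A],\;[\overline B\mid B]$. \item (quantifier) $\theta$ is a linking on $\Gamma,\;[\exists x\overline A\mid\forall xA]$; $\theta'$ consists of the same links, on $\Gamma,\;[\overline A\mid A]$. \end{itemize} \textbf{Theorem.} If $\theta$ is a unification net on a cut sequent $\Delta$, and $\theta$ on $\Delta$ reduces to $\theta'$ on $\Delta'$ by an atomic, multiplicative or quantifier cut reduction, then $\theta'$ is a unification net on $\Delta'$. -/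

import Mathlib

/-!
First-order multiplicative linear logic, cut sequents, linkings, unification nets, cut reduction.
Variables are natural numbers; terms and predicate symbols are those of a first-order language.
-/

universe u v

namespace UNet

/-- An arity-preserving negation on predicate symbols, involutive and without fixed points. -/
class PredDuality (L : FirstOrder.Language.{u, v}) where
  neg : ∀ {n : ℕ}, L.Relations n → L.Relations n
  neg_neg : ∀ {n : ℕ} (R : L.Relations n), neg (neg R) = R
  neg_ne : ∀ {n : ℕ} (R : L.Relations n), neg R ≠ R

/-- Formulas, generated from atoms by tensor, par and the two quantifiers. -/
inductive Formula (L : FirstOrder.Language.{u, v}) : Type (max u v)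
  | atom {n : ℕ} (R : L.Relations n) (ts : Fin n → L.Term ℕ) : Formula L
  | tensor (A B : Formula L) : Formula L
  | par (A B : Formula L) : Formula L
  | all (x : ℕ) (A : Formula L) : Formula L
  | ex (x : ℕ) (A : Formula L) : Formula L

namespace Formula

variable {L : FirstOrder.Language.{u, v}}

/-- The dual formula. -/
def dual [PredDuality L] : Formula L → Formula L
  | atom R ts => atom (PredDuality.neg R) ts
  | tensor A B => par A.dual B.dual
  | par A B => tensor A.dual B.dual
  | all x A => ex x A.dual
  | ex x A => all x A.dual

/-- The free variables of a formula. -/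
def fv : Formula L → Finset ℕ
  | atom _ ts => Finset.univ.biUnion fun i => (ts i).varFinset
  | tensor A B => A.fv ∪ B.fv
  | par A B => A.fv ∪ B.fv
  | all x A => A.fv.erase x
  | ex x A => A.fv.erase x

/-- The leaves of the parse tree. Quantifying a formula does not change its leaves. -/
def Leaf : Formula L → Type
  | atom _ _ => Unit
  | tensor A B => A.Leaf ⊕ B.Leaf
  | par A B => A.Leaf ⊕ B.Leaf
  | all _ A => A.Leaf
  | ex _ A => A.Leaf

/-- The vertices of the parse tree; `none` is the root of a compound formula. -/
def Vertex : Formula L → Type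
  | atom _ _ => Unit
  | tensor A B => Option (A.Vertex ⊕ B.Vertex)
  | par A B => Option (A.Vertex ⊕ B.Vertex)
  | all _ A => Option A.Vertex
  | ex _ A => Option A.Vertex

/-- The root of the parse tree. -/
def root : (A : Formula L) → A.Vertex
  | atom _ _ => ()
  | tensor _ _ => none
  | par _ _ => none
  | all _ _ => none
  | ex _ _ => none

/-- A leaf, seen as a vertex. -/
def leafVertex : (A : Formula L) → A.Leaf → A.Vertex
  | atom _ _, _ => ()
  | tensor A _, .inl l => some (.inl (A.leafVertex l))
  | tensor _ B, .inr l => some (.inr (B.leafVertex l))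
  | par A _, .inl l => some (.inl (A.leafVertex l))
  | par _ B, .inr l => some (.inr (B.leafVertex l))
  | all _ A, l => some (A.leafVertex l)
  | ex _ A, l => some (A.leafVertex l)

end Formula

/-- The kinds of vertices of a parse tree. -/
inductive Kind
  | leaf | tensor | par | all | ex

namespace Formula

variable {L : FirstOrder.Language.{u, v}}

/-- The kind of a vertex. -/
def kind : (A : Formula L) → A.Vertex → Kind
  | atom _ _, _ => .leaf
  | tensor _ _, none => .tensor
  | tensor A _, some (.inl w) => A.kind w
  | tensor _ B, some (.inr w) => B.kind w
  | par _ _, none => .par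
  | par A _, some (.inl w) => A.kind w
  | par _ B, some (.inr w) => B.kind w
  | all _ _, none => .all
  | all _ A, some w => A.kind w
  | ex _ _, none => .ex
  | ex _ A, some w => A.kind w

/-- `A.IsArg a b`: the parse tree of `A` has a directed edge from `a` to `b`, that is, `a` is the
root of an argument of the connective or quantifier at `b`. -/
def IsArg : (A : Formula L) → A.Vertex → A.Vertex → Prop
  | atom _ _, _, _ => False
  | tensor A _, some (.inl a), some (.inl b) => A.IsArg a b
  | tensor _ B, some (.inr a), some (.inr b) => B.IsArg a b
  | tensor A _, some (.inl a), none => a = A.root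
  | tensor _ B, some (.inr a), none => a = B.root
  | tensor _ _, _, _ => False
  | par A _, some (.inl a), some (.inl b) => A.IsArg a b
  | par _ B, some (.inr a), some (.inr b) => B.IsArg a b
  | par A _, some (.inl a), none => a = A.root
  | par _ B, some (.inr a), none => a = B.root
  | par _ _, _, _ => False
  | all _ A, some a, some b => A.IsArg a b
  | all _ A, some a, none => a = A.root
  | all _ _, none, _ => False
  | ex _ A, some a, some b => A.IsArg a b
  | ex _ A, some a, none => a = A.root
  | ex _ _, none, _ => False

/-- The predicate symbol (with its arity) of a leaf. -/
def leafPred : (A : Formula L) → A.Leaf → Σ n, L.Relations n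
  | atom (n := n) R _, _ => ⟨n, R⟩
  | tensor A _, .inl l => A.leafPred l
  | tensor _ B, .inr l => B.leafPred l
  | par A _, .inl l => A.leafPred l
  | par _ B, .inr l => B.leafPred l
  | all _ A, l => A.leafPred l
  | ex _ A, l => A.leafPred l

/-- The term sequence of a leaf, after replacing every free occurrence of a variable `x` by `ρ x`
and every occurrence bound by the quantifier at vertex `w` by `q w`. -/
def leafArgs {W : Type} : (A : Formula L) → (ρ : ℕ → W) → (q : A.Vertex → W) → A.Leaf →
    List (L.Term W)
  | atom _ ts, ρ, _, _ => List.ofFn fun i => (ts i).relabel ρ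
  | tensor A _, ρ, q, .inl l => A.leafArgs ρ (fun w => q (some (.inl w))) l
  | tensor _ B, ρ, q, .inr l => B.leafArgs ρ (fun w => q (some (.inr w))) l
  | par A _, ρ, q, .inl l => A.leafArgs ρ (fun w => q (some (.inl w))) l
  | par _ B, ρ, q, .inr l => B.leafArgs ρ (fun w => q (some (.inr w))) l
  | all x A, ρ, q, l => A.leafArgs (Function.update ρ x (q none)) (fun w => q (some w)) l
  | ex x A, ρ, q, l => A.leafArgs (Function.update ρ x (q none)) (fun w => q (some w)) l

/-- Iterated existential quantification `∃x₁ … ∃xₙ A`. -/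
def exs : List ℕ → Formula L → Formula L
  | [], A => A
  | x :: xs, A => ex x (exs xs A)

/-- The leaves of `∃x₁ … ∃xₙ A` are those of `A`. -/
def exsLeaf {A : Formula L} : (xs : List ℕ) → A.Leaf → (exs xs A).Leaf
  | [], l => l
  | _ :: xs, l => exsLeaf xs l

/-- The encoding of the cut between `A` and its dual: the tensor of the two, existentially closed
over the free variables of `A` (taken in increasing order). -/
def encodeCut [PredDuality L] (A : Formula L) : Formula L :=
  exs (A.fv.sort (· ≤ ·)) (tensor A A.dual)

end Formula

/-! ### Cut-free sequents: a sequent is a finite family `Γ : ι → Formula L` -/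

section Sequent

variable {L : FirstOrder.Language.{u, v}} {ι : Type} (Γ : ι → Formula L)

/-- Leaves of a sequent. -/
abbrev SLeaf : Type := Σ i, (Γ i).Leaf

/-- Vertices of a sequent. -/
abbrev SVertex : Type := Σ i, (Γ i).Vertex

/-- The variables of the sequent made clean: each free variable `x` is `Sum.inl x`, and each bound
variable is renamed to `Sum.inr w`, for `w` the quantifier vertex that binds it. -/
abbrev SVar : Type := ℕ ⊕ SVertex Γ

/-- The kind of a vertex of a sequent. -/
def kindOf (w : SVertex Γ) : Kind := (Γ w.1).kind w.2

/-- The vertex of a leaf. -/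
def vertexOf (l : SLeaf Γ) : SVertex Γ := ⟨l.1, (Γ l.1).leafVertex l.2⟩

/-- The term sequence of a leaf in the sequent made clean. -/
def argsOf (l : SLeaf Γ) : List (L.Term (SVar Γ)) :=
  (Γ l.1).leafArgs Sum.inl (fun w => Sum.inr ⟨l.1, w⟩) l.2

open Classical in
/-- The variable `x` occurs in the term `t`. -/
def Occurs {W : Type} (x : W) (t : L.Term W) : Prop := x ∈ t.varFinset

/-- `w` is a non-vacuous existential quantifier: it binds some occurrence of a variable. -/
def IsNonvacuousEx (w : SVertex Γ) : Prop :=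
  kindOf Γ w = .ex ∧ ∃ l : SLeaf Γ, ∃ t ∈ argsOf Γ l, Occurs (Sum.inr w) t

/-- The non-vacuous existential variables. -/
def IsExVar : SVar Γ → Prop
  | .inl _ => False
  | .inr w => IsNonvacuousEx Γ w

/-- The free and the universal variables. -/
def IsConstVar : SVar Γ → Prop
  | .inl _ => True
  | .inr w => kindOf Γ w = .all

/-- `σ` is a unifier for `θ`: it assigns to the non-vacuous existential variables terms over the
free and universal variables, leaves everything else fixed, and equalizes the term sequences at
the two ends of every link. -/
structure IsUnifier (θ : Set (Sym2 (SLeaf Γ))) (σ : SVar Γ → L.Term (SVar Γ)) : Prop where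
  fixes : ∀ x, ¬ IsExVar Γ x → σ x = FirstOrder.Language.Term.var x
  range : ∀ x, IsExVar Γ x → ∀ y, Occurs y (σ x) → IsConstVar Γ y
  equalizes : ∀ l l' : SLeaf Γ, s(l, l') ∈ θ →
    (argsOf Γ l).map (fun t => t.subst σ) = (argsOf Γ l').map (fun t => t.subst σ)

/-- `σ` is a most general unifier: it yields every unifier by substituting terms for free
variables. -/
def IsMGU (θ : Set (Sym2 (SLeaf Γ))) (σ : SVar Γ → L.Term (SVar Γ)) : Prop :=
  IsUnifier Γ θ σ ∧ ∀ τ, IsUnifier Γ θ τ → ∃ ρ : ℕ → L.Term (SVar Γ), ∀ x, IsExVar Γ x →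
    (σ x).subst (Sum.elim ρ fun w => FirstOrder.Language.Term.var (Sum.inr w)) = τ x

/-- The precedence of the existential quantifier `x` and the universal quantifier `y`: the most
general unifier (unique up to renaming of free variables) assigns to `x` a term containing `y`. -/
def Precedes (θ : Set (Sym2 (SLeaf Γ))) (x y : SVertex Γ) : Prop :=
  IsNonvacuousEx Γ x ∧ kindOf Γ y = .all ∧
    ∃ σ, IsMGU Γ θ σ ∧ Occurs (Sum.inr y) (σ (Sum.inr x))

/-- Edges on a vertex set `V`, tagged by what they come from: directed edges from an argument to
its connective or quantifier, directed leaps, undirected links. -/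
inductive Edge (V : Type) : Type
  | arg (a b : V) : Edge V
  | leap (a b : V) : Edge V
  | link (e : Sym2 V) : Edge V

/-- The vertex that a directed edge points into. -/
def Edge.target {V : Type} : Edge V → Option V
  | arg _ b => some b
  | leap _ b => some b
  | link _ => none

/-- The unordered pair of ends of an edge. -/
def Edge.ends {V : Type} : Edge V → Sym2 V
  | arg a b => s(a, b)
  | leap a b => s(a, b)
  | link e => e

/-- The edges of the graph of a linking `θ` on `Γ`. -/
inductive InGraph (θ : Set (Sym2 (SLeaf Γ))) : Edge (SVertex Γ) → Prop
  | arg (i : ι) (a b : (Γ i).Vertex) : (Γ i).IsArg a b → InGraph θ (.arg ⟨i, a⟩ ⟨i, b⟩)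
  | leap (x y : SVertex Γ) : Precedes Γ θ x y → InGraph θ (.leap x y)
  | link (e : Sym2 (SLeaf Γ)) : e ∈ θ → InGraph θ (.link (e.map (vertexOf Γ)))

/-- The pars and universal quantifiers. -/
def IsSwitched (w : SVertex Γ) : Prop := kindOf Γ w = .par ∨ kindOf Γ w = .all

/-- `S` is the edge set of a switching of `θ`: it is obtained from the graph by deleting all but
one edge into each par and each universal quantifier (and undirecting). -/
structure IsSwitching (θ : Set (Sym2 (SLeaf Γ))) (S : Set (Edge (SVertex Γ))) : Prop where
  sub : ∀ e ∈ S, InGraph Γ θ e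
  keep : ∀ e, InGraph Γ θ e → (∀ w, e.target = some w → ¬ IsSwitched Γ w) → e ∈ S
  one : ∀ w, IsSwitched Γ w → ∃! e, e ∈ S ∧ e.target = some w

/-- The undirected multigraph with edge set `S` is a tree: there are no two parallel edges, and
the simple graph with these edges is connected and acyclic. -/
def IsTreeEdges {V : Type} (S : Set (Edge V)) : Prop :=
  Set.InjOn Edge.ends S ∧ (SimpleGraph.fromEdgeSet (Edge.ends '' S)).IsTree

/-- A linking is correct if it is unifiable and all of its switchings are trees. -/
def Correct (θ : Set (Sym2 (SLeaf Γ))) : Prop :=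
  (∃ σ, IsUnifier Γ θ σ) ∧ ∀ S, IsSwitching Γ θ S → IsTreeEdges S

end Sequent

/-! ### Cut sequents -/

/-- A cut sequent: a finite family of formulas together with a finite family of cuts. The formula
`cuts k` stands for the cut between `cuts k` and its dual. -/
structure CutSequent (L : FirstOrder.Language.{u, v}) where
  ι : Type
  κ : Type
  finite_ι : Finite ι
  finite_κ : Finite κ
  concl : ι → Formula L
  cuts : κ → Formula L

/-- `θ` is a linking for leaves with predicate symbols `pred`: a set of pairwise disjoint pairs of
leaves with dual predicate symbols that cover all leaves. -/
structure IsLinking {L : FirstOrder.Language.{u, v}} [PredDuality L] {X : Type}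
    (pred : X → Σ n, L.Relations n) (θ : Set (Sym2 X)) : Prop where
  dual : ∀ l l', s(l, l') ∈ θ → pred l' = ⟨(pred l).1, PredDuality.neg (pred l).2⟩
  disjoint : ∀ e ∈ θ, ∀ e' ∈ θ, ∀ l, l ∈ e → l ∈ e' → e = e'
  covers : ∀ l, ∃ e ∈ θ, l ∈ e

namespace CutSequent

variable {L : FirstOrder.Language.{u, v}} [PredDuality L]

/-- Leaves of a cut sequent: a cut has the leaves of both of its cut formulas. -/
abbrev Leaf (Δ : CutSequent L) : Type :=
  (Σ i, (Δ.concl i).Leaf) ⊕ (Σ k, (Δ.cuts k).Leaf ⊕ (Δ.cuts k).dual.Leaf)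

/-- The predicate symbol of a leaf. -/
def leafPred (Δ : CutSequent L) : Δ.Leaf → Σ n, L.Relations n
  | .inl ⟨i, l⟩ => (Δ.concl i).leafPred l
  | .inr ⟨k, .inl l⟩ => (Δ.cuts k).leafPred l
  | .inr ⟨k, .inr l⟩ => (Δ.cuts k).dual.leafPred l

/-- The cut-free encoding: each cut is replaced by its encoding. -/
def encode (Δ : CutSequent L) : Δ.ι ⊕ Δ.κ → Formula L
  | .inl i => Δ.concl i
  | .inr k => (Δ.cuts k).encodeCut

/-- The identification of the leaves of a cut sequent with those of its encoding. -/
def encodeLeaf (Δ : CutSequent L) : Δ.Leaf → SLeaf Δ.encode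
  | .inl ⟨i, l⟩ => ⟨.inl i, l⟩
  | .inr ⟨k, l⟩ =>
    ⟨.inr k, Formula.exsLeaf (A := .tensor (Δ.cuts k) (Δ.cuts k).dual) _ l⟩

/-- `θ` is a unification net on `Δ`: a linking on `Δ` that is correct on the encoding. -/
def IsUnet (Δ : CutSequent L) (θ : Set (Sym2 Δ.Leaf)) : Prop :=
  IsLinking Δ.leafPred θ ∧ Correct Δ.encode (Sym2.map Δ.encodeLeaf '' θ)

/-- Renaming of the indices of the formulas and cuts. -/
def reindex (Δ : CutSequent L) {ι κ : Type} (e : ι ≃ Δ.ι) (f : κ ≃ Δ.κ) : CutSequent L where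
  ι := ι
  κ := κ
  finite_ι := haveI := Δ.finite_ι; Finite.of_equiv _ e.symm
  finite_κ := haveI := Δ.finite_κ; Finite.of_equiv _ f.symm
  concl := fun i => Δ.concl (e i)
  cuts := fun k => Δ.cuts (f k)

/-- The leaf of `Δ` that a leaf of the reindexed cut sequent stands for. -/
def reindexLeaf (Δ : CutSequent L) {ι κ : Type} (e : ι ≃ Δ.ι) (f : κ ≃ Δ.κ) :
    (Δ.reindex e f).Leaf → Δ.Leaf
  | .inl ⟨i, l⟩ => .inl ⟨e i, l⟩
  | .inr ⟨k, l⟩ => .inr ⟨f k, l⟩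

/-- The disjoint union of `Γ` and the cut between `A` and its dual (at index `none`). -/
def addCut (Γ : CutSequent L) (A : Formula L) : CutSequent L where
  ι := Γ.ι
  κ := Option Γ.κ
  finite_ι := Γ.finite_ι
  finite_κ := haveI := Γ.finite_κ; inferInstance
  concl := Γ.concl
  cuts := fun k => match k with
    | none => A
    | some k => Γ.cuts k

/-- A leaf of `Γ` as a leaf of `Γ` together with a cut. -/
def oldLeaf (Γ : CutSequent L) (A : Formula L) : Γ.Leaf → (Γ.addCut A).Leaf
  | .inl l => .inl l
  | .inr ⟨k, l⟩ => .inr ⟨some k, l⟩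

/-- A leaf of the added cut. -/
def newLeaf (Γ : CutSequent L) (A : Formula L) (l : A.Leaf ⊕ A.dual.Leaf) : (Γ.addCut A).Leaf :=
  .inr ⟨none, l⟩

/-- Where the leaves come from when the cut of `A ⊗ B` is replaced by cuts of `A` and `B`. -/
def tensorLeaf (Γ : CutSequent L) (A B : Formula L) :
    ((Γ.addCut A).addCut B).Leaf → (Γ.addCut (.tensor A B)).Leaf
  | .inl l => .inl l
  | .inr ⟨some (some k), l⟩ => .inr ⟨some k, l⟩
  | .inr ⟨some none, .inl l⟩ => Γ.newLeaf (.tensor A B) (.inl (.inl l))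
  | .inr ⟨some none, .inr l⟩ => Γ.newLeaf (.tensor A B) (.inr (.inl l))
  | .inr ⟨none, .inl l⟩ => Γ.newLeaf (.tensor A B) (.inl (.inr l))
  | .inr ⟨none, .inr l⟩ => Γ.newLeaf (.tensor A B) (.inr (.inr l))

/-- Where the leaves come from when the cut of `A ⅋ B` is replaced by cuts of `A` and `B`. -/
def parLeaf (Γ : CutSequent L) (A B : Formula L) :
    ((Γ.addCut A).addCut B).Leaf → (Γ.addCut (.par A B)).Leaf
  | .inl l => .inl l
  | .inr ⟨some (some k), l⟩ => .inr ⟨some k, l⟩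
  | .inr ⟨some none, .inl l⟩ => Γ.newLeaf (.par A B) (.inl (.inl l))
  | .inr ⟨some none, .inr l⟩ => Γ.newLeaf (.par A B) (.inr (.inl l))
  | .inr ⟨none, .inl l⟩ => Γ.newLeaf (.par A B) (.inl (.inr l))
  | .inr ⟨none, .inr l⟩ => Γ.newLeaf (.par A B) (.inr (.inr l))

/-- Where the leaves come from when the cut of `∀x A` is replaced by the cut of `A`. -/
def allLeaf (Γ : CutSequent L) (x : ℕ) (A : Formula L) :
    (Γ.addCut A).Leaf → (Γ.addCut (.all x A)).Leaf
  | .inl l => .inl l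
  | .inr ⟨some k, l⟩ => .inr ⟨some k, l⟩
  | .inr ⟨none, l⟩ => Γ.newLeaf (.all x A) l

/-- Where the leaves come from when the cut of `∃x A` is replaced by the cut of `A`. -/
def exLeaf (Γ : CutSequent L) (x : ℕ) (A : Formula L) :
    (Γ.addCut A).Leaf → (Γ.addCut (.ex x A)).Leaf
  | .inl l => .inl l
  | .inr ⟨some k, l⟩ => .inr ⟨some k, l⟩
  | .inr ⟨none, l⟩ => Γ.newLeaf (.ex x A) l

end CutSequent

open CutSequent in
/-- One step of cut reduction, from a linking on a cut sequent to a linking on a cut sequent.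
A cut is unordered, so each compound redex is given with either of its two cut formulas as the
one that names the cut. -/
inductive CutReduction {L : FirstOrder.Language.{u, v}} [PredDuality L] :
    (Δ : CutSequent L) → Set (Sym2 Δ.Leaf) → (Δ' : CutSequent L) → Set (Sym2 Δ'.Leaf) → Prop
  /-- The leaves `a` and `d`, linked to the two leaves of an atomic cut, become linked. -/
  | atomic (Γ : CutSequent L) {n : ℕ} (R : L.Relations n) (ts : Fin n → L.Term ℕ)
      (θ : Set (Sym2 (Γ.addCut (.atom R ts)).Leaf)) (a d : Γ.Leaf)
      (hab : s(Γ.oldLeaf (.atom R ts) a, Γ.newLeaf (.atom R ts) (.inl ())) ∈ θ)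
      (hcd : s(Γ.newLeaf (.atom R ts) (.inr ()), Γ.oldLeaf (.atom R ts) d) ∈ θ) :
      CutReduction (Γ.addCut (.atom R ts)) θ Γ
        ({e | e.map (Γ.oldLeaf (.atom R ts)) ∈ θ} ∪ {s(a, d)})
  | tensor (Γ : CutSequent L) (A B : Formula L) (θ : Set (Sym2 (Γ.addCut (.tensor A B)).Leaf)) :
      CutReduction (Γ.addCut (.tensor A B)) θ ((Γ.addCut A).addCut B)
        {e | e.map (Γ.tensorLeaf A B) ∈ θ}
  | par (Γ : CutSequent L) (A B : Formula L) (θ : Set (Sym2 (Γ.addCut (.par A B)).Leaf)) :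
      CutReduction (Γ.addCut (.par A B)) θ ((Γ.addCut A).addCut B)
        {e | e.map (Γ.parLeaf A B) ∈ θ}
  | all (Γ : CutSequent L) (x : ℕ) (A : Formula L) (θ : Set (Sym2 (Γ.addCut (.all x A)).Leaf)) :
      CutReduction (Γ.addCut (.all x A)) θ (Γ.addCut A) {e | e.map (Γ.allLeaf x A) ∈ θ}
  | ex (Γ : CutSequent L) (x : ℕ) (A : Formula L) (θ : Set (Sym2 (Γ.addCut (.ex x A)).Leaf)) :
      CutReduction (Γ.addCut (.ex x A)) θ (Γ.addCut A) {e | e.map (Γ.exLeaf x A) ∈ θ}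
  /-- The indices that name the formulas and cuts of a cut sequent are immaterial. -/
  | reindex (Δ Δ' : CutSequent L) (θ : Set (Sym2 Δ.Leaf)) (θ' : Set (Sym2 Δ'.Leaf))
      {ι κ ι' κ' : Type} (e : ι ≃ Δ.ι) (f : κ ≃ Δ.κ) (e' : ι' ≃ Δ'.ι) (f' : κ' ≃ Δ'.κ) :
      CutReduction Δ θ Δ' θ' →
      CutReduction (Δ.reindex e f) {l | l.map (Δ.reindexLeaf e f) ∈ θ}
        (Δ'.reindex e' f') {l | l.map (Δ'.reindexLeaf e' f') ∈ θ'}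

end UNet

/-! All switchings of a linking have the same number of edges (`IsSwitching.ncard_eq`). A linking is
therefore correct exactly when it has a unifier, its switchings have one edge less than there are
vertices (`Balanced`), and they are all connected (`AllConn`); see `Correct.balanced_and_allConn`
and `correct_of_allConn`. The count is governed by `Formula.excess`, which is additive over the
formulas of a sequent (`balanced_iff`). A multiplicative or quantifier reduction changes neither the
total excess nor the number of links, and an atomic one lowers both by one. What remains is to find
a unifier, to control the leaps, and to prove connectivity.

Unifiers and leaps are handled together. A universal variable in a term of the mgu persists in every
instance, so any single unifier bounds the leaps from above (`unifier_transfer`). It thus suffices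
to turn an mgu from before the reduction into some unifier after it. For atomic and multiplicative
cuts renaming is enough, and every new leap comes from an old one (`precedes_transfer`). For a
quantifier cut, the universal variable of the cut is replaced by the term assigned to the
existential one (`quant_transfer`). That term does not contain the universal variable, since such a
leap would close a cycle through the tensor of the cut (`not_precedes_of_conn`). A leap from `u` to
`w` may then be new, but only if `u` leapt to the universal quantifier of the cut and the
existential one leapt to `w`.

Connectivity after an atomic reduction follows by contracting the cut onto one leaf (`conn_of_map`).
For a quantifier cut, the composite leaps are first added to the old graph without losing
connectivity, by an exchange argument that uses only the edge count (`Sparse.conn_exchange`,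
`Sparse.conn_augment`), and then the quantifiers of the cut are contracted. For a multiplicative
cut, the two arguments of the par are joined by a path avoiding the par, because choosing either one
must connect it to the rest and a tree has no spare edge. This path joins the two new cuts
(`Sparse.conn_split`).

The existence of an mgu is needed because leaps are defined by one. It is obtained without a
unification algorithm, as the least general generalization of the family of all unifiers
(`exists_isMGU`). -/

namespace UNet

open FirstOrder.Language (Term)

/-! ### Substitution in terms -/

section Terms

variable {L : FirstOrder.Language.{u, v}} {W W' W'' : Type*}

/-- The set of variables of a term. -/
def vars : L.Term W → Set W
  | .var x => {x}
  | .func _ ts => ⋃ i, vars (ts i)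

@[simp] theorem vars_var (x : W) : vars (.var x : L.Term W) = {x} := rfl

@[simp] theorem vars_func {n : ℕ} (f : L.Functions n) (ts : Fin n → L.Term W) :
    vars (.func f ts) = ⋃ i, vars (ts i) := rfl

theorem coe_varFinset [DecidableEq W] (t : L.Term W) : (t.varFinset : Set W) = vars t := by
  induction t with
  | var => simp
  | func f ts ih => simp [ih]

theorem finite_vars (t : L.Term W) : (vars t).Finite := by
  classical
  rw [← coe_varFinset]
  exact Finset.finite_toSet _

theorem occurs_iff {W : Type} {x : W} {t : L.Term W} : Occurs x t ↔ x ∈ vars t := by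
  classical
  rw [Occurs, ← coe_varFinset, Finset.mem_coe]

theorem mem_vars_subst {t : L.Term W} {σ : W → L.Term W'} {y : W'} :
    y ∈ vars (t.subst σ) ↔ ∃ x ∈ vars t, y ∈ vars (σ x) := by
  induction t with
  | var => simp [Term.subst]
  | func f ts ih =>
    simp only [Term.subst, vars_func, Set.mem_iUnion, ih]
    exact ⟨fun ⟨i, x, h, h'⟩ => ⟨x, ⟨i, h⟩, h'⟩, fun ⟨x, ⟨i, h⟩, h'⟩ => ⟨i, x, h, h'⟩⟩

theorem relabel_eq_subst (t : L.Term W) (g : W → W') :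
    t.relabel g = t.subst fun x => .var (g x) := by
  induction t with
  | var => rfl
  | func f ts ih => simp [Term.subst, ih]

theorem mem_vars_relabel {t : L.Term W} {g : W → W'} {y : W'} :
    y ∈ vars (t.relabel g) ↔ ∃ x ∈ vars t, y = g x := by
  simp [relabel_eq_subst, mem_vars_subst]

theorem subst_congr {t : L.Term W} {σ τ : W → L.Term W'} (h : ∀ x ∈ vars t, σ x = τ x) :
    t.subst σ = t.subst τ := by
  induction t with
  | var => exact h _ rfl
  | func f ts ih =>
    simp only [Term.subst, Term.func.injEq, heq_eq_eq, true_and]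
    exact funext fun i => ih i fun x hx => h x (Set.mem_iUnion.2 ⟨i, hx⟩)

theorem subst_subst (t : L.Term W) (σ : W → L.Term W') (τ : W' → L.Term W'') :
    (t.subst σ).subst τ = t.subst fun x => (σ x).subst τ := by
  induction t with
  | var => rfl
  | func f ts ih => simp [Term.subst, ih]

theorem subst_var (t : L.Term W) : t.subst Term.var = t := by
  induction t with
  | var => rfl
  | func f ts ih => simp [Term.subst, ih]

theorem relabel_subst (t : L.Term W) (g : W → W') (σ : W' → L.Term W'') :
    (t.relabel g).subst σ = t.subst fun x => σ (g x) := by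
  rw [relabel_eq_subst, subst_subst]
  rfl

end Terms

/-! ### Least general generalizations and most general unifiers -/

section Generalization

variable {L : FirstOrder.Language.{u, v}} {W U : Type*}

open Classical in
/-- The least general generalization of the family `F` of terms, by recursion on one member of
the family. A position at which the heads disagree becomes a variable named by the subterms
at that position. -/
noncomputable def lgg : L.Term W → (U → L.Term W) → L.Term (W ⊕ (U → L.Term W))
  | .var x, F => if ∀ i, F i = .var x then .var (.inl x) else .var (.inr F)
  | .func f ts, F =>
    if h : ∃ G : _ → U → L.Term W, ∀ i, F i = .func f fun j => G j i then
      .func f fun j => lgg (ts j) (h.choose j)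
    else .var (.inr F)

/-- An invented variable is itself a family of subterms, so evaluating each family at `i` undoes the
generalization. The term `t` only steers the recursion and need not belong to the family. -/
theorem lgg_subst (t : L.Term W) (F : U → L.Term W) (i : U) :
    (lgg t F).subst (Sum.elim Term.var fun G => G i) = F i := by
  induction t generalizing F with
  | var x =>
    rw [lgg]
    split_ifs with h
    · simp [Term.subst, h]
    · simp [Term.subst]
  | func f ts ih =>
    rw [lgg]
    split_ifs with h
    · simp [Term.subst, ih, ← h.choose_spec]
    · simp [Term.subst]

theorem lgg_const (i : U) (F : U → L.Term W) {x : W} (h : ∀ i, F i = .var x) :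
    lgg (F i) F = .var (.inl x) := by
  rw [h i, lgg, if_pos h]

/-- All instances of `t` share the heads of `t`, so disagreements occur only below its variables.
Consequently an equation solved by every member of a family of substitutions is solved by their
generalization: both sides are then the generalization of the same family. -/
theorem lgg_map_subst (i : U) (σ : U → W → L.Term W) (t : L.Term W) :
    lgg (t.subst (σ i)) (fun j => t.subst (σ j)) =
      t.subst fun x => lgg (σ i x) fun j => σ j x := by
  induction t with
  | var => rfl
  | func f ts ih =>
    simp only [Term.subst]
    have h : ∃ G : _ → U → L.Term W, ∀ i,
        (Term.func f fun j => (ts j).subst (σ i)) = .func f fun j => G j i :=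
      ⟨fun j i => (ts j).subst (σ i), fun _ => rfl⟩
    rw [lgg, dif_pos h]
    have h' : h.choose = fun j i => (ts j).subst (σ i) := by
      funext j i
      have := h.choose_spec i
      simp only [Term.func.injEq, heq_eq_eq, true_and] at this
      exact (congrFun this j).symm
    simp only [h', ih]

/-- Original variables are fixed by every evaluation of the invented ones, so they survive into each
member. This keeps the generalization of unifiers within the free and universal variables. -/
theorem vars_lgg_inl {t : L.Term W} {F : U → L.Term W} {x : W} (h : Sum.inl x ∈ vars (lgg t F))
    (i : U) : x ∈ vars (F i) := by
  rw [← lgg_subst t F i, mem_vars_subst]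
  exact ⟨_, h, by simp⟩

end Generalization

/-! ### Existence of most general unifiers -/

section MGU

variable {L : FirstOrder.Language.{u, v}} {ι : Type} {Γ : ι → Formula L}

theorem map_subst_congr {W W' : Type*} {l : List (L.Term W)} {σ τ : W → L.Term W'}
    (h : ∀ t ∈ l, ∀ x ∈ vars t, σ x = τ x) :
    l.map (fun t => t.subst σ) = l.map (fun t => t.subst τ) :=
  List.map_congr_left fun t ht => subst_congr (h t ht)

theorem IsExVar.not_isConstVar {x : SVar Γ} (h : IsExVar Γ x) : ¬ IsConstVar Γ x := by
  rcases x with n | w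
  · exact h.elim
  · intro h'
    have h1 : kindOf Γ w = .ex := h.1
    have h2 : kindOf Γ w = .all := h'
    rw [h1] at h2
    cases h2

-- The candidate is the generalization of all unifiers at once, with its invented variables renamed
-- to fresh free variables. It unifies because generalization commutes with substitution, and
-- evaluating the invented variables at a given unifier recovers that unifier.
open Classical in
theorem exists_isMGU [Finite (SVertex Γ)] {θ : Set (Sym2 (SLeaf Γ))}
    (h : ∃ σ, IsUnifier Γ θ σ) : ∃ σ, IsMGU Γ θ σ := by
  obtain ⟨σ₀, h₀⟩ := h
  let U := {σ // IsUnifier Γ θ σ}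
  let u₀ : U := ⟨σ₀, h₀⟩
  let Λ : SVar Γ → L.Term (SVar Γ ⊕ (U → L.Term (SVar Γ))) :=
    fun x => lgg (u₀.1 x) fun u : U => u.1 x
  have hΛ : ∀ x, ¬ IsExVar Γ x → Λ x = .var (.inl x) := fun x hx =>
    lgg_const u₀ (fun u : U => u.1 x) fun u => u.2.fixes x hx
  -- Finiteness of the sequent enters here: only finitely many names are in use, so invented
  -- variables can be given distinct natural numbers that are not among them.
  have hfin : (⋃ w : SVertex Γ, vars (Λ (.inr w))).Finite :=
    Set.finite_iUnion fun w => finite_vars _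
  have hmem : ∀ x, IsExVar Γ x → vars (Λ x) ⊆ ⋃ w : SVertex Γ, vars (Λ (.inr w)) := by
    rintro (n | w) hx
    · exact hx.elim
    · exact Set.subset_iUnion (fun w : SVertex Γ => vars (Λ (.inr w))) w
  generalize hV : (⋃ w : SVertex Γ, vars (Λ (.inr w))) = V at hfin hmem
  let N : Set ℕ := {n | Sum.inl (Sum.inl n) ∈ V}
  have hN : N.Finite := hfin.preimage fun a _ b _ hab => by simpa using hab
  let Z : Set (U → L.Term (SVar Γ)) := {F | Sum.inr F ∈ V}
  have hZ : Z.Finite := hfin.preimage fun a _ b _ hab => by simpa using hab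
  obtain ⟨r₀, hr₀⟩ := Set.countable_iff_exists_injOn.1 hZ.countable
  obtain ⟨M, hM⟩ := hN.bddAbove
  -- The shift by `M + 1` puts all new names above the free variables that already occur.
  let r : (U → L.Term (SVar Γ)) → ℕ := fun F => r₀ F + (M + 1)
  have hr : Set.InjOn r Z := fun F hF G hG hFG => hr₀ hF hG (by simpa [r] using hFG)
  have hrN : ∀ F, r F ∉ N := fun F hF => by
    have := hM hF
    simp only [r] at this
    omega
  let δ : SVar Γ ⊕ (U → L.Term (SVar Γ)) → L.Term (SVar Γ) :=
    Sum.elim Term.var fun F => .var (.inl (r F))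
  have hfix : ∀ x, ¬ IsExVar Γ x → (Λ x).subst δ = .var x := fun x hx => by
    rw [hΛ x hx]
    rfl
  refine ⟨fun x => (Λ x).subst δ, ⟨hfix, ?_, ?_⟩, ?_⟩
  · intro x hx y hy
    rw [occurs_iff, mem_vars_subst] at hy
    obtain ⟨z, hz, hyz⟩ := hy
    rcases z with z | F
    · obtain rfl : y = z := by simpa [δ] using hyz
      exact h₀.range x hx y (occurs_iff.2 (vars_lgg_inl hz u₀))
    · obtain rfl : y = Sum.inl (r F) := by simpa [δ] using hyz
      trivial
  · intro l l' hl
    have key : ∀ l : SLeaf Γ, (argsOf Γ l).map (fun t => t.subst fun x => (Λ x).subst δ) =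
        (argsOf Γ l).map fun t => (lgg (t.subst u₀.1) fun u : U => t.subst u.1).subst δ := by
      intro l
      refine List.map_congr_left fun t _ => ?_
      rw [lgg_map_subst u₀ (fun u : U => u.1), subst_subst]
    rw [key, key]
    have heq := fun u : U => u.2.equalizes l l' hl
    refine List.ext_getElem ?_ fun i hi hi' => ?_
    · simpa using congrArg List.length (heq u₀)
    · simp only [List.getElem_map]
      have : ∀ u : U, ((argsOf Γ l)[i]'(by simpa using hi)).subst u.1 =
          ((argsOf Γ l')[i]'(by simpa using hi')).subst u.1 := fun u => by
        have := List.getElem_of_eq (heq u) (i := i) (by simpa using hi)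
        simpa using this
      simp only [this]
  · intro τ hτ
    let u : U := ⟨τ, hτ⟩
    -- A name of an invented variable is sent to the component of that family at `u`; every other
    -- free variable is left alone.
    refine ⟨fun n => if h : ∃ F ∈ Z, r F = n then h.choose u else .var (.inl n), ?_⟩
    intro x hx
    rw [subst_subst]
    conv_rhs => rw [show τ x = u.1 x from rfl, ← lgg_subst (u₀.1 x) (fun u : U => u.1 x) u]
    refine subst_congr fun z hz => ?_
    rcases z with (n | w) | F
    · have hn : ¬ ∃ F ∈ Z, r F = n := fun ⟨F, _, hF⟩ => hrN F (hF ▸ hmem x hx hz)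
      simp [δ, Term.subst, hn]
    · simp [δ, Term.subst]
    · have hF : ∃ G ∈ Z, r G = r F := ⟨F, hmem x hx hz, rfl⟩
      have : hF.choose = F := hr hF.choose_spec.1 (hmem x hx hz) hF.choose_spec.2
      simp [δ, Term.subst, hF, this]

end MGU

/-! ### Graphs with switched vertices -/

section Graphs

variable {V V' : Type}

/-- Connectivity: the equivalence relation generated by the edges. -/
abbrev Conn (r : V → V → Prop) : V → V → Prop := Relation.EqvGen r

theorem Conn.mono {r s : V → V → Prop} (h : ∀ a b, r a b → Conn s a b) {a b : V}
    (hab : Conn r a b) : Conn s a b := by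
  induction hab with
  | rel _ _ h' => exact h _ _ h'
  | refl => exact .refl _
  | symm _ _ _ ih => exact ih.symm
  | trans _ _ _ _ _ ih ih' => exact ih.trans _ _ _ ih'

theorem Conn.map {r : V → V → Prop} {s : V' → V' → Prop} (f : V → V')
    (h : ∀ a b, r a b → Conn s (f a) (f b)) {a b : V} (hab : Conn r a b) : Conn s (f a) (f b) := by
  induction hab with
  | rel _ _ h' => exact h _ _ h'
  | refl => exact .refl _
  | symm _ _ _ ih => exact ih.symm
  | trans _ _ _ _ _ ih ih' => exact ih.trans _ _ _ ih'

/-- Connectivity after adding one edge. -/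
theorem Conn.of_insert {r : V → V → Prop} {a b x y : V}
    (h : Conn (fun u v => r u v ∨ (u = a ∧ v = b)) x y) :
    Conn r x y ∨ (Conn r x a ∧ Conn r b y) ∨ (Conn r x b ∧ Conn r a y) := by
  induction h with
  | rel x y h =>
    rcases h with h | ⟨rfl, rfl⟩
    · exact .inl (.rel _ _ h)
    · exact .inr (.inl ⟨.refl _, .refl _⟩)
  | refl => exact .inl (.refl _)
  | symm x y _ ih =>
    rcases ih with h | ⟨h, h'⟩ | ⟨h, h'⟩
    · exact .inl h.symm
    · exact .inr (.inr ⟨h'.symm, h.symm⟩)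
    · exact .inr (.inl ⟨h'.symm, h.symm⟩)
  | trans x y z _ _ ih ih' =>
    rcases ih with h | ⟨h, h'⟩ | ⟨h, h'⟩ <;> rcases ih' with k | ⟨k, k'⟩ | ⟨k, k'⟩
    · exact .inl (h.trans _ _ _ k)
    · exact .inr (.inl ⟨h.trans _ _ _ k, k'⟩)
    · exact .inr (.inr ⟨h.trans _ _ _ k, k'⟩)
    · exact .inr (.inl ⟨h, h'.trans _ _ _ k⟩)
    · exact .inr (.inl ⟨h, k'⟩)
    · exact .inl (h.trans _ _ _ k')
    · exact .inr (.inr ⟨h, h'.trans _ _ _ k⟩)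
    · exact .inl (h.trans _ _ _ k')
    · exact .inr (.inr ⟨h, k'⟩)

/-- A connected multigraph has at least as many edges as vertices, minus one. -/
theorem card_le_of_conn [Finite V] [Nonempty V] {r : V → V → Prop} (h : ∀ a b, Conn r a b)
    (E : Finset (Sym2 V)) (hE : ∀ a b, r a b → s(a, b) ∈ E) : Nat.card V ≤ E.card + 1 := by
  classical
  have hc : (SimpleGraph.fromEdgeSet (E : Set (Sym2 V))).Connected := by
    refine ⟨fun a b => ?_⟩
    have := h a b
    induction this with
    | rel a b hab =>
      by_cases hne : a = b
      · rw [hne]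
      · exact SimpleGraph.Adj.reachable ((SimpleGraph.fromEdgeSet_adj _).2 ⟨hE _ _ hab, hne⟩)
    | refl => exact .refl _
    | symm _ _ _ ih => exact ih.symm
    | trans _ _ _ _ _ ih ih' => exact ih.trans ih'
  refine hc.card_vert_le_card_edgeSet_add_one.trans (Nat.add_le_add_right ?_ 1)
  rw [Nat.card_coe_set_eq, ← Set.ncard_coe_finset E]
  refine Set.ncard_le_ncard ?_ (Finset.finite_toSet E)
  rw [SimpleGraph.edgeSet_fromEdgeSet]
  exact Set.sdiff_subset

/-- The edges of a switching: the fixed edges and, for each switched vertex `v`, the edge from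
`c v` to `v`. -/
def SwAdj (F : V → V → Prop) (Sw : V → Prop) (c : V → V) (a b : V) : Prop :=
  F a b ∨ (Sw b ∧ a = c b)

/-- The number of fixed edges and of switched vertices is at most that of the edges of a tree. -/
def Sparse (F : V → V → Prop) (Sw : V → Prop) : Prop :=
  ∃ E : Finset (Sym2 V), (∀ a b, F a b → s(a, b) ∈ E) ∧
    E.card + {v | Sw v}.ncard + 1 ≤ Nat.card V

/-- Removing the edge into `w` from a switching with few edges leaves a disconnected graph. -/
theorem Sparse.not_conn [Finite V] {F : V → V → Prop} {Sw : V → Prop} (h : Sparse F Sw)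
    (c : V → V) {w : V} (hw : Sw w) :
    ¬ ∀ a b, Conn (SwAdj F (fun v => Sw v ∧ v ≠ w) c) a b := by
  classical
  intro hc
  obtain ⟨E, hE, hcard⟩ := h
  have : Nonempty V := ⟨w⟩
  have := Fintype.ofFinite V
  let W : Finset V := Finset.univ.filter fun v => Sw v ∧ v ≠ w
  -- The fixed edges together with one edge into each switched vertex other than `w` number at most
  -- `Nat.card V - 2`, too few to connect the graph.
  have h1 := card_le_of_conn hc (E ∪ W.image fun v => s(c v, v)) (by
    rintro a b (hab | ⟨hb, rfl⟩)
    · exact Finset.mem_union_left _ (hE _ _ hab)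
    · exact Finset.mem_union_right _ (Finset.mem_image.2 ⟨b, by simpa [W] using hb, rfl⟩))
  have h2 := Finset.card_union_le E (W.image fun v => s(c v, v))
  have h3 : (W.image fun v => s(c v, v)).card ≤ W.card := Finset.card_image_le
  have h4 : W.card < {v | Sw v}.ncard := by
    rw [← Set.ncard_coe_finset]
    refine Set.ncard_lt_ncard ⟨fun v hv => ?_, fun hsub => ?_⟩ (Set.toFinite _)
    · simp only [W, Finset.coe_filter, Finset.mem_univ, true_and, Set.mem_ofPred_eq] at hv
      exact hv.1
    · have := hsub hw
      simp [W] at this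
  omega

/-- The edges of a switching, split into those not into `w` and the one into `w`. -/
theorem SwAdj.conn_split {F : V → V → Prop} {Sw : V → Prop} {c c' : V → V} {w : V}
    (hc : ∀ v, v ≠ w → c v = c' v) {a b : V} (h : Conn (SwAdj F Sw c) a b) :
    Conn (fun u v => SwAdj F (fun v => Sw v ∧ v ≠ w) c' u v ∨ (u = c w ∧ v = w)) a b := by
  refine h.mono ?_
  rintro u v (h | ⟨h, rfl⟩)
  · exact .rel _ _ (.inl (.inl h))
  · by_cases hv : v = w
    · subst hv
      exact .rel _ _ (.inr ⟨rfl, rfl⟩)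
    · exact .rel _ _ (.inl (.inr ⟨⟨h, hv⟩, hc v hv⟩))

/-! ### Exchange of edges between switched vertices -/

section Augment

variable [Finite V] {F : V → V → Prop} {Sw : V → Prop}

open Function (update) in
open Classical in
/-- Exchange: if `x` is joined to the switched vertex `y` by fixed edges, then the edge into `w`
from `x` can be replaced by an edge from any `z` that may be chosen for `y`. -/
theorem Sparse.conn_exchange (hs : Sparse F Sw) {x y z w : V} (hy : Sw y) (hw : Sw w) (hyw : y ≠ w)
    (hxy : Conn F x y) {c : V → V}
    (h0 : ∀ a b, Conn (SwAdj F Sw (update c w x)) a b)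
    (h1 : ∀ a b, Conn (SwAdj F Sw (update (update c w x) y z)) a b) (hz : c w = z) :
    ∀ a b, Conn (SwAdj F Sw c) a b := by
  have mono : ∀ {S S' : V → Prop} {c' : V → V}, (∀ v, S v → S' v) → ∀ {a b},
      Conn (SwAdj F S c') a b → Conn (SwAdj F S' c') a b := fun hS _ _ h =>
    h.mono fun u v huv => .rel _ _ (huv.imp id fun h => ⟨hS _ h.1, h.2⟩)
  -- `G` has neither edge into `y` nor edge into `w`
  let G := SwAdj F (fun v => (Sw v ∧ v ≠ w) ∧ v ≠ y) c
  let Gp := SwAdj F (fun v => Sw v ∧ v ≠ w) c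
  have fixG : Conn G x y := hxy.mono fun u v h => .rel _ _ (.inl h)
  have GGp : ∀ {a b}, Conn G a b → Conn Gp a b := fun h => mono (fun v hv => hv.1) h
  have hGp : ∀ {a b}, Conn Gp a b → Conn G a b ∨ (Conn G a (c y) ∧ Conn G y b) ∨
      (Conn G a y ∧ Conn G (c y) b) := by
    intro a b h
    exact Conn.of_insert (SwAdj.conn_split (w := y) (c' := c) (fun _ _ => rfl) h)
  -- `Gp` is disconnected, but adding the edge from `x` to `w` connects it. Hence it has two
  -- components, one with `x` and one with `w`.
  have hnp : ¬ ∀ a b, Conn Gp a b := hs.not_conn c hw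
  have h0' : ∀ a b, Conn Gp a b ∨ (Conn Gp a x ∧ Conn Gp w b) ∨ (Conn Gp a w ∧ Conn Gp x b) := by
    intro a b
    have := SwAdj.conn_split (w := w) (c' := c) (fun v hv => by simp [hv]) (h0 a b)
    simp only [Function.update_self] at this
    exact this.of_insert
  -- If `z` lies on the side of `x`, the edge from `z` to `w` bridges the two components just as the
  -- edge from `x` did. The other side is impossible.
  by_cases hzx : Conn Gp z x
  · intro a b
    have hxw : Conn (SwAdj F Sw c) x w :=
      ((mono (fun v hv => hv.1) hzx).symm).trans _ _ _ (.rel _ _ (.inr ⟨hw, hz.symm⟩))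
    rcases h0' a b with h | ⟨h, h'⟩ | ⟨h, h'⟩
    · exact mono (fun v hv => hv.1) h
    · exact (mono (fun v hv => hv.1) h).trans _ _ _ (hxw.trans _ _ _ (mono (fun v hv => hv.1) h'))
    · exact (mono (fun v hv => hv.1) h).trans _ _ _
        (hxw.symm.trans _ _ _ (mono (fun v hv => hv.1) h'))
  · exfalso
    have hzw : Conn Gp z w := by
      rcases h0' z x with h | ⟨h, _⟩ | ⟨h, _⟩
      · exact (hzx h).elim
      · exact (hzx h).elim
      · exact h
    -- The path from `z` to `w` is examined at the edge into `y`. If it avoids this edge, then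
    -- continuing along `w`, `x`, `y` shows that the edge from `z` to `y` is redundant in the second
    -- given switching. If it crosses towards `w`, then `x` reaches `w` through `y` inside `Gp`. If
    -- it reaches `y` first, then `z` reaches `x`.
    rcases hGp hzw with h | ⟨_, h⟩ | ⟨h, _⟩
    · refine hs.not_conn (update c w x) hy fun a b => ?_
      have e : Conn (SwAdj F (fun v => Sw v ∧ v ≠ y) (update c w x)) z y := by
        have m : ∀ {a b}, Conn G a b → Conn (SwAdj F (fun v => Sw v ∧ v ≠ y) (update c w x)) a b :=
          fun h => h.mono fun u v huv => .rel _ _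
            (huv.imp id fun h => ⟨⟨h.1.1.1, h.1.2⟩, by simp [h.1.1.2, h.2]⟩)
        have hwx : Conn (SwAdj F (fun v => Sw v ∧ v ≠ y) (update c w x)) x w :=
          .rel _ _ (.inr ⟨⟨hw, hyw.symm⟩, by simp⟩)
        exact (m h).trans _ _ _ (hwx.symm.trans _ _ _ (m fixG))
      have := SwAdj.conn_split (w := y) (c' := update c w x) (fun v hv => by simp [hv]) (h1 a b)
      simp only [Function.update_self] at this
      refine this.mono ?_
      rintro u v (h | ⟨rfl, rfl⟩)
      · exact .rel _ _ h
      · exact e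
    · refine hnp fun a b => ?_
      have hxw : Conn Gp x w := GGp (fixG.trans _ _ _ h)
      rcases h0' a b with h | ⟨h, h'⟩ | ⟨h, h'⟩
      · exact h
      · exact h.trans _ _ _ (hxw.trans _ _ _ h')
      · exact h.trans _ _ _ (hxw.symm.trans _ _ _ h')
    · exact hzx (GGp (h.trans _ _ _ fixG.symm))

open Classical in
/-- If all switchings are connected and `x` is joined to the switched vertex `y` by fixed edges,
then all switchings remain connected when an edge into `w` from any source of an edge into `y` is
added whenever there is an edge from `x` into `w`. -/
theorem Sparse.conn_augment (hs : Sparse F Sw) {x y : V} (hy : Sw y) (hxy : Conn F x y)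
    {In : V → V → Prop} (hall : ∀ c, (∀ w, Sw w → In (c w) w) → ∀ a b, Conn (SwAdj F Sw c) a b)
    (c : V → V) (hc : ∀ w, Sw w → In (c w) w ∨ (In (c w) y ∧ In x w)) :
    ∀ a b, Conn (SwAdj F Sw c) a b := by
  induction hn : {w | Sw w ∧ ¬ In (c w) w}.ncard using Nat.strong_induction_on generalizing c with
  | _ n ih =>
    by_cases hbad : ∃ w, Sw w ∧ ¬ In (c w) w
    · obtain ⟨w, hw, hcw⟩ := hbad
      obtain ⟨hz, hxw⟩ := (hc w hw).resolve_left hcw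
      -- Sources of `y` are admissible for `y`, so the bad vertex is not `y` itself.
      have hyw : y ≠ w := fun h => hcw (h ▸ hz)
      have step : ∀ c' : V → V, (∀ v, Sw v → c' v = c v ∨ In (c' v) v) → In (c' w) w →
          ∀ a b, Conn (SwAdj F Sw c') a b := by
        intro c' h h'
        refine ih _ ?_ c' (fun v hv => ?_) rfl
        · rw [← hn]
          refine Set.ncard_lt_ncard ⟨fun v hv => ?_, fun hsub => ?_⟩ (Set.toFinite _)
          · rcases h v hv.1 with h | h
            · exact ⟨hv.1, h ▸ hv.2⟩
            · exact (hv.2 h).elim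
          · exact (hsub ⟨hw, hcw⟩ : Sw w ∧ ¬ In (c' w) w).2 h'
        · rcases h v hv with h | h
          · rw [h]
            exact hc v hv
          · exact .inl h
      -- Both auxiliary switchings give `w` the admissible source `x`. The second also gives `y` the
      -- source `c w`, admissible there, so both have fewer bad vertices and fall under the
      -- induction hypothesis.
      refine hs.conn_exchange hy hw hyw hxy (step _ ?_ ?_) (step _ ?_ ?_) rfl
      · intro v _
        by_cases hv : v = w
        · subst hv
          simp [hxw]
        · simp [hv]
      · simpa using hxw
      · intro v _
        by_cases hv : v = w
        · subst hv
          simp [hxw, hyw.symm]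
        · by_cases hv' : v = y
          · subst hv'
            simp [hz]
          · simp [hv, hv']
      · simpa [hyw.symm] using hxw
    · push Not at hbad
      exact hall c hbad

end Augment

/-- Transfer of connectivity along a map of vertices `f` and a map of sources of edges `g`. -/
theorem conn_of_map {F : V → V → Prop} {Sw : V → Prop} {In : V → V → Prop} {F' : V' → V' → Prop}
    {Sw' : V' → Prop} {In' : V' → V' → Prop} (f : V → V') (g : V' → V)
    (hall : ∀ c, (∀ w, Sw w → In (c w) w) → ∀ a b, Conn (SwAdj F Sw c) a b)
    (hF : ∀ a b, F a b → Conn F' (f a) (f b)) (hg : ∀ a, Conn F' a (f (g a)))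
    (hsw : ∀ w, Sw w → (∃ a, In a w ∧ Conn F' (f a) (f w)) ∨
      (Sw' (f w) ∧ ∀ a, In' a (f w) → In (g a) w))
    (c' : V' → V') (hc' : ∀ w, Sw' w → In' (c' w) w) :
    ∀ a b, Conn (SwAdj F' Sw' c') a b := by
  have hF' : ∀ {a b}, Conn F' a b → Conn (SwAdj F' Sw' c') a b := fun h =>
    h.mono fun u v huv => .rel _ _ (.inl huv)
  -- The choice `c'` is pulled back vertex by vertex. A switched vertex that is contracted away
  -- receives a source whose edge collapses to a fixed path.
  have hex : ∀ w, ∃ a, Sw w → In a w ∧ Conn (SwAdj F' Sw' c') (f a) (f w) := by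
    intro w
    by_cases hw : Sw w
    · rcases hsw w hw with ⟨a, ha, hc⟩ | ⟨hw', h⟩
      · exact ⟨a, fun _ => ⟨ha, hF' hc⟩⟩
      · exact ⟨g (c' (f w)), fun _ => ⟨h _ (hc' _ hw'),
          (hF' (hg _)).symm.trans _ _ _ (.rel _ _ (.inr ⟨hw', rfl⟩))⟩⟩
    · exact ⟨w, fun h => (hw h).elim⟩
  choose c hc using hex
  intro a b
  refine (hF' (hg a)).trans _ _ _ (.trans _ _ _ ?_ (hF' (hg b)).symm)
  refine (hall c (fun w hw => (hc w hw).1) (g a) (g b)).map f ?_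
  rintro u v (h | ⟨h, rfl⟩)
  · exact hF' (hF _ _ h)
  · exact (hc v h).2

open Classical in
/-- Transfer of connectivity when a vertex is split in two. The vertex `p` has two possible
sources `a₀` and `b₀`; the vertices in `K` are joined to `p` by fixed edges, and are
replaced by vertices joined to one of the vertices `ta`, `tb`, to which
`a₀` and `b₀`, respectively, are now joined. -/
theorem Sparse.conn_split [Finite V] {F : V → V → Prop} {Sw : V → Prop} {In : V → V → Prop}
    {F' : V' → V' → Prop} {Sw' : V' → Prop} {In' : V' → V' → Prop} (hs : Sparse F Sw)
    (f : V → V') (g : V' → V) (K : V → Prop) {p a₀ b₀ : V} {ta tb : V'}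
    (hall : ∀ c, (∀ w, Sw w → In (c w) w) → ∀ a b, Conn (SwAdj F Sw c) a b)
    (hp : Sw p) (hK : ∀ a, K a → Conn F a p) (ha₀ : In a₀ p) (hb₀ : In b₀ p)
    (hfa : Conn F' (f a₀) ta) (hfb : Conn F' (f b₀) tb)
    (hfp : Conn (fun u v => F' u v ∨ (u = ta ∧ v = tb)) (f p) ta)
    (hF : ∀ a b, F a b → Conn (fun u v => F' u v ∨ (u = ta ∧ v = tb)) (f a) (f b))
    (hFK : ∀ a b, F a b → ¬ K a → ¬ K b → Conn F' (f a) (f b))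
    (hg : ∀ a, Conn (fun u v => F' u v ∨ (u = ta ∧ v = tb)) a (f (g a)))
    (hgK : ∀ a, ¬ K (g a) → f (g a) = a)
    (hsw : ∀ w, Sw w → w ≠ p → Sw' (f w) ∧ ∀ a, In' a (f w) → In (g a) w)
    (c' : V' → V') (hc' : ∀ w, Sw' w → In' (c' w) w) :
    ∀ a b, Conn (SwAdj F' Sw' c') a b := by
  have hF' : ∀ {a b}, Conn F' a b → Conn (SwAdj F' Sw' c') a b := fun h =>
    h.mono fun u v huv => .rel _ _ (.inl huv)
  -- The pulled-back switching with the source of `p` left as a parameter, so that both arguments of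
  -- `p` can be tried.
  let c : V → V → V := fun q w => if w = p then q else g (c' (f w))
  have hc : ∀ q, In q p → ∀ w, Sw w → In (c q w) w := by
    intro q hq w hw
    by_cases h : w = p
    · subst h
      simpa [c] using hq
    · simpa [c, h] using (hsw w hw h).2 _ (hc' _ (hsw w hw h).1)
  let H := SwAdj F (fun v => Sw v ∧ v ≠ p) (c a₀)
  have hH : ∀ q, In q p → ∀ a b, Conn (fun u v => H u v ∨ (u = q ∧ v = p)) a b := by
    intro q hq a b
    have := SwAdj.conn_split (w := p) (c' := c a₀) (fun v hv => by simp [c, hv])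
      (hall (c q) (hc q hq) a b)
    simpa [c] using this
  have hHn : ¬ ∀ a b, Conn H a b := hs.not_conn (c a₀) hp
  -- A source of `p` already joined to `p` would make the edge into `p` redundant, contrary to
  -- sparsity. Hence both sources lie in the component of `H` that does not contain `p`.
  have hnp : ∀ q, In q p → ¬ Conn H q p := by
    intro q hq hqp
    refine hHn fun a b => (hH q hq a b).mono ?_
    rintro u v (h | ⟨rfl, rfl⟩)
    · exact .rel _ _ h
    · exact hqp
  -- the two sources are joined without passing through `p`
  have hab : Conn H a₀ b₀ := by
    rcases (hH a₀ ha₀ a₀ b₀).of_insert with h | ⟨_, h⟩ | ⟨h, _⟩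
    · exact h
    · exact (hnp b₀ hb₀ h.symm).elim
    · exact (hnp a₀ ha₀ h).elim
  -- A path in a component without `p` meets no vertex of `K`, so it maps to the split graph without
  -- assuming that `ta` and `tb` are joined.
  have key : ∀ {a b}, Conn H a b → ¬ Conn H a p → Conn (SwAdj F' Sw' c') (f a) (f b) := by
    have hnK : ∀ a, ¬ Conn H a p → ¬ K a := fun a ha hk =>
      ha ((hK a hk).mono fun u v huv => .rel _ _ (.inl huv))
    intro a b h
    induction h with
    | rel u v h =>
      intro hu
      have hv : ¬ Conn H v p := fun hv => hu (.trans _ _ _ (.rel _ _ h) hv)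
      rcases h with h | ⟨⟨hsv, hvp⟩, rfl⟩
      · exact hF' (hFK _ _ h (hnK _ hu) (hnK _ hv))
      · have h1 := hnK _ hu
        simp only [c, if_neg hvp] at h1 ⊢
        rw [hgK _ h1]
        exact .rel _ _ (.inr ⟨(hsw v hsv hvp).1, rfl⟩)
    | refl => exact fun _ => .refl _
    | symm u v h ih => exact fun hv => (ih fun hu => hv (h.symm.trans _ _ _ hu)).symm
    | trans u v w h h' ih ih' =>
      exact fun hu => (ih hu).trans _ _ _ (ih' fun hv => hu (h.trans _ _ _ hv))
  -- Mapping the path between the two sources joins `ta` to `tb`. From here on the auxiliary edge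
  -- between them may be used freely.
  have htab : Conn (SwAdj F' Sw' c') ta tb :=
    (hF' hfa).symm.trans _ _ _ ((key hab (hnp _ ha₀)).trans _ _ _ (hF' hfb))
  have hQ : ∀ {a b}, Conn (fun u v => F' u v ∨ (u = ta ∧ v = tb)) a b →
      Conn (SwAdj F' Sw' c') a b := by
    intro a b h
    refine h.mono ?_
    rintro u v (h | ⟨rfl, rfl⟩)
    · exact .rel _ _ (.inl h)
    · exact htab
  intro a b
  refine (hQ (hg a)).trans _ _ _ (.trans _ _ _ ?_ (hQ (hg b)).symm)
  refine (hall (c a₀) (hc a₀ ha₀) (g a) (g b)).map f ?_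
  rintro u v (h | ⟨h, rfl⟩)
  · exact hQ (hF _ _ h)
  · by_cases hv : v = p
    · subst hv
      simp only [c, if_true]
      exact (hF' hfa).trans _ _ _ (hQ hfp).symm
    · simp only [c, if_neg hv]
      exact (hQ (hg _)).symm.trans _ _ _ (.rel _ _ (.inr ⟨(hsw v h hv).1, rfl⟩))

end Graphs

/-! ### Counting vertices and edges -/

namespace Formula

variable {L : FirstOrder.Language.{u, v}}

noncomputable instance fintypeVertex : (A : Formula L) → Fintype A.Vertex
  | atom _ _ => inferInstanceAs (Fintype Unit)
  | tensor A B | par A B =>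
    letI := fintypeVertex A
    letI := fintypeVertex B
    inferInstanceAs (Fintype (Option (A.Vertex ⊕ B.Vertex)))
  | all _ A | ex _ A =>
    letI := fintypeVertex A
    inferInstanceAs (Fintype (Option A.Vertex))

instance finite_leaf : (A : Formula L) → Finite A.Leaf
  | atom _ _ => inferInstanceAs (Finite Unit)
  | tensor A B | par A B =>
    letI := finite_leaf A
    letI := finite_leaf B
    inferInstanceAs (Finite (A.Leaf ⊕ B.Leaf))
  | all _ A | ex _ A => finite_leaf A

theorem leafVertex_injective (A : Formula L) : Function.Injective A.leafVertex := by
  induction A with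
  | atom => exact fun _ _ _ => rfl
  | tensor A B ihA ihB | par A B ihA ihB =>
    rintro (l | l) (l' | l') h
    · exact congrArg Sum.inl (ihA (Sum.inl_injective (Option.some_injective _ h)))
    · cases Option.some_injective _ h
    · cases Option.some_injective _ h
    · exact congrArg Sum.inr (ihB (Sum.inr_injective (Option.some_injective _ h)))
  | all x A ih | ex x A ih => exact fun l l' h => ih (Option.some_injective _ h)

end Formula

/-- The number of arguments of a vertex. -/
def Kind.argCount : Kind → ℕ
  | leaf => 0
  | tensor => 2
  | par => 2
  | all => 1
  | ex => 1

/-- The number of edges into a vertex that belong to a switching. -/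
def Kind.weight : Kind → ℕ
  | leaf => 0
  | tensor => 2
  | par => 1
  | all => 1
  | ex => 1

namespace Formula

variable {L : FirstOrder.Language.{u, v}}

theorem ncard_isArg (A : Formula L) (b : A.Vertex) :
    {a | A.IsArg a b}.ncard = (A.kind b).argCount := by
  induction A with
  | atom R ts =>
    have : {a | (atom R ts).IsArg a b} = ∅ := Set.eq_empty_of_forall_notMem fun a h => h
    rw [this, Set.ncard_empty]
    rfl
  | tensor A B ihA ihB | par A B ihA ihB =>
    rcases b with _ | b | b
    · refine Eq.trans (congrArg Set.ncard (a₂ := {some (.inl A.root), some (.inr B.root)}) ?_)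
        (Set.ncard_pair fun h => by cases Option.some_injective _ h)
      ext a
      rcases a with _ | a | a
      · exact ⟨False.elim, fun h => by rcases h with h | h <;> cases h⟩
      · refine ⟨fun h => .inl (congrArg (fun a => some (Sum.inl a)) h), fun h => ?_⟩
        rcases h with h | h
        · exact Sum.inl_injective (Option.some_injective _ h)
        · cases Option.some_injective _ h
      · refine ⟨fun h => .inr (congrArg (fun a => some (Sum.inr a)) h), fun h => ?_⟩
        rcases h with h | h
        · cases Option.some_injective _ h
        · exact Sum.inr_injective (Option.some_injective _ h)
    · refine Eq.trans ?_ (ihA b)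
      rw [← Set.ncard_image_of_injective {a | A.IsArg a b}
        ((Option.some_injective _).comp (Sum.inl_injective (β := B.Vertex)))]
      refine congrArg Set.ncard ?_
      ext a
      rcases a with _ | a | a
      · exact ⟨False.elim, fun ⟨_, _, h⟩ => by cases h⟩
      · refine ⟨fun h => ⟨a, h, rfl⟩, fun ⟨a', h, e⟩ => ?_⟩
        obtain rfl : a' = a := Sum.inl_injective (Option.some_injective _ e)
        exact h
      · exact ⟨False.elim, fun ⟨_, _, h⟩ => by cases Option.some_injective _ h⟩
    · refine Eq.trans ?_ (ihB b)
      rw [← Set.ncard_image_of_injective {a | B.IsArg a b}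
        ((Option.some_injective _).comp (Sum.inr_injective (α := A.Vertex)))]
      refine congrArg Set.ncard ?_
      ext a
      rcases a with _ | a | a
      · exact ⟨False.elim, fun ⟨_, _, h⟩ => by cases h⟩
      · exact ⟨False.elim, fun ⟨_, _, h⟩ => by cases Option.some_injective _ h⟩
      · refine ⟨fun h => ⟨a, h, rfl⟩, fun ⟨a', h, e⟩ => ?_⟩
        obtain rfl : a' = a := Sum.inr_injective (Option.some_injective _ e)
        exact h
  | all x A ih | ex x A ih =>
    rcases b with _ | b
    · refine Eq.trans (congrArg Set.ncard (a₂ := {some A.root}) ?_) (Set.ncard_singleton _)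
      ext a
      rcases a with _ | a
      · exact ⟨False.elim, fun h => by cases h⟩
      · exact ⟨fun h => congrArg some h, fun h => Option.some_injective _ h⟩
    · refine Eq.trans ?_ (ih b)
      rw [← Set.ncard_image_of_injective {a | A.IsArg a b} (Option.some_injective _)]
      refine congrArg Set.ncard ?_
      ext a
      rcases a with _ | a
      · exact ⟨False.elim, fun ⟨_, _, h⟩ => by cases h⟩
      · refine ⟨fun h => ⟨a, h, rfl⟩, fun ⟨a', h, e⟩ => ?_⟩
        obtain rfl : a' = a := Option.some_injective _ e
        exact h

/-- The number of vertices minus the number of edges of the parse tree that belong to a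
switching. -/
def excess : Formula L → ℤ
  | atom _ _ => 1
  | tensor A B => A.excess + B.excess - 1
  | par A B => A.excess + B.excess
  | all _ A => A.excess
  | ex _ A => A.excess

/-- Expressing the vertex and edge count as a sum over vertices makes it additive over subformulas,
so the effect of a reduction can be read off the formulas alone. -/
theorem sum_weight (A : Formula L) :
    ∑ w : A.Vertex, (1 - ((A.kind w).weight : ℤ)) = A.excess := by
  induction A with
  | atom => rfl
  | tensor A B ihA ihB =>
    refine (Fintype.sum_option _).trans ((congrArg₂ (· + ·) rfl (Fintype.sum_sum_type _)).trans ?_)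
    simp only [excess, ← ihA, ← ihB, kind, Kind.weight]
    push_cast
    ring
  | par A B ihA ihB =>
    refine (Fintype.sum_option _).trans ((congrArg₂ (· + ·) rfl (Fintype.sum_sum_type _)).trans ?_)
    simp only [excess, ← ihA, ← ihB, kind, Kind.weight]
    push_cast
    ring
  | all x A ih | ex x A ih =>
    refine (Fintype.sum_option _).trans ?_
    simp only [excess, ← ih, kind, Kind.weight]
    push_cast
    ring

end Formula

/-! ### Correctness in terms of connectivity -/

section Sequent

variable {L : FirstOrder.Language.{u, v}} {ι : Type} (Γ : ι → Formula L)

/-- The edges of the forest of a sequent. -/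
def SArg (a b : SVertex Γ) : Prop :=
  ∃ i, ∃ a' b' : (Γ i).Vertex, (Γ i).IsArg a' b' ∧ a = ⟨i, a'⟩ ∧ b = ⟨i, b'⟩

variable {Γ} in
theorem sArg_mk {i : ι} {a b : (Γ i).Vertex} : SArg Γ ⟨i, a⟩ ⟨i, b⟩ ↔ (Γ i).IsArg a b := by
  refine ⟨?_, fun h => ⟨i, a, b, h, rfl, rfl⟩⟩
  rintro ⟨j, a', b', h, e, e'⟩
  cases e
  cases e'
  exact h

theorem SArg.fst_eq {a b : SVertex Γ} (h : SArg Γ a b) : a.1 = b.1 := by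
  obtain ⟨i, a', b', -, rfl, rfl⟩ := h
  rfl

theorem vertexOf_injective : Function.Injective (vertexOf Γ) := by
  rintro ⟨i, l⟩ ⟨j, l'⟩ h
  obtain rfl : i = j := congrArg Sigma.fst h
  have : (Γ i).leafVertex l = (Γ i).leafVertex l' := by
    simpa [vertexOf] using h
  rw [(Γ i).leafVertex_injective this]

theorem ncard_sArg (b : SVertex Γ) : {a | SArg Γ a b}.ncard = (kindOf Γ b).argCount := by
  obtain ⟨i, b⟩ := b
  change _ = ((Γ i).kind b).argCount
  rw [← Formula.ncard_isArg, ← Set.ncard_image_of_injective {a | (Γ i).IsArg a b}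
    (sigma_mk_injective (β := fun i => (Γ i).Vertex) (i := i))]
  refine congrArg Set.ncard ?_
  ext ⟨j, a⟩
  constructor
  · intro h
    obtain rfl : j = i := SArg.fst_eq Γ h
    exact ⟨a, sArg_mk.1 h, rfl⟩
  · rintro ⟨a', h, e⟩
    cases e
    exact sArg_mk.2 h

theorem exists_sArg {b : SVertex Γ} (hb : IsSwitched Γ b) : ∃ a, SArg Γ a b := by
  refine Set.nonempty_of_ncard_ne_zero (s := {a | SArg Γ a b}) ?_
  rw [ncard_sArg]
  rcases hb with h | h <;> rw [h] <;> decide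

instance {V : Type} [Finite V] : Finite (Edge V) :=
  Finite.of_surjective (α := (V × V) ⊕ (V × V) ⊕ Sym2 V)
    (Sum.elim (fun p => .arg p.1 p.2) (Sum.elim (fun p => .leap p.1 p.2) .link)) fun e => by
      rcases e with ⟨a, b⟩ | ⟨a, b⟩ | e
      · exact ⟨.inl (a, b), rfl⟩
      · exact ⟨.inr (.inl (a, b)), rfl⟩
      · exact ⟨.inr (.inr e), rfl⟩

variable {Γ}

theorem inGraph_arg_iff {θ : Set (Sym2 (SLeaf Γ))} {a b : SVertex Γ} :
    InGraph Γ θ (.arg a b) ↔ SArg Γ a b := by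
  constructor
  · rintro ⟨i, a, b, h⟩
    exact ⟨i, a, b, h, rfl, rfl⟩
  · rintro ⟨i, a, b, h, rfl, rfl⟩
    exact .arg i a b h

theorem inGraph_leap_iff {θ : Set (Sym2 (SLeaf Γ))} {a b : SVertex Γ} :
    InGraph Γ θ (.leap a b) ↔ Precedes Γ θ a b :=
  ⟨fun | .leap _ _ h => h, .leap a b⟩

theorem inGraph_link_iff {θ : Set (Sym2 (SLeaf Γ))} {e : Sym2 (SVertex Γ)} :
    InGraph Γ θ (.link e) ↔ e ∈ Sym2.map (vertexOf Γ) '' θ :=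
  ⟨fun | .link e h => ⟨e, h, rfl⟩, fun ⟨e, h, he⟩ => he ▸ .link e h⟩

theorem Precedes.isSwitched {θ : Set (Sym2 (SLeaf Γ))} {a b : SVertex Γ} (h : Precedes Γ θ a b) :
    IsSwitched Γ b := .inr h.2.1

theorem IsSwitched.weight {w : SVertex Γ} (h : IsSwitched Γ w) : (kindOf Γ w).weight = 1 := by
  rcases h with h | h <;> rw [h] <;> rfl

theorem argCount_eq_weight {w : SVertex Γ} (h : ¬ IsSwitched Γ w) :
    (kindOf Γ w).argCount = (kindOf Γ w).weight := by
  unfold IsSwitched at h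
  cases hk : kindOf Γ w <;> simp_all [Kind.argCount, Kind.weight]

-- Edges are counted by target. Those without target are the links, an unswitched vertex receives
-- exactly its argument edges, and a switched vertex receives exactly one edge. Leaps do not affect
-- the count because they only enter switched vertices.
open Classical in
theorem IsSwitching.ncard_eq [Fintype (SVertex Γ)] {θ : Set (Sym2 (SLeaf Γ))}
    {S : Set (Edge (SVertex Γ))} (hS : IsSwitching Γ θ S) :
    S.ncard = θ.ncard + ∑ w, (kindOf Γ w).weight := by
  have := Fintype.ofFinite (Edge (SVertex Γ))
  have hfib : ∀ o : Option (SVertex Γ), (S.toFinset.filter fun e => e.target = o).card =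
      {e | e ∈ S ∧ e.target = o}.ncard := fun o => by
    rw [← Set.ncard_coe_finset]
    congr 1
    ext e
    simp
  rw [Set.ncard_eq_toFinset_card', Finset.card_eq_sum_card_fiberwise (f := Edge.target)
    (t := Finset.univ) fun _ _ => Finset.mem_coe.2 (Finset.mem_univ _), Fintype.sum_option]
  simp only [hfib]
  congr 1
  · have : {e | e ∈ S ∧ e.target = none} = (fun e => Edge.link (Sym2.map (vertexOf Γ) e)) '' θ := by
      ext e
      constructor
      · rintro ⟨he, ht⟩
        rcases e with ⟨a, b⟩ | ⟨a, b⟩ | e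
        · cases ht
        · cases ht
        · obtain ⟨e', h, rfl⟩ := inGraph_link_iff.1 (hS.sub _ he)
          exact ⟨e', h, rfl⟩
      · rintro ⟨e, he, rfl⟩
        exact ⟨hS.keep _ (.link e he) fun w h => (by cases h), rfl⟩
    rw [this, Set.ncard_image_of_injective]
    intro e e' h
    exact Sym2.map.injective (vertexOf_injective Γ) (Edge.link.inj h)
  · refine Finset.sum_congr rfl fun w _ => ?_
    by_cases hw : IsSwitched Γ w
    · rw [hw.weight, Set.ncard_eq_one]
      obtain ⟨e, he, h⟩ := hS.one w hw
      exact ⟨e, Set.ext fun e' => ⟨fun h' => h e' h', fun h' => (h' : e' = e) ▸ he⟩⟩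
    · rw [← argCount_eq_weight hw, ← ncard_sArg]
      have : {e | e ∈ S ∧ e.target = some w} = (fun a => Edge.arg a w) '' {a | SArg Γ a w} := by
        ext e
        constructor
        · rintro ⟨he, ht⟩
          rcases e with ⟨a, b⟩ | ⟨a, b⟩ | e
          · obtain rfl : b = w := Option.some_injective _ ht
            exact ⟨a, inGraph_arg_iff.1 (hS.sub _ he), rfl⟩
          · obtain rfl : b = w := Option.some_injective _ ht
            exact (hw (inGraph_leap_iff.1 (hS.sub _ he)).isSwitched).elim
          · cases ht
        · rintro ⟨a, ha, rfl⟩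
          refine ⟨hS.keep _ (inGraph_arg_iff.2 ha) fun v hv => ?_, rfl⟩
          obtain rfl : w = v := Option.some_injective _ hv
          exact hw
      rw [this, Set.ncard_image_of_injective _ fun a b h => (Edge.arg.inj h).1]

variable (Γ) in
/-- The edges that belong to every switching. -/
def Fixed (θ : Set (Sym2 (SLeaf Γ))) (a b : SVertex Γ) : Prop :=
  (SArg Γ a b ∧ ¬ IsSwitched Γ b) ∨ ∃ l l', s(l, l') ∈ θ ∧ a = vertexOf Γ l ∧ b = vertexOf Γ l'

variable (Γ) in
/-- The possible sources of the edges into a switched vertex. -/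
def Source (θ : Set (Sym2 (SLeaf Γ))) (a b : SVertex Γ) : Prop :=
  SArg Γ a b ∨ Precedes Γ θ a b

variable (Γ) in
/-- The numerical part of correctness: a switching has one edge less than there are vertices. -/
def Balanced [Fintype (SVertex Γ)] (θ : Set (Sym2 (SLeaf Γ))) : Prop :=
  Fintype.card (SVertex Γ) = θ.ncard + ∑ w, (kindOf Γ w).weight + 1

variable (Γ) in
/-- All switchings are connected. -/
def AllConn (θ : Set (Sym2 (SLeaf Γ))) : Prop :=
  ∀ c : SVertex Γ → SVertex Γ, (∀ w, IsSwitched Γ w → Source Γ θ (c w) w) →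
    ∀ a b, Conn (SwAdj (Fixed Γ θ) (IsSwitched Γ) c) a b

theorem Fixed.symm_link {θ : Set (Sym2 (SLeaf Γ))} {a b : SVertex Γ}
    (h : s(a, b) ∈ Sym2.map (vertexOf Γ) '' θ) : Fixed Γ θ a b := by
  obtain ⟨e, he, h⟩ := h
  induction e using Sym2.ind with
  | _ l l' =>
    rw [Sym2.map_mk, Sym2.eq_iff] at h
    rcases h with ⟨h, h'⟩ | ⟨h, h'⟩
    · exact .inr ⟨l, l', he, h.symm, h'.symm⟩
    · exact .inr ⟨l', l, Sym2.eq_swap (a := l) ▸ he, h'.symm, h.symm⟩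

/-- Only an upper bound on the fixed edges is needed, so possible coincidences of their pairs of
ends need not be excluded. -/
theorem Balanced.sparse [Fintype (SVertex Γ)] {θ : Set (Sym2 (SLeaf Γ))} (h : Balanced Γ θ)
    [Finite (SLeaf Γ)] : Sparse (Fixed Γ θ) (IsSwitched Γ) := by
  classical
  have := Fintype.ofFinite (SLeaf Γ)
  let E : Finset (Sym2 (SVertex Γ)) := θ.toFinset.image (Sym2.map (vertexOf Γ)) ∪
    (Finset.univ.filter fun w => ¬ IsSwitched Γ w).biUnion fun w =>
      (Finset.univ.filter fun a => SArg Γ a w).image fun a => s(a, w)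
  refine ⟨E, ?_, ?_⟩
  · rintro a b (⟨h, hb⟩ | ⟨l, l', h, rfl, rfl⟩)
    · exact Finset.mem_union_right _ (Finset.mem_biUnion.2 ⟨b, by simpa using hb,
        Finset.mem_image.2 ⟨a, by simpa using h, rfl⟩⟩)
    · exact Finset.mem_union_left _ (Finset.mem_image.2 ⟨s(l, l'), by simpa using h, rfl⟩)
  · have h1 : (θ.toFinset.image (Sym2.map (vertexOf Γ))).card ≤ θ.ncard := by
      rw [Set.ncard_eq_toFinset_card']
      exact Finset.card_image_le
    have h2 : ((Finset.univ.filter fun w => ¬ IsSwitched Γ w).biUnion fun w =>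
        (Finset.univ.filter fun a => SArg Γ a w).image fun a => s(a, w)).card ≤
        ∑ w ∈ Finset.univ.filter (fun w => ¬ IsSwitched Γ w), (kindOf Γ w).weight := by
      refine Finset.card_biUnion_le.trans (Finset.sum_le_sum fun w hw => ?_)
      rw [← argCount_eq_weight (by simpa using hw), ← ncard_sArg]
      refine Finset.card_image_le.trans (le_of_eq ?_)
      rw [← Set.ncard_coe_finset]
      congr 1
      ext a
      simp
    have h3 : {w | IsSwitched Γ w}.ncard =
        ∑ w ∈ Finset.univ.filter (fun w => IsSwitched Γ w), (kindOf Γ w).weight := by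
      rw [Finset.sum_congr rfl fun w hw => (Finset.mem_filter.1 hw).2.weight,
        Finset.sum_const, smul_eq_mul, mul_one, ← Set.ncard_coe_finset]
      congr 1
      ext a
      simp
    have h4 := Finset.sum_filter_add_sum_filter_not Finset.univ (fun w => IsSwitched Γ w)
      fun w => (kindOf Γ w).weight
    have h5 := Finset.card_union_le (θ.toFinset.image (Sym2.map (vertexOf Γ)))
      ((Finset.univ.filter fun w => ¬ IsSwitched Γ w).biUnion fun w =>
        (Finset.univ.filter fun a => SArg Γ a w).image fun a => s(a, w))
    rw [Nat.card_eq_fintype_card]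
    unfold Balanced at h
    simp only [E]
    omega

open Classical in
/-- The switching given by a choice of sources. -/
theorem exists_isSwitching {θ : Set (Sym2 (SLeaf Γ))} {c : SVertex Γ → SVertex Γ}
    (hc : ∀ w, IsSwitched Γ w → Source Γ θ (c w) w) :
    ∃ S, IsSwitching Γ θ S ∧ ∀ e ∈ S, ∀ a b, e.ends = s(a, b) →
      Conn (SwAdj (Fixed Γ θ) (IsSwitched Γ) c) a b := by
  -- A source may be an argument of `w` and also leap to `w`. The two edges have the same ends, so
  -- preferring the argument edge does not affect connectivity.
  let pick : SVertex Γ → Edge (SVertex Γ) := fun w =>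
    if SArg Γ (c w) w then .arg (c w) w else .leap (c w) w
  have hpt : ∀ w, (pick w).target = some w := fun w => by
    simp only [pick]
    split_ifs <;> rfl
  have hpe : ∀ w, (pick w).ends = s(c w, w) := fun w => by
    simp only [pick]
    split_ifs <;> rfl
  refine ⟨{e | InGraph Γ θ e ∧ ∀ w, e.target = some w → IsSwitched Γ w → e = pick w},
    ⟨fun e he => he.1, fun e he h => ⟨he, fun w hw hs => (h w hw hs).elim⟩, fun w hw => ?_⟩, ?_⟩
  · refine ⟨pick w, ⟨⟨?_, fun v hv _ => ?_⟩, hpt w⟩, fun e he => he.1.2 w he.2 hw⟩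
    · simp only [pick]
      split_ifs with h
      · exact inGraph_arg_iff.2 h
      · exact inGraph_leap_iff.2 ((hc w hw).resolve_left h)
    · rw [hpt] at hv
      rw [Option.some_injective _ hv]
  · have sym : ∀ {x y a b : SVertex Γ}, s(x, y) = s(a, b) →
        Conn (SwAdj (Fixed Γ θ) (IsSwitched Γ) c) x y →
        Conn (SwAdj (Fixed Γ θ) (IsSwitched Γ) c) a b := by
      intro x y a b h hxy
      rcases Sym2.eq_iff.1 h with ⟨rfl, rfl⟩ | ⟨rfl, rfl⟩
      · exact hxy
      · exact hxy.symm
    rintro e ⟨he, hp⟩ a b hab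
    by_cases ht : ∃ w, e.target = some w ∧ IsSwitched Γ w
    · obtain ⟨w, hw, hs⟩ := ht
      rw [hp w hw hs, hpe] at hab
      exact sym hab (.rel _ _ (.inr ⟨hs, rfl⟩))
    · rcases e with ⟨x, y⟩ | ⟨x, y⟩ | e
      · exact sym hab (.rel _ _ (.inl (.inl ⟨inGraph_arg_iff.1 he, fun h => ht ⟨y, rfl, h⟩⟩)))
      · exact (ht ⟨y, rfl, (inGraph_leap_iff.1 he).isSwitched⟩).elim
      · exact .rel _ _ (.inl (Fixed.symm_link ((hab : e = _) ▸ inGraph_link_iff.1 he)))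

theorem not_isArg_self (A : Formula L) (a : A.Vertex) : ¬ A.IsArg a a := by
  induction A with
  | atom => exact id
  | tensor A B ihA ihB | par A B ihA ihB =>
    rcases a with _ | a | a
    · exact id
    · exact ihA a
    · exact ihB a
  | all x A ih | ex x A ih =>
    rcases a with _ | a
    · exact id
    · exact ih a

/-- `SimpleGraph.fromEdgeSet` discards loops silently. Excluding them makes the edge set of the
simple graph agree with that of the switching. -/
theorem InGraph.not_isDiag {θ : Set (Sym2 (SLeaf Γ))} (hθ : ∀ l, s(l, l) ∉ θ)
    {e : Edge (SVertex Γ)} (he : InGraph Γ θ e) : ¬ e.ends.IsDiag := by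
  rcases he with ⟨i, a, b, h⟩ | ⟨x, y, h⟩ | ⟨e, h⟩
  · intro hd
    have : (⟨i, a⟩ : SVertex Γ) = ⟨i, b⟩ := Sym2.mk_isDiag_iff.1 hd
    cases this
    exact not_isArg_self _ _ h
  · intro hd
    obtain rfl : x = y := Sym2.mk_isDiag_iff.1 hd
    have h1 := h.1.1
    rw [h.2.1] at h1
    cases h1
  · intro hd
    induction e using Sym2.ind with
    | _ l l' =>
      have h' : vertexOf Γ l = vertexOf Γ l' := Sym2.mk_isDiag_iff.1 hd
      rw [vertexOf_injective Γ h'] at h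
      exact hθ _ h

/-- Every switched vertex has an argument, so at least one switching exists. Since its size is that
of every switching, this one tree fixes the count. -/
theorem Correct.balanced_and_allConn [Fintype (SVertex Γ)] {θ : Set (Sym2 (SLeaf Γ))}
    (hθ : ∀ l, s(l, l) ∉ θ) (h : Correct Γ θ) : Balanced Γ θ ∧ AllConn Γ θ := by
  classical
  constructor
  · have : ∀ w, ∃ a, IsSwitched Γ w → Source Γ θ a w := fun w => by
      by_cases hw : IsSwitched Γ w
      · obtain ⟨a, ha⟩ := exists_sArg Γ hw
        exact ⟨a, fun _ => .inl ha⟩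
      · exact ⟨w, fun h => (hw h).elim⟩
    choose c hc using this
    obtain ⟨S, hS, -⟩ := exists_isSwitching hc
    have htree := h.2 S hS
    have hcard := (SimpleGraph.isTree_iff_connected_and_card.1 htree.2).2
    rw [Nat.card_coe_set_eq, SimpleGraph.edgeSet_fromEdgeSet, sdiff_eq_left.2,
      htree.1.ncard_image, hS.ncard_eq, Nat.card_eq_fintype_card] at hcard
    · exact hcard.symm
    · rw [Set.disjoint_left]
      rintro _ ⟨e, he, rfl⟩
      exact (hS.sub e he).not_isDiag hθ
  · intro c hc a b
    obtain ⟨S, hS, hconn⟩ := exists_isSwitching hc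
    obtain ⟨p⟩ := (h.2 S hS).2.connected.preconnected a b
    induction p with
    | nil => exact .refl _
    | cons hadj _ ih =>
      obtain ⟨⟨e, he, hab⟩, -⟩ := (SimpleGraph.fromEdgeSet_adj _).1 hadj
      exact (hconn e he _ _ hab).trans _ _ _ ih

/-- Connectivity bounds the number of distinct non-loop edges from below and the count bounds the
number of tagged edges from above. The bounds coincide, which excludes both parallel edges and
cycles. -/
theorem correct_of_allConn [Fintype (SVertex Γ)] {θ : Set (Sym2 (SLeaf Γ))}
    (hu : ∃ σ, IsUnifier Γ θ σ) (hb : Balanced Γ θ) (hconn : AllConn Γ θ) : Correct Γ θ := by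
  classical
  refine ⟨hu, fun S hS => ?_⟩
  have hex : ∀ w, ∃ a, IsSwitched Γ w → Source Γ θ a w ∧ s(a, w) ∈ Edge.ends '' S := by
    intro w
    by_cases hw : IsSwitched Γ w
    · obtain ⟨e, ⟨he, ht⟩, -⟩ := hS.one w hw
      rcases e with ⟨a, b⟩ | ⟨a, b⟩ | e
      · obtain rfl : b = w := Option.some_injective _ ht
        exact ⟨a, fun _ => ⟨.inl (inGraph_arg_iff.1 (hS.sub _ he)), _, he, rfl⟩⟩
      · obtain rfl : b = w := Option.some_injective _ ht
        exact ⟨a, fun _ => ⟨.inr (inGraph_leap_iff.1 (hS.sub _ he)), _, he, rfl⟩⟩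
      · cases ht
    · exact ⟨w, fun h => (hw h).elim⟩
  choose c hc using hex
  have hreach : ∀ {a b}, s(a, b) ∈ Edge.ends '' S →
      (SimpleGraph.fromEdgeSet (Edge.ends '' S)).Reachable a b := by
    intro a b h
    by_cases hne : a = b
    · rw [hne]
    · exact SimpleGraph.Adj.reachable ((SimpleGraph.fromEdgeSet_adj _).2 ⟨h, hne⟩)
  have : Nonempty (SVertex Γ) := Fintype.card_pos_iff.1 (by unfold Balanced at hb; omega)
  have hco : (SimpleGraph.fromEdgeSet (Edge.ends '' S)).Connected := by
    refine ⟨fun a b => ?_⟩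
    have := hconn c (fun w hw => (hc w hw).1) a b
    induction this with
    | rel a b hab =>
      rcases hab with (⟨h, hb⟩ | ⟨l, l', h, rfl, rfl⟩) | ⟨h, rfl⟩
      · refine hreach ⟨.arg a b, hS.keep _ (inGraph_arg_iff.2 h) fun w hw => ?_, rfl⟩
        obtain rfl : b = w := Option.some_injective _ hw
        exact hb
      · refine hreach ⟨.link s(vertexOf Γ l, vertexOf Γ l'), hS.keep _
          (InGraph.link s(l, l') h) fun w hw => ?_, rfl⟩
        cases hw
      · exact hreach (hc b h).2
    | refl => exact .refl _
    | symm _ _ _ ih => exact ih.symm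
    | trans _ _ _ _ _ ih ih' => exact ih.trans ih'
  have h1 := hco.card_vert_le_card_edgeSet_add_one
  have h2 : (SimpleGraph.fromEdgeSet (Edge.ends '' S)).edgeSet.ncard ≤ (Edge.ends '' S).ncard := by
    rw [SimpleGraph.edgeSet_fromEdgeSet]
    exact Set.ncard_le_ncard Set.sdiff_subset (Set.toFinite _)
  have h3 : (Edge.ends '' S).ncard ≤ S.ncard := Set.ncard_image_le (Set.toFinite _)
  have h4 := hS.ncard_eq
  unfold Balanced at hb
  rw [Nat.card_coe_set_eq, Nat.card_eq_fintype_card] at h1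
  refine ⟨Set.injOn_of_ncard_image_eq (by omega) (Set.toFinite _),
    SimpleGraph.isTree_iff_connected_and_card.2 ⟨hco, ?_⟩⟩
  rw [Nat.card_coe_set_eq, Nat.card_eq_fintype_card]
  omega

theorem balanced_iff [Fintype ι] {θ : Set (Sym2 (SLeaf Γ))} :
    Balanced Γ θ ↔ ∑ i, (Γ i).excess = θ.ncard + 1 := by
  have h : ∑ w : SVertex Γ, (1 - ((kindOf Γ w).weight : ℤ)) = ∑ i, (Γ i).excess := by
    rw [Fintype.sum_sigma]
    exact Finset.sum_congr rfl fun i _ => (Γ i).sum_weight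
  rw [← h, Finset.sum_sub_distrib, Balanced]
  simp only [Finset.sum_const, Finset.card_univ, nsmul_eq_mul, mul_one, ← Nat.cast_sum]
  omega

end Sequent

/-! ### Term sequences of leaves -/

namespace Formula

variable {L : FirstOrder.Language.{u, v}}

/-- Terms at the leaves depend only on the values of the free variables and of the quantifier
vertices. Comparing two namings and two substitutions at once lets one induction serve both renaming
and the transfer of unifiers. -/
theorem leafArgs_subst_congr {W W' : Type} {X : Type*} (A : Formula L) {ρ : ℕ → W} {ρ' : ℕ → W'}
    {q : A.Vertex → W} {q' : A.Vertex → W'} {σ : W → L.Term X} {σ' : W' → L.Term X}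
    (hρ : ∀ x ∈ A.fv, σ (ρ x) = σ' (ρ' x)) (hq : ∀ w, σ (q w) = σ' (q' w)) (l : A.Leaf) :
    (A.leafArgs ρ q l).map (fun t => t.subst σ) = (A.leafArgs ρ' q' l).map fun t => t.subst σ' := by
  induction A generalizing ρ ρ' with
  | atom R ts =>
    simp only [leafArgs, List.map_ofFn]
    congr 1
    funext i
    simp only [Function.comp_apply, relabel_subst]
    refine subst_congr fun x hx => hρ x ?_
    rw [fv, Finset.mem_biUnion]
    refine ⟨i, Finset.mem_univ _, ?_⟩
    rwa [← Finset.mem_coe, coe_varFinset]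
  | tensor A B ihA ihB | par A B ihA ihB =>
    rcases l with l | l
    · exact ihA (fun x hx => hρ x (Finset.mem_union_left _ hx)) (fun w => hq _) l
    · exact ihB (fun x hx => hρ x (Finset.mem_union_right _ hx)) (fun w => hq _) l
  | all y A ih | ex y A ih =>
    refine ih (fun x hx => ?_) (fun w => hq _) l
    by_cases hxy : x = y
    · subst hxy
      simpa using hq none
    · simpa [hxy] using hρ x (Finset.mem_erase.2 ⟨hxy, hx⟩)

theorem leafArgs_relabel {W W' : Type} (A : Formula L) {ρ : ℕ → W} {ρ' : ℕ → W'}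
    {q : A.Vertex → W} {q' : A.Vertex → W'} {g : W → W'} (hρ : ∀ x ∈ A.fv, g (ρ x) = ρ' x)
    (hq : ∀ w, g (q w) = q' w) (l : A.Leaf) :
    (A.leafArgs ρ q l).map (fun t => t.relabel g) = A.leafArgs ρ' q' l := by
  have := A.leafArgs_subst_congr (ρ := ρ) (ρ' := ρ') (q := q) (q' := q')
    (σ := fun x => (Term.var (g x) : L.Term W')) (σ' := Term.var)
    (fun x hx => congrArg _ (hρ x hx)) (fun w => congrArg _ (hq w)) l
  simpa only [subst_var, List.map_id', relabel_eq_subst] using this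

theorem mem_fv_or_of_mem_vars {W : Type} (A : Formula L) {ρ : ℕ → W} {q : A.Vertex → W} {l : A.Leaf}
    {t : L.Term W} (ht : t ∈ A.leafArgs ρ q l) {y : W} (hy : y ∈ vars t) :
    (∃ x ∈ A.fv, y = ρ x) ∨ ∃ w, (A.kind w = .all ∨ A.kind w = .ex) ∧ y = q w := by
  induction A generalizing ρ with
  | atom R ts =>
    obtain ⟨i, rfl⟩ := List.mem_ofFn.1 ht
    obtain ⟨x, hx, rfl⟩ := mem_vars_relabel.1 hy
    refine .inl ⟨x, ?_, rfl⟩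
    rw [fv, Finset.mem_biUnion]
    refine ⟨i, Finset.mem_univ _, ?_⟩
    rwa [← Finset.mem_coe, coe_varFinset]
  | tensor A B ihA ihB | par A B ihA ihB =>
    rcases l with l | l
    · rcases ihA ht with ⟨x, hx, h⟩ | ⟨w, hw, h⟩
      · exact .inl ⟨x, Finset.mem_union_left _ hx, h⟩
      · exact .inr ⟨some (.inl w), hw, h⟩
    · rcases ihB ht with ⟨x, hx, h⟩ | ⟨w, hw, h⟩
      · exact .inl ⟨x, Finset.mem_union_right _ hx, h⟩
      · exact .inr ⟨some (.inr w), hw, h⟩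
  | all z A ih =>
    rcases ih ht with ⟨x, hx, h⟩ | ⟨w, hw, h⟩
    · by_cases hxz : x = z
      · subst hxz
        exact .inr ⟨none, .inl rfl, by simpa using h⟩
      · exact .inl ⟨x, Finset.mem_erase.2 ⟨hxz, hx⟩, by simpa [hxz] using h⟩
    · exact .inr ⟨some w, hw, h⟩
  | ex z A ih =>
    rcases ih ht with ⟨x, hx, h⟩ | ⟨w, hw, h⟩
    · by_cases hxz : x = z
      · subst hxz
        exact .inr ⟨none, .inr rfl, by simpa using h⟩
      · exact .inl ⟨x, Finset.mem_erase.2 ⟨hxz, hx⟩, by simpa [hxz] using h⟩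
    · exact .inr ⟨some w, hw, h⟩

/-- This is what makes a quantifier over a free variable of its body non-vacuous. -/
theorem exists_leaf_of_mem_fv {W : Type} (A : Formula L) (ρ : ℕ → W) (q : A.Vertex → W) {x : ℕ}
    (hx : x ∈ A.fv) : ∃ l, ∃ t ∈ A.leafArgs ρ q l, ρ x ∈ vars t := by
  induction A generalizing ρ with
  | atom R ts =>
    rw [fv, Finset.mem_biUnion] at hx
    obtain ⟨i, -, hi⟩ := hx
    rw [← Finset.mem_coe, coe_varFinset] at hi
    exact ⟨(), _, List.mem_ofFn.2 ⟨i, rfl⟩, mem_vars_relabel.2 ⟨x, hi, rfl⟩⟩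
  | tensor A B ihA ihB | par A B ihA ihB =>
    rcases Finset.mem_union.1 hx with hx | hx
    · obtain ⟨l, h⟩ := ihA ρ (fun w => q (some (.inl w))) hx
      exact ⟨.inl l, h⟩
    · obtain ⟨l, h⟩ := ihB ρ (fun w => q (some (.inr w))) hx
      exact ⟨.inr l, h⟩
  | all z A ih | ex z A ih =>
    obtain ⟨hxz, hx⟩ := Finset.mem_erase.1 hx
    obtain ⟨l, h⟩ := ih (Function.update ρ z (q none)) (fun w => q (some w)) hx
    rw [Function.update_of_ne hxz] at h
    exact ⟨l, h⟩

end Formula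

/-! ### Transfer of unifiers and precedence -/

section Transfer

variable {L : FirstOrder.Language.{u, v}} {ι ι' : Type} {Γ : ι → Formula L} {Γ' : ι' → Formula L}

theorem isConstVar_or_isExVar {l : SLeaf Γ} {t : L.Term (SVar Γ)} (ht : t ∈ argsOf Γ l)
    {x : SVar Γ} (hx : x ∈ vars t) : IsConstVar Γ x ∨ IsExVar Γ x := by
  rcases (Γ l.1).mem_fv_or_of_mem_vars ht hx with ⟨n, -, rfl⟩ | ⟨w, hw | hw, rfl⟩
  · exact .inl trivial
  · exact .inl hw
  · exact .inr ⟨hw, l, t, ht, occurs_iff.2 hx⟩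

open Classical in
/-- A valuation of all variables that equalizes the links gives a unifier. -/
theorem IsUnifier.of_valuation {θ : Set (Sym2 (SLeaf Γ))} {v : SVar Γ → L.Term (SVar Γ)}
    (hc : ∀ x, IsConstVar Γ x → v x = .var x)
    (hr : ∀ x, IsExVar Γ x → ∀ y ∈ vars (v x), IsConstVar Γ y)
    (he : ∀ l l', s(l, l') ∈ θ →
      (argsOf Γ l).map (fun t => t.subst v) = (argsOf Γ l').map fun t => t.subst v) :
    IsUnifier Γ θ fun x => if IsExVar Γ x then v x else .var x := by
  have h : ∀ l : SLeaf Γ, (argsOf Γ l).map (fun t => t.subst fun x =>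
      if IsExVar Γ x then v x else .var x) = (argsOf Γ l).map fun t => t.subst v := fun l => by
    refine map_subst_congr fun t ht x hx => ?_
    split_ifs with hex
    · rfl
    · exact (hc x ((isConstVar_or_isExVar ht hx).resolve_right hex)).symm
  refine ⟨fun x hx => if_neg hx, fun x hx y hy => ?_, fun l l' hl => ?_⟩
  · rw [if_pos hx, occurs_iff] at hy
    exact hr x hx y hy
  · rw [h, h]
    exact he l l' hl

/-- A unifier of one linking, pushed forward along a substitution `κ` for its constants, gives a
unifier of another, and bounds the precedence relation. -/
theorem unifier_transfer {θ : Set (Sym2 (SLeaf Γ))} {θ' : Set (Sym2 (SLeaf Γ'))}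
    {σ : SVar Γ → L.Term (SVar Γ)} (hσ : IsUnifier Γ θ σ) (g : SVertex Γ' → SVertex Γ)
    (κ : SVar Γ → L.Term (SVar Γ'))
    (hall : ∀ w, kindOf Γ' w = .all → kindOf Γ (g w) = .all ∧ κ (.inr (g w)) = .var (.inr w))
    (hfree : ∀ n, κ (.inl n) = .var (.inl n))
    (hex : ∀ w, IsNonvacuousEx Γ' w → IsNonvacuousEx Γ (g w))
    (hκ : ∀ s, IsConstVar Γ s → ∀ y ∈ vars (κ s), IsConstVar Γ' y)
    (he : ∀ l l', s(l, l') ∈ θ' →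
      (argsOf Γ' l).map (fun t => t.subst fun x => (σ (Sum.map id g x)).subst κ) =
        (argsOf Γ' l').map fun t => t.subst fun x => (σ (Sum.map id g x)).subst κ) :
    (∃ τ, IsUnifier Γ' θ' τ) ∧ ∀ x y, Precedes Γ' θ' x y → IsNonvacuousEx Γ (g x) ∧
      ∃ s, IsConstVar Γ s ∧ s ∈ vars (σ (.inr (g x))) ∧ Sum.inr y ∈ vars (κ s) := by
  have hconst : ∀ {s}, IsConstVar Γ s → σ s = .var s := fun hs =>
    hσ.fixes _ fun h => h.not_isConstVar hs
  have hu := IsUnifier.of_valuation (θ := θ')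
    (v := fun x => (σ (Sum.map id g x)).subst κ) (fun x hx => ?_) (fun x hx y hy => ?_) he
  · refine ⟨⟨_, hu⟩, fun x y ⟨hx, hy, τ, hτ, hocc⟩ => ⟨hex x hx, ?_⟩⟩
    -- The constructed unifier is an instance of the mgu `τ`. Instantiating free variables cannot
    -- remove the universal variable `y`, so `y` must already occur in the constructed term.
    obtain ⟨r, hr⟩ := hτ.2 _ hu
    have hxe : IsExVar Γ' (.inr x) := hx
    have h1 := hr (.inr x) hxe
    rw [if_pos hxe] at h1
    have h2 : Sum.inr y ∈ vars ((σ (.inr (g x))).subst κ) := by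
      have h3 : Sum.inr y ∈ vars ((τ (Sum.inr x)).subst (Sum.elim r fun w => .var (.inr w))) :=
        mem_vars_subst.2 ⟨_, occurs_iff.1 hocc, rfl⟩
      rw [h1] at h3
      exact h3
    obtain ⟨s, hs, hys⟩ := mem_vars_subst.1 h2
    exact ⟨s, hσ.range (.inr (g x)) (hex x hx) s (occurs_iff.2 hs), hs, hys⟩
  · rcases x with n | w
    · change (σ (Sum.inl n)).subst κ = _
      rw [hconst (s := .inl n) trivial]
      exact hfree n
    · change (σ (Sum.inr (g w))).subst κ = _
      rw [hconst (s := .inr (g w)) (hall w hx).1]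
      exact (hall w hx).2
  · rcases x with n | w
    · exact hx.elim
    · obtain ⟨s, hs, hys⟩ := mem_vars_subst.1 hy
      exact hκ s (hσ.range (.inr (g w)) (hex w hx) s (occurs_iff.2 hs)) y hys

theorem IsMGU.precedes {θ : Set (Sym2 (SLeaf Γ))} {σ : SVar Γ → L.Term (SVar Γ)}
    (hσ : IsMGU Γ θ σ) {x y : SVertex Γ} (hx : IsNonvacuousEx Γ x) (hy : kindOf Γ y = .all)
    (h : Sum.inr y ∈ vars (σ (.inr x))) : Precedes Γ θ x y :=
  ⟨hx, hy, σ, hσ, occurs_iff.2 h⟩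

/-- Transfer along a map of leaves `m` and of variables `g` that is a bijection on universal
variables, with inverse `f`. -/
theorem precedes_transfer {θ : Set (Sym2 (SLeaf Γ))} {θ' : Set (Sym2 (SLeaf Γ'))}
    {σ : SVar Γ → L.Term (SVar Γ)} (hσ : IsMGU Γ θ σ) (f : SVertex Γ → SVertex Γ')
    (g : SVertex Γ' → SVertex Γ) (m : SLeaf Γ' → SLeaf Γ)
    (hkind : ∀ w, kindOf Γ' w = .all ∨ kindOf Γ' w = .ex → kindOf Γ (g w) = kindOf Γ' w)
    (hfg : ∀ w, kindOf Γ' w = .all → f (g w) = w)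
    (hgf : ∀ w, kindOf Γ w = .all → kindOf Γ' (f w) = .all ∧ g (f w) = w)
    (hargs : ∀ l, argsOf Γ (m l) = (argsOf Γ' l).map fun t => t.relabel (Sum.map id g))
    (he : ∀ l l', s(l, l') ∈ θ' → (argsOf Γ (m l)).map (fun t => t.subst σ) =
      (argsOf Γ (m l')).map fun t => t.subst σ) :
    (∃ τ, IsUnifier Γ' θ' τ) ∧ ∀ x y, Precedes Γ' θ' x y → Precedes Γ θ (g x) (g y) := by
  have key : ∀ l, (argsOf Γ' l).map (fun t => t.subst fun x =>
      (σ (Sum.map id g x)).subst fun x => .var (Sum.map id f x)) =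
      ((argsOf Γ (m l)).map fun t => t.subst σ).map fun t =>
        t.subst fun x => .var (Sum.map id f x) := by
    intro l
    simp only [hargs, List.map_map, Function.comp_def, relabel_subst, subst_subst]
  -- Here constants are merely renamed along `f`, so a universal variable in a new term can be
  -- traced back to a single old one.
  obtain ⟨h, h'⟩ := unifier_transfer (θ' := θ') hσ.1 g (fun x => .var (Sum.map id f x))
    (fun w hw => ⟨(hkind w (.inl hw)).trans hw, by simp [hfg w hw]⟩) (fun n => rfl)
    (by
      rintro w ⟨hw, l, t, ht, hocc⟩
      refine ⟨(hkind w (.inr hw)).trans hw, m l, t.relabel (Sum.map id g), ?_, ?_⟩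
      · rw [hargs]
        exact List.mem_map_of_mem ht
      · rw [occurs_iff] at hocc ⊢
        exact mem_vars_relabel.2 ⟨_, hocc, rfl⟩)
    (by
      rintro (n | w) hs y hy
      · obtain rfl : y = Sum.inl n := hy
        trivial
      · obtain rfl : y = Sum.inr (f w) := hy
        exact (hgf w hs).1)
    fun l l' hl => by rw [key, key, he l l' hl]
  refine ⟨h, fun x y hxy => ?_⟩
  obtain ⟨hx, s, hs, hsx, hys⟩ := h' x y hxy
  rcases s with n | s
  · simp at hys
  · obtain rfl : y = f s := by simpa using hys
    rw [(hgf s hs).2]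
    exact hσ.precedes hx hs hsx

end Transfer

/-! ### Isomorphisms -/

section Iso

variable {L : FirstOrder.Language.{u, v}}

/-- Isomorphism of parse trees. -/
structure FIso (A B : Formula L) where
  vert : A.Vertex ≃ B.Vertex
  leaf : A.Leaf ≃ B.Leaf
  root : vert A.root = B.root
  kind : ∀ w, B.kind (vert w) = A.kind w
  isArg : ∀ a b, B.IsArg (vert a) (vert b) ↔ A.IsArg a b
  leafVertex : ∀ l, B.leafVertex (leaf l) = vert (A.leafVertex l)
  leafArgs : ∀ {W : Type} (ρ : ℕ → W) (q : B.Vertex → W) (l : A.Leaf),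
    B.leafArgs ρ q (leaf l) = A.leafArgs ρ (fun w => q (vert w)) l

namespace FIso

/-- The identity. -/
def refl (A : Formula L) : FIso A A :=
  ⟨.refl _, .refl _, rfl, fun _ => rfl, fun _ _ => .rfl, fun _ => rfl, fun _ _ _ => rfl⟩

/-- Commutativity of tensor. -/
def tensorComm (A B : Formula L) : FIso (.tensor A B) (.tensor B A) where
  vert := Equiv.optionCongr (Equiv.sumComm A.Vertex B.Vertex)
  leaf := Equiv.sumComm A.Leaf B.Leaf
  root := rfl
  kind := by rintro (_ | w | w) <;> rfl
  isArg := by rintro (_ | a | a) (_ | b | b) <;> exact .rfl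
  leafVertex := by rintro (l | l) <;> rfl
  leafArgs := by rintro W ρ q (l | l) <;> rfl

/-- Existential quantification. -/
def ex (x : ℕ) {A B : Formula L} (F : FIso A B) : FIso (.ex x A) (.ex x B) where
  vert := Equiv.optionCongr F.vert
  leaf := F.leaf
  root := rfl
  kind := by
    rintro (_ | w)
    · rfl
    · exact F.kind w
  isArg := by
    rintro (_ | a) (_ | b)
    · exact .rfl
    · exact .rfl
    · change F.vert a = B.root ↔ a = A.root
      rw [← F.root, F.vert.injective.eq_iff]
    · exact F.isArg a b
  leafVertex := fun l => congrArg some (F.leafVertex l)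
  leafArgs := fun ρ q l => F.leafArgs _ _ l

/-- Iterated existential quantification. -/
def exs {A B : Formula L} (F : FIso A B) : (xs : List ℕ) → FIso (Formula.exs xs A) (Formula.exs xs B)
  | [] => F
  | x :: xs => (F.exs xs).ex x

theorem exs_leaf {A B : Formula L} (F : FIso A B) (xs : List ℕ) (l : A.Leaf) :
    (F.exs xs).leaf (Formula.exsLeaf xs l) = Formula.exsLeaf xs (F.leaf l) := by
  induction xs with
  | nil => rfl
  | cons x xs ih => exact ih

end FIso

/-- Isomorphism of sequents. -/
structure SeqIso {ι ι' : Type} (Γ : ι → Formula L) (Γ' : ι' → Formula L) where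
  vert : SVertex Γ ≃ SVertex Γ'
  leaf : SLeaf Γ ≃ SLeaf Γ'
  kind : ∀ w, kindOf Γ' (vert w) = kindOf Γ w
  sArg : ∀ a b, SArg Γ' (vert a) (vert b) ↔ SArg Γ a b
  vertexOf : ∀ l, vertexOf Γ' (leaf l) = vert (vertexOf Γ l)
  argsOf : ∀ l, argsOf Γ' (leaf l) = (argsOf Γ l).map fun t => t.relabel (Sum.map id vert)

namespace SeqIso

variable {ι ι' : Type} {Γ : ι → Formula L} {Γ' : ι' → Formula L}

/-- The inverse isomorphism. -/
def symm (F : SeqIso Γ Γ') : SeqIso Γ' Γ where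
  vert := F.vert.symm
  leaf := F.leaf.symm
  kind := fun w => by rw [← F.kind, Equiv.apply_symm_apply]
  sArg := fun a b => by rw [← F.sArg, Equiv.apply_symm_apply, Equiv.apply_symm_apply]
  vertexOf := fun l => by
    rw [Equiv.eq_symm_apply, ← F.vertexOf, Equiv.apply_symm_apply]
  argsOf := fun l => by
    conv_rhs => rw [← F.leaf.apply_symm_apply l, F.argsOf]
    have h : ∀ x : SVar Γ, Sum.map id F.vert.symm (Sum.map id F.vert x) = x := by
      rintro (n | w) <;> simp
    simp only [List.map_map, Function.comp_def, FirstOrder.Language.Term.relabel_relabel, h]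
    exact ((List.map_congr_left fun t _ => t.relabel_id).trans (List.map_id _)).symm

/-- The isomorphism given by a bijection of the indices and isomorphisms of the formulas. -/
def ofFIso (E : ι ≃ ι') (F : ∀ i, FIso (Γ i) (Γ' (E i))) : SeqIso Γ Γ' where
  vert := Equiv.sigmaCongr E fun i => (F i).vert
  leaf := Equiv.sigmaCongr E fun i => (F i).leaf
  kind := fun w => (F w.1).kind w.2
  sArg := by
    rintro ⟨i, a⟩ ⟨j, b⟩
    constructor
    · intro h
      obtain rfl : i = j := E.injective (SArg.fst_eq Γ' h)
      exact sArg_mk.2 (((F i).isArg a b).1 (sArg_mk.1 h))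
    · intro h
      obtain rfl : i = j := SArg.fst_eq Γ h
      exact sArg_mk.2 (((F i).isArg a b).2 (sArg_mk.1 h))
  vertexOf := fun l => Sigma.ext rfl (heq_of_eq ((F l.1).leafVertex l.2))
  argsOf := fun l => ((F l.1).leafArgs _ _ l.2).trans
    ((Γ l.1).leafArgs_relabel (ρ := Sum.inl) (q := fun w => Sum.inr (⟨l.1, w⟩ : SVertex Γ))
      (g := Sum.map id
        (Equiv.sigmaCongr E (fun i => (F i).vert) : SVertex Γ ≃ SVertex Γ'))
      (fun _ _ => rfl) (fun _ => rfl) l.2).symm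

theorem isSwitched (F : SeqIso Γ Γ') (w : SVertex Γ) :
    IsSwitched Γ' (F.vert w) ↔ IsSwitched Γ w := by
  simp only [IsSwitched, F.kind]

/-- The characterization by count and connectivity reduces invariance to the same transfer lemmas
that serve for cut reduction. Only one inclusion of leaps is needed. -/
theorem correct [Finite ι] [Finite ι'] (F : SeqIso Γ Γ') {θ : Set (Sym2 (SLeaf Γ))}
    (hθ : ∀ l, s(l, l) ∉ θ) (h : Correct Γ θ) : Correct Γ' (Sym2.map F.leaf '' θ) := by
  classical
  have := Fintype.ofFinite ι
  have := Fintype.ofFinite ι'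
  obtain ⟨hb, hc⟩ := h.balanced_and_allConn hθ
  obtain ⟨σ, hσ⟩ := exists_isMGU h.1
  have hlink : ∀ l l', s(l, l') ∈ Sym2.map F.leaf '' θ → s(F.leaf.symm l, F.leaf.symm l') ∈ θ := by
    rintro l l' ⟨e, he, h⟩
    have : e = s(F.leaf.symm l, F.leaf.symm l') := by
      apply Sym2.map.injective F.leaf.injective
      rw [h]
      simp
    rwa [← this]
  obtain ⟨hu, hp⟩ := precedes_transfer (θ' := Sym2.map F.leaf '' θ) hσ F.vert F.vert.symm
    F.leaf.symm (fun w _ => F.symm.kind w) (fun w _ => F.vert.apply_symm_apply w)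
    (fun w hw => ⟨(F.kind w).trans hw, F.vert.symm_apply_apply w⟩) (fun l => F.symm.argsOf l)
    fun l l' hl => hσ.1.equalizes _ _ (hlink l l' hl)
  refine correct_of_allConn hu ?_ ?_
  · unfold Balanced at hb ⊢
    rw [Set.ncard_image_of_injective _ (Sym2.map.injective F.leaf.injective),
      ← Fintype.card_congr F.vert, hb, ← Equiv.sum_comp F.vert]
    simp only [F.kind]
  · refine conn_of_map F.vert F.vert.symm hc ?_ ?_ ?_
    · rintro a b (⟨h, hb⟩ | ⟨l, l', h, rfl, rfl⟩)
      · exact .rel _ _ (.inl ⟨(F.sArg a b).2 h, fun h' => hb ((F.isSwitched b).1 h')⟩)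
      · exact .rel _ _ (.inr ⟨F.leaf l, F.leaf l', ⟨_, h, rfl⟩, (F.vertexOf l).symm,
          (F.vertexOf l').symm⟩)
    · intro a
      rw [F.vert.apply_symm_apply]
      exact .refl _
    · refine fun w hw => .inr ⟨(F.isSwitched w).2 hw, ?_⟩
      rintro a (h | h)
      · rw [← F.vert.apply_symm_apply a, F.sArg] at h
        exact .inl h
      · have := hp _ _ h
        rw [F.vert.symm_apply_apply] at this
        exact .inr this

end SeqIso

end Iso

/-! ### Vertices of compound formulas -/

namespace Formula

variable {L : FirstOrder.Language.{u, v}}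

section Constructors

variable (x : ℕ) (A B : Formula L)

/-- The root of `A ⊗ B`. -/
def tensorTop : (tensor A B).Vertex := (none : Option (A.Vertex ⊕ B.Vertex))

/-- A vertex of `A` as a vertex of `A ⊗ B`. -/
def tensorLeft {A : Formula L} (a : A.Vertex) : (tensor A B).Vertex :=
  (some (.inl a) : Option (A.Vertex ⊕ B.Vertex))

/-- A vertex of `B` as a vertex of `A ⊗ B`. -/
def tensorRight {B : Formula L} (b : B.Vertex) : (tensor A B).Vertex :=
  (some (.inr b) : Option (A.Vertex ⊕ B.Vertex))

/-- The root of `A ⅋ B`. -/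
def parTop : (par A B).Vertex := (none : Option (A.Vertex ⊕ B.Vertex))

/-- A vertex of `A` as a vertex of `A ⅋ B`. -/
def parLeft {A : Formula L} (a : A.Vertex) : (par A B).Vertex :=
  (some (.inl a) : Option (A.Vertex ⊕ B.Vertex))

/-- A vertex of `B` as a vertex of `A ⅋ B`. -/
def parRight {B : Formula L} (b : B.Vertex) : (par A B).Vertex :=
  (some (.inr b) : Option (A.Vertex ⊕ B.Vertex))

/-- The root of `∀x A`. -/
def allTop : (all x A).Vertex := (none : Option A.Vertex)

/-- A vertex of `A` as a vertex of `∀x A`. -/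
def allBody {A : Formula L} (a : A.Vertex) : (all x A).Vertex := (some a : Option A.Vertex)

/-- The root of `∃x A`. -/
def exTop : (ex x A).Vertex := (none : Option A.Vertex)

/-- A vertex of `A` as a vertex of `∃x A`. -/
def exBody {A : Formula L} (a : A.Vertex) : (ex x A).Vertex := (some a : Option A.Vertex)

end Constructors

section Elim

variable {T : Type} {x : ℕ} {A B : Formula L}

/-- Case distinction on the vertices of `A ⊗ B`. -/
def tensorElim (t : T) (l : A.Vertex → T) (r : B.Vertex → T) : (tensor A B).Vertex → T
  | none => t
  | some (.inl a) => l a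
  | some (.inr b) => r b

/-- Case distinction on the vertices of `A ⅋ B`. -/
def parElim (t : T) (l : A.Vertex → T) (r : B.Vertex → T) : (par A B).Vertex → T
  | none => t
  | some (.inl a) => l a
  | some (.inr b) => r b

/-- Case distinction on the vertices of `∀x A`. -/
def allElim (t : T) (i : A.Vertex → T) : (all x A).Vertex → T
  | none => t
  | some a => i a

/-- Case distinction on the vertices of `∃x A`. -/
def exElim (t : T) (i : A.Vertex → T) : (ex x A).Vertex → T
  | none => t
  | some a => i a

variable (t : T) (l : A.Vertex → T) (r : B.Vertex → T) (a : A.Vertex) (b : B.Vertex)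

@[simp] theorem tensorElim_top : tensorElim t l r (tensorTop A B) = t := rfl
@[simp] theorem tensorElim_left : tensorElim t l r (tensorLeft B a) = l a := rfl
@[simp] theorem tensorElim_right : tensorElim t l r (tensorRight A b) = r b := rfl
@[simp] theorem allElim_top : allElim t l (allTop x A) = t := rfl
@[simp] theorem allElim_body : allElim t l (allBody x a) = l a := rfl
@[simp] theorem exElim_body : exElim t l (exBody x a) = l a := rfl

theorem tensor_cases (w : (tensor A B).Vertex) :
    w = tensorTop A B ∨ (∃ a, w = tensorLeft B a) ∨ ∃ b, w = tensorRight A b := by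
  rcases w with _ | a | b
  · exact .inl rfl
  · exact .inr (.inl ⟨a, rfl⟩)
  · exact .inr (.inr ⟨b, rfl⟩)

theorem par_cases (w : (par A B).Vertex) :
    w = parTop A B ∨ (∃ a, w = parLeft B a) ∨ ∃ b, w = parRight A b := by
  rcases w with _ | a | b
  · exact .inl rfl
  · exact .inr (.inl ⟨a, rfl⟩)
  · exact .inr (.inr ⟨b, rfl⟩)

theorem all_cases (w : (all x A).Vertex) : w = allTop x A ∨ ∃ a, w = allBody x a := by
  rcases w with _ | a
  · exact .inl rfl
  · exact .inr ⟨a, rfl⟩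

theorem ex_cases (w : (ex x A).Vertex) : w = exTop x A ∨ ∃ a, w = exBody x a := by
  rcases w with _ | a
  · exact .inl rfl
  · exact .inr ⟨a, rfl⟩

@[simp] theorem kind_tensorTop : (tensor A B).kind (tensorTop A B) = .tensor := rfl
@[simp] theorem kind_tensorLeft : (tensor A B).kind (tensorLeft B a) = A.kind a := rfl
@[simp] theorem kind_tensorRight : (tensor A B).kind (tensorRight A b) = B.kind b := rfl
@[simp] theorem kind_parTop : (par A B).kind (parTop A B) = .par := rfl
@[simp] theorem kind_allBody : (all x A).kind (allBody x a) = A.kind a := rfl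
@[simp] theorem kind_exTop : (ex x A).kind (exTop x A) = .ex := rfl
@[simp] theorem kind_exBody : (ex x A).kind (exBody x a) = A.kind a := rfl

theorem isArg_tensorTop {w : (tensor A B).Vertex} : (tensor A B).IsArg w (tensorTop A B) ↔
    w = tensorLeft B A.root ∨ w = tensorRight A B.root := by
  rcases tensor_cases w with rfl | ⟨a, rfl⟩ | ⟨b, rfl⟩
  · exact ⟨False.elim, fun h => by rcases h with h | h <;> cases h⟩
  · exact ⟨fun h => .inl (congrArg _ h), fun h => h.elim
      (fun h => Sum.inl_injective (Option.some_injective _ h))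
      fun h => by cases Option.some_injective _ h⟩
  · exact ⟨fun h => .inr (congrArg _ h), fun h => h.elim
      (fun h => by cases Option.some_injective _ h)
      fun h => Sum.inr_injective (Option.some_injective _ h)⟩

theorem isArg_tensorLeft {w : (tensor A B).Vertex} {c : A.Vertex} :
    (tensor A B).IsArg w (tensorLeft B c) ↔ ∃ a, w = tensorLeft B a ∧ A.IsArg a c := by
  rcases tensor_cases w with rfl | ⟨a, rfl⟩ | ⟨b, rfl⟩
  · exact ⟨False.elim, fun ⟨_, h, _⟩ => by cases h⟩
  · refine ⟨fun h => ⟨a, rfl, h⟩, fun ⟨a', h, h'⟩ => ?_⟩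
    obtain rfl : a = a' := Sum.inl_injective (Option.some_injective _ h)
    exact h'
  · exact ⟨False.elim, fun ⟨_, h, _⟩ => by cases Option.some_injective _ h⟩

theorem isArg_tensorRight {w : (tensor A B).Vertex} {c : B.Vertex} :
    (tensor A B).IsArg w (tensorRight A c) ↔ ∃ b, w = tensorRight A b ∧ B.IsArg b c := by
  rcases tensor_cases w with rfl | ⟨a, rfl⟩ | ⟨b, rfl⟩
  · exact ⟨False.elim, fun ⟨_, h, _⟩ => by cases h⟩
  · exact ⟨False.elim, fun ⟨_, h, _⟩ => by cases Option.some_injective _ h⟩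
  · refine ⟨fun h => ⟨b, rfl, h⟩, fun ⟨a', h, h'⟩ => ?_⟩
    obtain rfl : b = a' := Sum.inr_injective (Option.some_injective _ h)
    exact h'

theorem isArg_parLeft {w : (par A B).Vertex} {c : A.Vertex} :
    (par A B).IsArg w (parLeft B c) ↔ ∃ a, w = parLeft B a ∧ A.IsArg a c := by
  rcases par_cases w with rfl | ⟨a, rfl⟩ | ⟨b, rfl⟩
  · exact ⟨False.elim, fun ⟨_, h, _⟩ => by cases h⟩
  · refine ⟨fun h => ⟨a, rfl, h⟩, fun ⟨a', h, h'⟩ => ?_⟩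
    obtain rfl : a = a' := Sum.inl_injective (Option.some_injective _ h)
    exact h'
  · exact ⟨False.elim, fun ⟨_, h, _⟩ => by cases Option.some_injective _ h⟩

theorem isArg_parRight {w : (par A B).Vertex} {c : B.Vertex} :
    (par A B).IsArg w (parRight A c) ↔ ∃ b, w = parRight A b ∧ B.IsArg b c := by
  rcases par_cases w with rfl | ⟨a, rfl⟩ | ⟨b, rfl⟩
  · exact ⟨False.elim, fun ⟨_, h, _⟩ => by cases h⟩
  · exact ⟨False.elim, fun ⟨_, h, _⟩ => by cases Option.some_injective _ h⟩
  · refine ⟨fun h => ⟨b, rfl, h⟩, fun ⟨a', h, h'⟩ => ?_⟩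
    obtain rfl : b = a' := Sum.inr_injective (Option.some_injective _ h)
    exact h'

theorem isArg_exTop {w : (ex x A).Vertex} : (ex x A).IsArg w (exTop x A) ↔ w = exBody x A.root := by
  rcases ex_cases w with rfl | ⟨a, rfl⟩
  · exact ⟨False.elim, fun h => by cases h⟩
  · exact ⟨fun h => congrArg _ h, fun h => Option.some_injective _ h⟩

theorem isArg_exBody {w : (ex x A).Vertex} {c : A.Vertex} :
    (ex x A).IsArg w (exBody x c) ↔ ∃ a, w = exBody x a ∧ A.IsArg a c := by
  rcases ex_cases w with rfl | ⟨a, rfl⟩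
  · exact ⟨False.elim, fun ⟨_, h, _⟩ => by cases h⟩
  · refine ⟨fun h => ⟨a, rfl, h⟩, fun ⟨a', h, h'⟩ => ?_⟩
    obtain rfl : a = a' := Option.some_injective _ h
    exact h'

theorem isArg_allBody {w : (all x A).Vertex} {c : A.Vertex} :
    (all x A).IsArg w (allBody x c) ↔ ∃ a, w = allBody x a ∧ A.IsArg a c := by
  rcases all_cases w with rfl | ⟨a, rfl⟩
  · exact ⟨False.elim, fun ⟨_, h, _⟩ => by cases h⟩
  · refine ⟨fun h => ⟨a, rfl, h⟩, fun ⟨a', h, h'⟩ => ?_⟩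
    obtain rfl : a = a' := Option.some_injective _ h
    exact h'

end Elim

end Formula

/-! ### Iterated existential quantification -/

namespace Formula

variable {L : FirstOrder.Language.{u, v}} {C : Formula L}

/-- The vertices of `C`, as vertices of `∃x₁ … ∃xₙ C`. -/
def body : (xs : List ℕ) → C.Vertex → (exs xs C).Vertex
  | [], w => w
  | _ :: xs, w => some (body xs w)

variable (C) in
/-- The quantifier of `∃x₁ … ∃xₙ C` that binds `x`, or else the root of `C`. -/
def binder : (xs : List ℕ) → ℕ → (exs xs C).Vertex
  | [], _ => C.root
  | y :: ys, x => if x = y then none else some (binder ys x)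

/-- The vertices of `∃x₁ … ∃xₙ C` are bound variables or vertices of `C`. -/
def view : (xs : List ℕ) → (exs xs C).Vertex → ℕ ⊕ C.Vertex
  | [], w => .inr w
  | y :: _, none => .inl y
  | _ :: ys, some w => view ys w

theorem binder_self (y : ℕ) (ys : List ℕ) :
    binder C (y :: ys) y = (none : Option (exs ys C).Vertex) := if_pos rfl

theorem binder_of_ne {x y : ℕ} (ys : List ℕ) (h : x ≠ y) :
    binder C (y :: ys) x = (some (binder C ys x) : Option (exs ys C).Vertex) := if_neg h

theorem view_body (xs : List ℕ) (w : C.Vertex) : view xs (body xs w) = .inr w := by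
  induction xs with
  | nil => rfl
  | cons x xs ih => exact ih

theorem view_binder {xs : List ℕ} {x : ℕ} (hx : x ∈ xs) : view xs (binder C xs x) = .inl x := by
  induction xs with
  | nil => cases hx
  | cons y ys ih =>
    by_cases h : x = y
    · subst h
      rw [binder_self]
      rfl
    · rw [binder_of_ne ys h]
      exact ih (List.mem_of_ne_of_mem h hx)

theorem binder_of_notMem {xs : List ℕ} {x : ℕ} (hx : x ∉ xs) :
    binder C xs x = body xs C.root := by
  induction xs with
  | nil => rfl
  | cons y ys ih =>
    rw [binder_of_ne ys (fun h => hx (List.mem_cons.2 (.inl h))),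
      ih fun h => hx (List.mem_cons_of_mem _ h)]
    rfl

/-- Distinctness matters: `binder` finds the outermost quantifier with a given name, so a repeated
name would leave an inner quantifier unreached. -/
theorem exs_vertex_cases {xs : List ℕ} (hxs : xs.Nodup) (w : (exs xs C).Vertex) :
    (∃ x ∈ xs, w = binder C xs x) ∨ ∃ c, w = body xs c := by
  induction xs with
  | nil => exact .inr ⟨w, rfl⟩
  | cons y ys ih =>
    rcases w with _ | w
    · exact .inl ⟨y, List.mem_cons_self, (binder_self y ys).symm⟩
    · rcases ih (List.nodup_cons.1 hxs).2 w with ⟨x, hx, rfl⟩ | ⟨c, rfl⟩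
      · exact .inl ⟨x, List.mem_cons_of_mem _ hx,
          (binder_of_ne ys (ne_of_mem_of_not_mem hx (List.nodup_cons.1 hxs).1)).symm⟩
      · exact .inr ⟨c, rfl⟩

theorem kind_body (xs : List ℕ) (w : C.Vertex) : (exs xs C).kind (body xs w) = C.kind w := by
  induction xs with
  | nil => rfl
  | cons x xs ih => exact ih

theorem kind_binder {xs : List ℕ} {x : ℕ} (hx : x ∈ xs) :
    (exs xs C).kind (binder C xs x) = .ex := by
  induction xs with
  | nil => cases hx
  | cons y ys ih =>
    by_cases h : x = y
    · subst h
      rw [binder_self]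
      rfl
    · rw [binder_of_ne ys h]
      exact ih (List.mem_of_ne_of_mem h hx)

theorem excess_exs (xs : List ℕ) : (exs xs C).excess = C.excess := by
  induction xs with
  | nil => rfl
  | cons x xs ih => exact ih

theorem root_exs (xs : List ℕ) :
    (exs xs C).root = body xs C.root ∨ ∃ x ∈ xs, (exs xs C).root = binder C xs x := by
  cases xs with
  | nil => exact .inl rfl
  | cons y ys => exact .inr ⟨y, List.mem_cons_self, (binder_self y ys).symm⟩

theorem isArg_body_iff {xs : List ℕ} {a : (exs xs C).Vertex} {b : C.Vertex} :
    (exs xs C).IsArg a (body xs b) ↔ ∃ a', a = body xs a' ∧ C.IsArg a' b := by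
  induction xs with
  | nil => exact ⟨fun h => ⟨a, rfl, h⟩, fun ⟨a', h, h'⟩ => by rw [h]; exact h'⟩
  | cons x xs ih =>
    rcases a with _ | a
    · exact ⟨False.elim, fun ⟨_, h, _⟩ => by cases h⟩
    · refine ih.trans ⟨fun ⟨a', h, h'⟩ => ⟨a', congrArg some h, h'⟩, fun ⟨a', h, h'⟩ =>
        ⟨a', Option.some_injective _ h, h'⟩⟩

theorem isArg_binder {xs : List ℕ} {x : ℕ} (hxs : xs.Nodup) (hx : x ∈ xs) {a : (exs xs C).Vertex}
    (h : (exs xs C).IsArg a (binder C xs x)) :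
    a = body xs C.root ∨ ∃ y ∈ xs, a = binder C xs y := by
  induction xs with
  | nil => cases hx
  | cons z zs ih =>
    have lift : ∀ {a : (exs zs C).Vertex}, (a = body zs C.root ∨ ∃ y ∈ zs, a = binder C zs y) →
        ((some a : (exs (z :: zs) C).Vertex) = body (z :: zs) C.root ∨
          ∃ y ∈ z :: zs, (some a : (exs (z :: zs) C).Vertex) = binder C (z :: zs) y) := by
      rintro a (rfl | ⟨y, hy, rfl⟩)
      · exact .inl rfl
      · exact .inr ⟨y, List.mem_cons_of_mem _ hy,
          (binder_of_ne zs (ne_of_mem_of_not_mem hy (List.nodup_cons.1 hxs).1)).symm⟩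
    by_cases hxz : x = z
    · subst hxz
      rw [binder_self] at h
      rcases a with _ | a
      · exact False.elim h
      · exact lift ((show a = (exs zs C).root from h) ▸ root_exs zs)
    · rw [binder_of_ne zs hxz] at h
      rcases a with _ | a
      · exact False.elim h
      · exact lift (ih (List.nodup_cons.1 hxs).2 (List.mem_of_ne_of_mem hxz hx) h)

/-- The prefix is a chain of unswitched vertices. No membership of `x` is required, because `binder`
then defaults to the root of `C`; vacuous quantifier cuts rely on this. -/
theorem conn_binder (xs : List ℕ) (x : ℕ) :
    Conn (fun a b => (exs xs C).IsArg a b ∧ (exs xs C).kind b = .ex) (binder C xs x)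
      (body xs C.root) := by
  induction xs generalizing x with
  | nil => exact .refl _
  | cons y ys ih =>
    have lift : ∀ z, Conn (fun a b => (exs (y :: ys) C).IsArg a b ∧ (exs (y :: ys) C).kind b = .ex)
        (some (binder C ys z)) (body (y :: ys) C.root) :=
      fun z => (ih z).map some fun a b h => .rel _ _ h
    by_cases h : x = y
    · subst h
      rw [binder_self]
      refine .trans _ (some (exs ys C).root) _ (.symm _ _ (.rel _ _ ⟨rfl, rfl⟩)) ?_
      rcases root_exs (C := C) ys with h | ⟨z, -, h⟩
      · rw [h]
        exact .refl _
      · rw [h]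
        exact lift z
    · rw [binder_of_ne ys h]
      exact lift x

theorem leafVertex_exsLeaf (xs : List ℕ) (l : C.Leaf) :
    (exs xs C).leafVertex (exsLeaf xs l) = body xs (C.leafVertex l) := by
  induction xs with
  | nil => rfl
  | cons x xs ih => exact congrArg some ih

theorem exsLeaf_bijective (xs : List ℕ) : Function.Bijective (exsLeaf (A := C) xs) := by
  induction xs with
  | nil => exact Function.bijective_id
  | cons x xs ih => exact ih

/-- With distinct names, the outermost quantifier found by `binder` is also the one that captures
the variable. -/
theorem leafArgs_exsLeaf {W : Type} {xs : List ℕ} (hxs : xs.Nodup) (ρ : ℕ → W)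
    (q : (exs xs C).Vertex → W) (l : C.Leaf) :
    (exs xs C).leafArgs ρ q (exsLeaf xs l) =
      C.leafArgs (fun x => if x ∈ xs then q (binder C xs x) else ρ x) (fun w => q (body xs w)) l := by
  induction xs generalizing ρ with
  | nil => simp [exs, exsLeaf, body]
  | cons y ys ih =>
    refine (ih (List.nodup_cons.1 hxs).2 _ _).trans ?_
    congr 1
    funext x
    by_cases hxy : x = y
    · subst hxy
      simp [(List.nodup_cons.1 hxs).1, binder_self]
    · simp [hxy, binder_of_ne]

end Formula

/-! ### Sequents with a distinguished formula -/

section Ext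

variable {L : FirstOrder.Language.{u, v}} {J : Type}

/-- The sequent `Γ, D`. -/
def ext (Γ : J → Formula L) (D : Formula L) : Option J → Formula L
  | none => D
  | some j => Γ j

variable {Γ : J → Formula L} {D : Formula L}

/-- A vertex of `Γ`, as a vertex of `Γ, D`. -/
def oldVertex (D : Formula L) (w : SVertex Γ) : SVertex (ext Γ D) := ⟨some w.1, w.2⟩

/-- A vertex of `D`, as a vertex of `Γ, D`. -/
def newVertex (Γ : J → Formula L) (w : D.Vertex) : SVertex (ext Γ D) := ⟨none, w⟩

/-- Case distinction on vertices of `Γ, D`. -/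
def extElim {T : Type} (h : SVertex Γ → T) (k : D.Vertex → T) : SVertex (ext Γ D) → T
  | ⟨none, w⟩ => k w
  | ⟨some j, w⟩ => h ⟨j, w⟩

@[simp] theorem extElim_oldVertex {T : Type} (h : SVertex Γ → T) (k : D.Vertex → T)
    (w : SVertex Γ) : extElim h k (oldVertex D w) = h w := rfl

@[simp] theorem extElim_newVertex {T : Type} (h : SVertex Γ → T) (k : D.Vertex → T)
    (w : D.Vertex) : extElim h k (newVertex Γ w) = k w := rfl

theorem ext_vertex_cases (w : SVertex (ext Γ D)) :
    (∃ a, w = oldVertex D a) ∨ ∃ a, w = newVertex Γ a := by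
  rcases w with ⟨_ | j, w⟩
  · exact .inr ⟨w, rfl⟩
  · exact .inl ⟨⟨j, w⟩, rfl⟩

theorem oldVertex_ne_newVertex (a : SVertex Γ) (b : D.Vertex) : oldVertex D a ≠ newVertex Γ b :=
  fun h => by simpa using congrArg (extElim (fun _ => True) fun _ => False) h

@[simp] theorem kindOf_oldVertex (w : SVertex Γ) : kindOf (ext Γ D) (oldVertex D w) = kindOf Γ w :=
  rfl

theorem sArg_oldVertex_iff {a : SVertex (ext Γ D)} {b : SVertex Γ} :
    SArg (ext Γ D) a (oldVertex D b) ↔ ∃ a', a = oldVertex D a' ∧ SArg Γ a' b := by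
  obtain ⟨j, b⟩ := b
  constructor
  · intro h
    obtain ⟨i, a⟩ := a
    obtain rfl : i = some j := SArg.fst_eq _ h
    exact ⟨⟨j, a⟩, rfl, sArg_mk.2 ((sArg_mk (Γ := ext Γ D) (i := some j)).1 h)⟩
  · rintro ⟨⟨i, a⟩, rfl, h⟩
    obtain rfl : i = j := SArg.fst_eq _ h
    exact ⟨some i, a, b, (sArg_mk (Γ := Γ)).1 h, rfl, rfl⟩

theorem sArg_newVertex_iff {a : SVertex (ext Γ D)} {b : D.Vertex} :
    SArg (ext Γ D) a (newVertex Γ b) ↔ ∃ a', a = newVertex Γ a' ∧ D.IsArg a' b := by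
  constructor
  · intro h
    obtain ⟨i, a⟩ := a
    obtain rfl : i = none := SArg.fst_eq _ h
    exact ⟨a, rfl, (sArg_mk (Γ := ext Γ D) (i := none)).1 h⟩
  · rintro ⟨a, rfl, h⟩
    exact ⟨none, a, b, h, rfl, rfl⟩

theorem fixed_newVertex {θ : Set (Sym2 (SLeaf (ext Γ D)))} {a b : D.Vertex} (h : D.IsArg a b)
    (h1 : D.kind b ≠ .par) (h2 : D.kind b ≠ .all) :
    Fixed (ext Γ D) θ (newVertex Γ a) (newVertex Γ b) :=
  .inl ⟨sArg_newVertex_iff.2 ⟨a, rfl, h⟩, fun h' => h'.elim h1 h2⟩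

theorem fixed_oldVertex {θ : Set (Sym2 (SLeaf (ext Γ D)))} {a b : SVertex Γ} (h : SArg Γ a b)
    (hb : ¬ IsSwitched Γ b) :
    Fixed (ext Γ D) θ (oldVertex D a) (oldVertex D b) :=
  .inl ⟨sArg_oldVertex_iff.2 ⟨a, rfl, h⟩, hb⟩

theorem sum_excess_ext [Fintype J] :
    ∑ i, (ext Γ D i).excess = D.excess + ∑ i, (Γ i).excess :=
  Fintype.sum_option _

/-- The leaves of `Γ, ∃x₁ … ∃xₙ C`. -/
def extLeaf (Γ : J → Formula L) (C : Formula L) (xs : List ℕ) :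
    SLeaf Γ ⊕ C.Leaf → SLeaf (ext Γ (Formula.exs xs C))
  | .inl l => ⟨some l.1, l.2⟩
  | .inr l => ⟨none, Formula.exsLeaf xs l⟩

variable {C : Formula L} {xs : List ℕ}

theorem extLeaf_bijective : Function.Bijective (extLeaf Γ C xs) := by
  constructor
  · rintro (⟨i, l⟩ | l) (⟨j, l'⟩ | l') h
    · obtain rfl : i = j := Option.some_injective _ (congrArg Sigma.fst h)
      obtain rfl : l = l' := eq_of_heq (Sigma.ext_iff.1 h).2
      rfl
    · cases congrArg Sigma.fst h
    · cases congrArg Sigma.fst h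
    · exact congrArg Sum.inr
        ((Formula.exsLeaf_bijective xs).1 (eq_of_heq (Sigma.ext_iff.1 h).2))
  · rintro ⟨_ | j, l⟩
    · obtain ⟨l, rfl⟩ := (Formula.exsLeaf_bijective xs).2 l
      exact ⟨.inr l, rfl⟩
    · exact ⟨.inl ⟨j, l⟩, rfl⟩

/-- The quantifier of `∃x₁ … ∃xₙ C` that binds `x`, as a vertex of `Γ, ∃x₁ … ∃xₙ C`. -/
def bindVertex (Γ : J → Formula L) (C : Formula L) (xs : List ℕ) (x : ℕ) :
    SVertex (ext Γ (Formula.exs xs C)) := newVertex Γ (Formula.binder C xs x)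

/-- A vertex of `C`, as a vertex of `Γ, ∃x₁ … ∃xₙ C`. -/
def bodyVertex (Γ : J → Formula L) (xs : List ℕ) (c : C.Vertex) :
    SVertex (ext Γ (Formula.exs xs C)) := newVertex Γ (Formula.body xs c)

/-- Case distinction on the vertices of `Γ, ∃x₁ … ∃xₙ C`. -/
def exsElim {T : Type} (h : SVertex Γ → T) (b : ℕ → T) (k : C.Vertex → T) :
    SVertex (ext Γ (Formula.exs xs C)) → T :=
  extElim h fun w => Sum.elim b k (Formula.view xs w)

section

variable {T : Type} (h : SVertex Γ → T) (b : ℕ → T) (k : C.Vertex → T)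

theorem exsElim_bindVertex {x : ℕ} (hx : x ∈ xs) : exsElim h b k (bindVertex Γ C xs x) = b x := by
  rw [exsElim, bindVertex, extElim_newVertex, Formula.view_binder hx, Sum.elim_inl]

@[simp] theorem exsElim_bodyVertex (c : C.Vertex) :
    exsElim h b k (bodyVertex Γ xs c) = k c := by
  rw [exsElim, bodyVertex, extElim_newVertex, Formula.view_body, Sum.elim_inr]

end

theorem exs_cases (hxs : xs.Nodup) (w : SVertex (ext Γ (Formula.exs xs C))) :
    (∃ a, w = oldVertex _ a) ∨ (∃ x ∈ xs, w = bindVertex Γ C xs x) ∨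
      ∃ c, w = bodyVertex Γ xs c := by
  rcases ext_vertex_cases w with h | ⟨w, rfl⟩
  · exact .inl h
  · rcases Formula.exs_vertex_cases hxs w with ⟨x, hx, rfl⟩ | ⟨c, rfl⟩
    · exact .inr (.inl ⟨x, hx, rfl⟩)
    · exact .inr (.inr ⟨c, rfl⟩)

theorem bodyVertex_injective : Function.Injective (bodyVertex (C := C) Γ xs) := fun a b h => by
  simpa using congrArg (exsElim (fun _ => none) (fun _ => none) some) h

@[simp] theorem bodyVertex_inj {a b : C.Vertex} : bodyVertex Γ xs a = bodyVertex Γ xs b ↔ a = b :=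
  bodyVertex_injective.eq_iff

@[simp] theorem oldVertex_ne_bodyVertex {a : SVertex Γ} {c : C.Vertex} :
    oldVertex _ a ≠ bodyVertex Γ xs c := oldVertex_ne_newVertex _ _

theorem bindVertex_of_notMem {x : ℕ} (hx : x ∉ xs) :
    bindVertex Γ C xs x = bodyVertex Γ xs C.root :=
  congrArg (fun w => newVertex Γ w) (Formula.binder_of_notMem hx)

theorem kindOf_bindVertex {x : ℕ} (hx : x ∈ xs) : kindOf _ (bindVertex Γ C xs x) = .ex :=
  Formula.kind_binder hx

@[simp] theorem kindOf_bodyVertex (c : C.Vertex) : kindOf _ (bodyVertex Γ xs c) = C.kind c :=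
  Formula.kind_body xs c

@[simp] theorem isSwitched_bodyVertex {c : C.Vertex} :
    IsSwitched _ (bodyVertex Γ xs c) ↔ C.kind c = .par ∨ C.kind c = .all := by
  rw [IsSwitched, kindOf_bodyVertex]

theorem not_isSwitched_bindVertex {x : ℕ} (hx : x ∈ xs) :
    ¬ IsSwitched _ (bindVertex Γ C xs x) := by
  rw [IsSwitched, kindOf_bindVertex hx]
  simp

theorem sArg_bodyVertex_iff {a : SVertex (ext Γ (Formula.exs xs C))} {c : C.Vertex} :
    SArg _ a (bodyVertex Γ xs c) ↔ ∃ a', a = bodyVertex Γ xs a' ∧ C.IsArg a' c := by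
  rw [bodyVertex, sArg_newVertex_iff]
  constructor
  · rintro ⟨a, rfl, h⟩
    obtain ⟨a', rfl, h'⟩ := Formula.isArg_body_iff.1 h
    exact ⟨a', rfl, h'⟩
  · rintro ⟨a', rfl, h⟩
    exact ⟨_, rfl, Formula.isArg_body_iff.2 ⟨a', rfl, h⟩⟩

theorem sArg_bindVertex (hxs : xs.Nodup) {a : SVertex (ext Γ (Formula.exs xs C))} {x : ℕ}
    (hx : x ∈ xs) (h : SArg _ a (bindVertex Γ C xs x)) :
    a = bodyVertex Γ xs C.root ∨ ∃ y ∈ xs, a = bindVertex Γ C xs y := by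
  obtain ⟨a, rfl, h'⟩ := sArg_newVertex_iff.1 h
  rcases Formula.isArg_binder hxs hx h' with h | ⟨y, hy, h⟩
  · exact .inl (congrArg (fun w => newVertex Γ w) h)
  · exact .inr ⟨y, hy, congrArg (fun w => newVertex Γ w) h⟩

theorem fixed_bodyVertex {θ : Set (Sym2 (SLeaf (ext Γ (Formula.exs xs C))))} {a b : C.Vertex}
    (h : C.IsArg a b) (h1 : C.kind b = .tensor ∨ C.kind b = .ex) :
    Fixed _ θ (bodyVertex Γ xs a) (bodyVertex Γ xs b) :=
  .inl ⟨sArg_bodyVertex_iff.2 ⟨a, rfl, h⟩, by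
    rw [isSwitched_bodyVertex]
    rcases h1 with h1 | h1 <;> rw [h1] <;> simp⟩

theorem vertexOf_extLeaf_inr (l : C.Leaf) :
    vertexOf _ (extLeaf Γ C xs (.inr l)) = bodyVertex Γ xs (C.leafVertex l) :=
  congrArg (fun w => newVertex Γ w) (Formula.leafVertex_exsLeaf xs l)

theorem argsOf_extLeaf_inr (hxs : xs.Nodup) (l : C.Leaf) :
    argsOf _ (extLeaf Γ C xs (.inr l)) =
      C.leafArgs (fun x => if x ∈ xs then Sum.inr (bindVertex Γ C xs x) else .inl x)
        (fun w => Sum.inr (bodyVertex Γ xs w)) l :=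
  Formula.leafArgs_exsLeaf hxs _ _ l

theorem conn_bindVertex (θ : Set (Sym2 (SLeaf (ext Γ (Formula.exs xs C))))) (x : ℕ) :
    Conn (Fixed _ θ) (bindVertex Γ C xs x) (bodyVertex Γ xs C.root) :=
  (Formula.conn_binder xs x).map (newVertex Γ) fun a b h =>
    .rel _ _ (fixed_newVertex h.1 (by rw [h.2]; exact Kind.noConfusion)
      (by rw [h.2]; exact Kind.noConfusion))

end Ext

/-! ### Quantifier cuts -/

section Quantifier

open Formula

variable {L : FirstOrder.Language.{u, v}} {J : Type}

/-- The encoding of the cut between `∀y A` and `∃y B`, with bound variables `xs`. -/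
abbrev quantCut (xs : List ℕ) (y : ℕ) (A B : Formula L) : Formula L :=
  exs xs (.tensor (.all y A) (.ex y B))

/-- The encoding of the cut between `A` and `B`, with bound variables `xs`. -/
abbrev pairCut (xs : List ℕ) (A B : Formula L) : Formula L :=
  exs xs (.tensor A B)

variable (Γ : J → Formula L) (xs xs' : List ℕ) (y : ℕ) (A B : Formula L)

/-- Reduction of a quantifier cut, on vertices. -/
def quantMap : SVertex (ext Γ (quantCut xs y A B)) → SVertex (ext Γ (pairCut xs' A B)) :=
  exsElim (oldVertex _) (bindVertex Γ _ xs') <| tensorElim (bodyVertex Γ xs' (tensorTop A B))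
    (allElim (bindVertex Γ _ xs' y) fun a => bodyVertex Γ xs' (tensorLeft B a))
    (exElim (bindVertex Γ _ xs' y) fun b => bodyVertex Γ xs' (tensorRight A b))

/-- The universal vertex of a quantifier cut. -/
def quantAll : SVertex (ext Γ (quantCut xs y A B)) :=
  bodyVertex Γ xs (tensorLeft (.ex y B) (allTop y A))

/-- The existential vertex of a quantifier cut. -/
def quantEx : SVertex (ext Γ (quantCut xs y A B)) :=
  bodyVertex Γ xs (tensorRight (.all y A) (exTop y B))

/-- The vertices after the reduction of a quantifier cut, as vertices before it. -/
def quantInv : SVertex (ext Γ (pairCut xs' A B)) → SVertex (ext Γ (quantCut xs y A B)) :=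
  exsElim (oldVertex _)
    (fun x => if x = y then quantEx Γ xs y A B else bindVertex Γ _ xs x) <|
    tensorElim (bodyVertex Γ xs (tensorTop (.all y A) (.ex y B)))
      (fun a => bodyVertex Γ xs (tensorLeft (.ex y B) (allBody y a)))
      (fun b => bodyVertex Γ xs (tensorRight (.all y A) (exBody y b)))

/-- The leaves of the context and of a quantifier cut. -/
def quantLeaf : SLeaf Γ ⊕ (A.Leaf ⊕ B.Leaf) → SLeaf (ext Γ (quantCut xs y A B)) :=
  extLeaf Γ (.tensor (.all y A) (.ex y B)) xs

/-- The leaves of the context and of a cut. -/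
def pairLeaf : SLeaf Γ ⊕ (A.Leaf ⊕ B.Leaf) → SLeaf (ext Γ (pairCut xs A B)) :=
  extLeaf Γ (.tensor A B) xs

variable {Γ xs xs' y A B}

/-- Cases for the vertices before the reduction. -/
theorem quant_cases (hxs : xs.Nodup) (w : SVertex (ext Γ (quantCut xs y A B))) :
    (∃ a, w = oldVertex _ a) ∨ (∃ x ∈ xs, w = bindVertex Γ _ xs x) ∨
      w = bodyVertex Γ xs (tensorTop (.all y A) (.ex y B)) ∨ w = quantAll Γ xs y A B ∨
      w = quantEx Γ xs y A B ∨
      (∃ a, w = bodyVertex Γ xs (tensorLeft (.ex y B) (allBody y a))) ∨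
      ∃ b, w = bodyVertex Γ xs (tensorRight (.all y A) (exBody y b)) := by
  rcases exs_cases hxs w with h | h | ⟨c, rfl⟩
  · exact .inl h
  · exact .inr (.inl h)
  · refine .inr (.inr ?_)
    rcases tensor_cases c with rfl | ⟨c, rfl⟩ | ⟨c, rfl⟩
    · exact .inl rfl
    · rcases all_cases c with rfl | ⟨a, rfl⟩
      · exact .inr (.inl rfl)
      · exact .inr (.inr (.inr (.inl ⟨a, rfl⟩)))
    · rcases ex_cases c with rfl | ⟨b, rfl⟩
      · exact .inr (.inr (.inl rfl))
      · exact .inr (.inr (.inr (.inr ⟨b, rfl⟩)))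

/-- Cases for the vertices after the reduction. -/
theorem pair_cases (hxs : xs.Nodup) (w : SVertex (ext Γ (pairCut xs A B))) :
    (∃ a, w = oldVertex _ a) ∨ (∃ x ∈ xs, w = bindVertex Γ _ xs x) ∨
      w = bodyVertex Γ xs (tensorTop A B) ∨ (∃ a, w = bodyVertex Γ xs (tensorLeft B a)) ∨
      ∃ b, w = bodyVertex Γ xs (tensorRight A b) := by
  rcases exs_cases hxs w with h | h | ⟨c, rfl⟩
  · exact .inl h
  · exact .inr (.inl h)
  · refine .inr (.inr ?_)
    rcases tensor_cases c with rfl | ⟨c, rfl⟩ | ⟨c, rfl⟩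
    · exact .inl rfl
    · exact .inr (.inl ⟨c, rfl⟩)
    · exact .inr (.inr ⟨c, rfl⟩)

theorem quantMap_bindVertex {x : ℕ} (hx : x ∈ xs) :
    quantMap Γ xs xs' y A B (bindVertex Γ _ xs x) = bindVertex Γ _ xs' x :=
  exsElim_bindVertex _ _ _ hx

@[simp] theorem quantMap_bodyVertex (c : (tensor (all y A) (ex y B)).Vertex) :
    quantMap Γ xs xs' y A B (bodyVertex Γ xs c) =
      tensorElim (bodyVertex Γ xs' (tensorTop A B))
        (allElim (bindVertex Γ _ xs' y) fun a => bodyVertex Γ xs' (tensorLeft B a))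
        (exElim (bindVertex Γ _ xs' y) fun b => bodyVertex Γ xs' (tensorRight A b)) c :=
  exsElim_bodyVertex _ _ _ c

@[simp] theorem quantMap_quantAll :
    quantMap Γ xs xs' y A B (quantAll Γ xs y A B) = bindVertex Γ _ xs' y :=
  quantMap_bodyVertex _

@[simp] theorem quantMap_quantEx :
    quantMap Γ xs xs' y A B (quantEx Γ xs y A B) = bindVertex Γ _ xs' y :=
  quantMap_bodyVertex _

theorem quantInv_bindVertex {x : ℕ} (hx : x ∈ xs') :
    quantInv Γ xs xs' y A B (bindVertex Γ _ xs' x) =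
      if x = y then quantEx Γ xs y A B else bindVertex Γ _ xs x :=
  exsElim_bindVertex _ _ _ hx

@[simp] theorem quantInv_bodyVertex (c : (tensor A B).Vertex) :
    quantInv Γ xs xs' y A B (bodyVertex Γ xs' c) =
      tensorElim (bodyVertex Γ xs (tensorTop (.all y A) (.ex y B)))
      (fun a => bodyVertex Γ xs (tensorLeft (.ex y B) (allBody y a)))
      (fun b => bodyVertex Γ xs (tensorRight (.all y A) (exBody y b))) c :=
  exsElim_bodyVertex _ _ _ c

/-- A par or universal quantifier after the reduction comes from one before it. -/
theorem quantInv_of_isSwitched (hxs' : xs'.Nodup) {w : SVertex (ext Γ (pairCut xs' A B))}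
    (hw : IsSwitched _ w) :
    kindOf _ (quantInv Γ xs xs' y A B w) = kindOf _ w ∧
      quantInv Γ xs xs' y A B w ≠ quantAll Γ xs y A B ∧
      quantMap Γ xs xs' y A B (quantInv Γ xs xs' y A B w) = w := by
  rcases pair_cases hxs' w with ⟨w, rfl⟩ | ⟨x, hx, rfl⟩ | rfl | ⟨a, rfl⟩ | ⟨b, rfl⟩
  · exact ⟨rfl, oldVertex_ne_bodyVertex, rfl⟩
  · exact (not_isSwitched_bindVertex hx hw).elim
  · simp at hw
  · refine ⟨by simp, fun h => ?_, by simp⟩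
    rw [quantInv_bodyVertex, tensorElim_left, quantAll, bodyVertex_inj] at h
    simpa using congrArg (tensorElim True (allElim False fun _ => True) fun _ => True) h
  · refine ⟨by simp, fun h => ?_, by simp⟩
    rw [quantInv_bodyVertex, tensorElim_right, quantAll, bodyVertex_inj] at h
    simpa using congrArg (tensorElim True (fun _ => False) fun _ => True) h

/-- A par or universal quantifier before the reduction, other than the one of the cut, corresponds
to one after it. -/
theorem quantMap_of_isSwitched (hxs : xs.Nodup) {w : SVertex (ext Γ (quantCut xs y A B))}
    (hw : IsSwitched _ w) (hwy : w ≠ quantAll Γ xs y A B) :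
    kindOf _ (quantMap Γ xs xs' y A B w) = kindOf _ w ∧
      quantInv Γ xs xs' y A B (quantMap Γ xs xs' y A B w) = w := by
  rcases quant_cases hxs w with ⟨w, rfl⟩ | ⟨x, hx, rfl⟩ | rfl | rfl | rfl | ⟨a, rfl⟩ | ⟨b, rfl⟩
  · exact ⟨rfl, rfl⟩
  · exact (not_isSwitched_bindVertex hx hw).elim
  · simp at hw
  · exact (hwy rfl).elim
  · simp [quantEx] at hw
  · simp
  · simp

theorem sArg_quantInv (hxs' : xs'.Nodup) {a w : SVertex (ext Γ (pairCut xs' A B))}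
    (hw : IsSwitched _ w) (h : SArg _ a w) :
    SArg _ (quantInv Γ xs xs' y A B a) (quantInv Γ xs xs' y A B w) := by
  rcases pair_cases hxs' w with ⟨w, rfl⟩ | ⟨x, hx, rfl⟩ | rfl | ⟨c, rfl⟩ | ⟨c, rfl⟩
  · obtain ⟨a, rfl, k⟩ := sArg_oldVertex_iff.1 h
    exact sArg_oldVertex_iff.2 ⟨a, rfl, k⟩
  · exact (not_isSwitched_bindVertex hx hw).elim
  · simp at hw
  · obtain ⟨a, rfl, k⟩ := sArg_bodyVertex_iff.1 h
    obtain ⟨a, rfl, k'⟩ := isArg_tensorLeft.1 k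
    rw [quantInv_bodyVertex, quantInv_bodyVertex]
    exact sArg_bodyVertex_iff.2 ⟨_, rfl, isArg_tensorLeft.2 ⟨_, rfl, isArg_allBody.2 ⟨_, rfl, k'⟩⟩⟩
  · obtain ⟨a, rfl, k⟩ := sArg_bodyVertex_iff.1 h
    obtain ⟨a, rfl, k'⟩ := isArg_tensorRight.1 k
    rw [quantInv_bodyVertex, quantInv_bodyVertex]
    exact sArg_bodyVertex_iff.2 ⟨_, rfl, isArg_tensorRight.2 ⟨_, rfl, isArg_exBody.2 ⟨_, rfl, k'⟩⟩⟩

/-- The bound variables of a cut and its root are joined by fixed edges. -/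
theorem conn_pairCut (θ : Set (Sym2 (SLeaf (ext Γ (pairCut xs A B))))) (x : ℕ) :
    Conn (Fixed _ θ) (bindVertex Γ (.tensor A B) xs x) (bodyVertex Γ xs (tensorTop A B)) :=
  conn_bindVertex θ x

theorem fixed_tensorLeft (θ : Set (Sym2 (SLeaf (ext Γ (pairCut xs A B))))) :
    Fixed _ θ (bodyVertex Γ xs (tensorLeft B A.root)) (bodyVertex Γ xs (tensorTop A B)) :=
  fixed_bodyVertex (isArg_tensorTop.2 (.inl rfl)) (.inl rfl)

theorem fixed_tensorRight (θ : Set (Sym2 (SLeaf (ext Γ (pairCut xs A B))))) :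
    Fixed _ θ (bodyVertex Γ xs (tensorRight A B.root)) (bodyVertex Γ xs (tensorTop A B)) :=
  fixed_bodyVertex (isArg_tensorTop.2 (.inr rfl)) (.inl rfl)

theorem vertexOf_quantLeaf (l : SLeaf Γ ⊕ (A.Leaf ⊕ B.Leaf)) :
    quantMap Γ xs xs' y A B (vertexOf _ (quantLeaf Γ xs y A B l)) =
      vertexOf _ (pairLeaf Γ xs' A B l) := by
  rcases l with l | l | l
  · rfl
  · refine (congrArg (quantMap Γ xs xs' y A B) (vertexOf_extLeaf_inr _)).trans
      ((quantMap_bodyVertex _).trans ?_)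
    exact (vertexOf_extLeaf_inr (C := .tensor A B) (.inl l)).symm
  · refine (congrArg (quantMap Γ xs xs' y A B) (vertexOf_extLeaf_inr _)).trans
      ((quantMap_bodyVertex _).trans ?_)
    exact (vertexOf_extLeaf_inr (C := .tensor A B) (.inr l)).symm

/-- Both quantifiers of the cut go to the binder of `y`, which fixed edges join to the cut root.
Hence edges at these quantifiers and along the prefix become fixed paths, even though the order of
the prefix may change. -/
theorem fixed_quantMap (hxs : xs.Nodup)
    {θ : Set (Sym2 (SLeaf Γ ⊕ (A.Leaf ⊕ B.Leaf)))}
    {a b : SVertex (ext Γ (quantCut xs y A B))}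
    (h : Fixed _ (Sym2.map (quantLeaf Γ xs y A B) '' θ) a b) :
    Conn (Fixed _ (Sym2.map (pairLeaf Γ xs' A B) '' θ)) (quantMap Γ xs xs' y A B a)
      (quantMap Γ xs xs' y A B b) := by
  rcases h with ⟨h, hb⟩ | ⟨l, l', ⟨e, he, hl⟩, rfl, rfl⟩
  · rcases quant_cases hxs b with ⟨b, rfl⟩ | ⟨x, hx, rfl⟩ | rfl | rfl | rfl | ⟨c, rfl⟩ | ⟨c, rfl⟩
    · obtain ⟨a, rfl, k⟩ := sArg_oldVertex_iff.1 h
      exact .rel _ _ (fixed_oldVertex k hb)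
    · rw [quantMap_bindVertex hx]
      rcases sArg_bindVertex hxs hx h with rfl | ⟨z, hz, rfl⟩
      · exact (quantMap_bodyVertex (tensorTop (.all y A) (.ex y B))) ▸ (conn_pairCut _ x).symm
      · rw [quantMap_bindVertex hz]
        exact (conn_pairCut _ z).trans _ _ _ (conn_pairCut _ x).symm
    · obtain ⟨a, rfl, k⟩ := sArg_bodyVertex_iff.1 h
      rcases isArg_tensorTop.1 k with rfl | rfl
      · exact (quantMap_quantAll (Γ := Γ) (xs := xs)) ▸ quantMap_bodyVertex
          (tensorTop (.all y A) (.ex y B)) ▸ conn_pairCut _ y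
      · exact (quantMap_quantEx (Γ := Γ) (xs := xs)) ▸ quantMap_bodyVertex
          (tensorTop (.all y A) (.ex y B)) ▸ conn_pairCut _ y
    · exact (hb (.inr (kindOf_bodyVertex _))).elim
    · obtain ⟨a, rfl, k⟩ := sArg_bodyVertex_iff.1 h
      obtain ⟨a, rfl, k'⟩ := isArg_tensorRight.1 k
      obtain rfl := isArg_exTop.1 k'
      rw [quantMap_quantEx, quantMap_bodyVertex]
      exact .trans _ _ _ (.rel _ _ (fixed_tensorRight _)) (conn_pairCut _ y).symm
    · obtain ⟨a, rfl, k⟩ := sArg_bodyVertex_iff.1 h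
      obtain ⟨a, rfl, k'⟩ := isArg_tensorLeft.1 k
      obtain ⟨a, rfl, k''⟩ := isArg_allBody.1 k'
      rw [quantMap_bodyVertex, quantMap_bodyVertex]
      simp only [isSwitched_bodyVertex, kind_tensorLeft, kind_allBody] at hb
      exact .rel _ _ (.inl ⟨sArg_bodyVertex_iff.2 ⟨_, rfl, isArg_tensorLeft.2 ⟨_, rfl, k''⟩⟩,
        by simpa using hb⟩)
    · obtain ⟨a, rfl, k⟩ := sArg_bodyVertex_iff.1 h
      obtain ⟨a, rfl, k'⟩ := isArg_tensorRight.1 k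
      obtain ⟨a, rfl, k''⟩ := isArg_exBody.1 k'
      rw [quantMap_bodyVertex, quantMap_bodyVertex]
      simp only [isSwitched_bodyVertex, kind_tensorRight, kind_exBody] at hb
      exact .rel _ _ (.inl ⟨sArg_bodyVertex_iff.2 ⟨_, rfl, isArg_tensorRight.2 ⟨_, rfl, k''⟩⟩,
        by simpa using hb⟩)
  · induction e using Sym2.ind with
    | _ m m' =>
      have key : ∀ {m m'}, s(m, m') ∈ θ → Conn (Fixed _ (Sym2.map (pairLeaf Γ xs' A B) '' θ))
          (quantMap Γ xs xs' y A B (vertexOf _ (quantLeaf Γ xs y A B m)))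
          (quantMap Γ xs xs' y A B (vertexOf _ (quantLeaf Γ xs y A B m'))) := by
        intro m m' h
        rw [vertexOf_quantLeaf, vertexOf_quantLeaf]
        exact .rel _ _ (.inr ⟨_, _, ⟨_, h, rfl⟩, rfl, rfl⟩)
      rcases Sym2.eq_iff.1 hl with ⟨rfl, rfl⟩ | ⟨rfl, rfl⟩
      · exact key he
      · exact (key he).symm

end Quantifier

/-! ### Unifiers and switchings under quantifier reduction -/

section Quantifier

open Formula

variable {L : FirstOrder.Language.{u, v}} {J : Type} {Γ : J → Formula L} {xs xs' : List ℕ} {y : ℕ}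
  {A B : Formula L}

theorem notMem_map_image {X Y : Type} {p : X → Y} (hp : Function.Injective p) {θ : Set (Sym2 X)}
    (hθ : ∀ l, s(l, l) ∉ θ) (l : Y) : s(l, l) ∉ Sym2.map p '' θ := by
  rintro ⟨e, he, h⟩
  induction e using Sym2.ind with
  | _ a b =>
    obtain ⟨ha, hb⟩ : p a = l ∧ p b = l := by simpa using h
    exact hθ a ((hp (ha.trans hb.symm)) ▸ he)

theorem ncard_map_image {X Y : Type} {p : X → Y} (hp : Function.Injective p) (θ : Set (Sym2 X)) :
    (Sym2.map p '' θ).ncard = θ.ncard :=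
  Set.ncard_image_of_injective _ (Sym2.map.injective hp)

/-- An equation between values at linked leaves transfers to the image of a linking. -/
theorem forall_mem_map_image {X Y T : Type*} {p : X → Y} {θ : Set (Sym2 X)} {k : Y → T}
    (h : ∀ l l', s(l, l') ∈ θ → k (p l) = k (p l')) (l l' : Y) (hl : s(l, l') ∈ Sym2.map p '' θ) :
    k l = k l' := by
  obtain ⟨e, he, hl⟩ := hl
  induction e using Sym2.ind with
  | _ a b =>
    rcases Sym2.eq_iff.1 hl with ⟨rfl, rfl⟩ | ⟨rfl, rfl⟩
    · exact h _ _ he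
    · exact (h _ _ he).symm

theorem argsOf_quantLeaf_left (hxs : xs.Nodup) (l : A.Leaf) :
    argsOf _ (quantLeaf Γ xs y A B (.inr (.inl l))) =
      A.leafArgs (Function.update (fun x => if x ∈ xs then Sum.inr (bindVertex Γ _ xs x) else .inl x)
        y (.inr (quantAll Γ xs y A B)))
        (fun w => .inr (bodyVertex Γ xs (tensorLeft (.ex y B) (allBody y w)))) l :=
  argsOf_extLeaf_inr (C := .tensor (.all y A) (.ex y B)) hxs (.inl l)

theorem argsOf_quantLeaf_right (hxs : xs.Nodup) (l : B.Leaf) :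
    argsOf _ (quantLeaf Γ xs y A B (.inr (.inr l))) =
      B.leafArgs (Function.update (fun x => if x ∈ xs then Sum.inr (bindVertex Γ _ xs x) else .inl x)
        y (.inr (quantEx Γ xs y A B)))
        (fun w => .inr (bodyVertex Γ xs (tensorRight (.all y A) (exBody y w)))) l :=
  argsOf_extLeaf_inr (C := .tensor (.all y A) (.ex y B)) hxs (.inr l)

theorem argsOf_quantLeaf_inl (l : SLeaf Γ) :
    argsOf _ (quantLeaf Γ xs y A B (.inl l)) =
      (Γ l.1).leafArgs Sum.inl (fun w => Sum.inr (oldVertex _ ⟨l.1, w⟩)) l.2 := rfl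

theorem argsOf_pairLeaf_inl (l : SLeaf Γ) :
    argsOf _ (pairLeaf Γ xs A B (.inl l)) =
      (Γ l.1).leafArgs Sum.inl (fun w => Sum.inr (oldVertex _ ⟨l.1, w⟩)) l.2 := rfl

theorem argsOf_pairLeaf_left (hxs : xs.Nodup) (l : A.Leaf) :
    argsOf _ (pairLeaf Γ xs A B (.inr (.inl l))) =
      A.leafArgs (fun x => if x ∈ xs then Sum.inr (bindVertex Γ _ xs x) else .inl x)
        (fun w => .inr (bodyVertex Γ xs (tensorLeft B w))) l :=
  argsOf_extLeaf_inr (C := .tensor A B) hxs (.inl l)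

theorem argsOf_pairLeaf_right (hxs : xs.Nodup) (l : B.Leaf) :
    argsOf _ (pairLeaf Γ xs A B (.inr (.inr l))) =
      B.leafArgs (fun x => if x ∈ xs then Sum.inr (bindVertex Γ _ xs x) else .inl x)
        (fun w => .inr (bodyVertex Γ xs (tensorRight A w))) l :=
  argsOf_extLeaf_inr (C := .tensor A B) hxs (.inr l)

/-- The terms after the reduction, from those before it. -/
theorem argsOf_pairLeaf (hxs : xs.Nodup) (hxs' : xs'.Nodup) (hA : ∀ x, x ∈ xs' ↔ x ∈ A.fv)
    (hB : ∀ x, x ∈ xs' ↔ x ∈ B.fv) (hx : ∀ x, x ∈ xs ↔ x ∈ xs' ∧ x ≠ y)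
    (l : SLeaf Γ ⊕ (A.Leaf ⊕ B.Leaf)) :
    argsOf _ (pairLeaf Γ xs' A B l) = (argsOf _ (quantLeaf Γ xs y A B l)).map
      fun t => t.relabel (Sum.map id (quantMap Γ xs xs' y A B)) := by
  have key : ∀ x ∈ xs', ∀ w, quantMap Γ xs xs' y A B w = bindVertex Γ _ xs' y →
      Sum.map id (quantMap Γ xs xs' y A B) (Function.update
        (fun x => if x ∈ xs then Sum.inr (bindVertex Γ _ xs x) else .inl x) y (.inr w) x) =
      if x ∈ xs' then Sum.inr (bindVertex Γ _ xs' x) else .inl x := by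
    intro x hx' w hw
    by_cases hxy : x = y
    · subst hxy
      simp [hx', hw]
    · have : x ∈ xs := (hx x).2 ⟨hx', hxy⟩
      simp [hxy, this, hx', quantMap_bindVertex]
  rcases l with l | l | l
  · rw [argsOf_pairLeaf_inl, argsOf_quantLeaf_inl]
    exact (leafArgs_relabel _ (fun _ _ => by rfl) (fun _ => by rfl) _).symm
  · rw [argsOf_pairLeaf_left hxs', argsOf_quantLeaf_left hxs]
    refine (leafArgs_relabel _ (fun x hxA => ?_) (fun w => by simp) _).symm
    exact key x ((hA x).2 hxA) _ quantMap_quantAll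
  · rw [argsOf_pairLeaf_right hxs', argsOf_quantLeaf_right hxs]
    refine (leafArgs_relabel _ (fun x hxB => ?_) (fun w => by simp) _).symm
    exact key x ((hB x).2 hxB) _ quantMap_quantEx

theorem isNonvacuousEx_quantEx (hxs : xs.Nodup) (hy : y ∈ B.fv) :
    IsNonvacuousEx _ (quantEx Γ xs y A B) := by
  obtain ⟨l, t, ht, h⟩ := B.exists_leaf_of_mem_fv
    (Function.update (fun x => if x ∈ xs then Sum.inr (bindVertex Γ _ xs x) else .inl x)
        y (.inr (quantEx Γ xs y A B)))
    (fun w => .inr (bodyVertex Γ xs (tensorRight (.all y A) (exBody y w)))) hy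
  rw [← argsOf_quantLeaf_right hxs] at ht
  rw [Function.update_self] at h
  exact ⟨kindOf_bodyVertex _, _, t, ht, occurs_iff.2 h⟩

/-- A non-vacuous existential quantifier after the reduction comes from one before it. -/
theorem isNonvacuousEx_quantInv (hxs : xs.Nodup) (hxs' : xs'.Nodup)
    (hA : ∀ x, x ∈ xs' ↔ x ∈ A.fv) (hB : ∀ x, x ∈ xs' ↔ x ∈ B.fv)
    (hx : ∀ x, x ∈ xs ↔ x ∈ xs' ∧ x ≠ y) {w : SVertex (ext Γ (pairCut xs' A B))}
    (hw : IsNonvacuousEx _ w) : IsNonvacuousEx _ (quantInv Γ xs xs' y A B w) := by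
  obtain ⟨hk, l, t, ht, hocc⟩ := hw
  obtain ⟨m, rfl⟩ : ∃ m, pairLeaf Γ xs' A B m = l := extLeaf_bijective.2 l
  rw [argsOf_pairLeaf hxs hxs' hA hB hx] at ht
  obtain ⟨t, htm, rfl⟩ := List.mem_map.1 ht
  obtain ⟨u, hu, hwu⟩ := mem_vars_relabel.1 (occurs_iff.1 hocc)
  obtain ⟨u, rfl, rfl⟩ : ∃ u', u = Sum.inr u' ∧ w = quantMap Γ xs xs' y A B u' := by
    rcases u with n | u
    · cases hwu
    · exact ⟨u, rfl, Sum.inr_injective hwu⟩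
  have main : kindOf _ u = .ex → quantInv Γ xs xs' y A B (quantMap Γ xs xs' y A B u) = u →
      IsNonvacuousEx _ (quantInv Γ xs xs' y A B (quantMap Γ xs xs' y A B u)) := fun h1 h2 => by
    rw [h2]
    exact ⟨h1, _, t, htm, occurs_iff.2 hu⟩
  -- When `y` is not free in the body, the binder defaults to the tensor of the cut, which is not
  -- existential.
  have hyx : kindOf _ (bindVertex Γ (.tensor A B) xs' y) = .ex → y ∈ xs' := by
    intro h
    by_contra hy
    rw [bindVertex_of_notMem hy, kindOf_bodyVertex] at h
    cases h
  rcases quant_cases hxs u with ⟨w, rfl⟩ | ⟨x, hx', rfl⟩ | rfl | rfl | rfl | ⟨a, rfl⟩ | ⟨b, rfl⟩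
  · exact main hk rfl
  · refine main (kindOf_bindVertex hx') ?_
    rw [quantMap_bindVertex hx', quantInv_bindVertex ((hx x).1 hx').1, if_neg ((hx x).1 hx').2]
  · simp at hk
  -- An occurrence formerly bound by the universal quantifier of the cut is now bound existentially.
  -- The old existential witness comes from the dual side, which has the same free variables.
  · rw [quantMap_quantAll] at hk ⊢
    rw [quantInv_bindVertex (hyx hk), if_pos rfl]
    exact isNonvacuousEx_quantEx hxs ((hB y).1 (hyx hk))
  · rw [quantMap_quantEx] at hk ⊢
    rw [quantInv_bindVertex (hyx hk), if_pos rfl]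
    exact isNonvacuousEx_quantEx hxs ((hB y).1 (hyx hk))
  · exact main (by simpa using hk) (by simp)
  · exact main (by simpa using hk) (by simp)

theorem isSwitched_quantAll : IsSwitched _ (quantAll Γ xs y A B) := .inr (kindOf_bodyVertex _)

/-- Both are arguments of the tensor of the cut, which is not switched. This provides the fixed path
needed both to exclude a leap between them and to apply the exchange argument. -/
theorem conn_quantEx_quantAll (θ : Set (Sym2 (SLeaf (ext Γ (quantCut xs y A B))))) :
    Conn (Fixed _ θ) (quantEx Γ xs y A B) (quantAll Γ xs y A B) :=
  .trans _ _ _ (.rel _ _ (fixed_bodyVertex (isArg_tensorTop.2 (.inr rfl)) (.inl rfl)))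
    (.symm _ _ (.rel _ _ (fixed_bodyVertex (isArg_tensorTop.2 (.inl rfl)) (.inl rfl))))

/-- In a correct linking, the existential quantifier of a cut does not precede the universal
one. -/
theorem not_precedes_of_conn {ι : Type} {Γ : ι → Formula L} [Finite (SVertex Γ)]
    {θ : Set (Sym2 (SLeaf Γ))} (hs : Sparse (Fixed Γ θ) (IsSwitched Γ)) (hc : AllConn Γ θ)
    {x y : SVertex Γ} (hxy : Conn (Fixed Γ θ) x y) : ¬ Precedes Γ θ x y := by
  classical
  intro h
  have : ∀ w, ∃ a, IsSwitched Γ w → Source Γ θ a w := fun w => by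
    by_cases hw : IsSwitched Γ w
    · obtain ⟨a, ha⟩ := exists_sArg Γ hw
      exact ⟨a, fun _ => .inl ha⟩
    · exact ⟨w, fun h => (hw h).elim⟩
  choose c hcs using this
  -- In a switching that uses the leap from `x` to `y`, the leap would be redundant beside the fixed
  -- path, against the edge count.
  refine hs.not_conn (Function.update c y x) h.isSwitched fun a b => ?_
  have h1 := SwAdj.conn_split (w := y) (c' := Function.update c y x) (fun _ _ => rfl)
    (hc (Function.update c y x) (fun w hw => ?_) a b)
  · refine h1.mono ?_
    rintro u v (h | ⟨rfl, rfl⟩)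
    · exact .rel _ _ h
    · rw [Function.update_self]
      exact hxy.mono fun _ _ h => .rel _ _ (.inl h)
  · by_cases hwy : w = y
    · subst hwy
      rw [Function.update_self]
      exact .inr h
    · rw [Function.update_of_ne hwy]
      exact hcs w hw

open Classical in
/-- The substitution for constants that replaces the universal variable of the cut by the term
assigned to the existential one. -/
noncomputable def quantSubst (Γ : J → Formula L) (xs xs' : List ℕ) (y : ℕ) (A B : Formula L)
    (σ : SVar (ext Γ (quantCut xs y A B)) → L.Term (SVar (ext Γ (quantCut xs y A B)))) :
    SVar (ext Γ (quantCut xs y A B)) → L.Term (SVar (ext Γ (pairCut xs' A B))) := fun s =>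
  if s = .inr (quantAll Γ xs y A B) then
    if IsNonvacuousEx _ (quantEx Γ xs y A B) then
      (σ (.inr (quantEx Γ xs y A B))).relabel (Sum.map id (quantMap Γ xs xs' y A B))
    else .var (.inl 0)
  else .var (Sum.map id (quantMap Γ xs xs' y A B) s)

-- The new assignment is the old mgu followed by the replacement of the universal variable of the
-- cut by the existential term. A universal variable in a new term is either already in the old term
-- or enters through this replacement, which gives the two alternatives for leaps.
open Classical in
theorem quant_transfer (hxs : xs.Nodup) (hxs' : xs'.Nodup)
    (hA : ∀ x, x ∈ xs' ↔ x ∈ A.fv) (hB : ∀ x, x ∈ xs' ↔ x ∈ B.fv)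
    (hx : ∀ x, x ∈ xs ↔ x ∈ xs' ∧ x ≠ y) {θ : Set (Sym2 (SLeaf Γ ⊕ (A.Leaf ⊕ B.Leaf)))}
    {σ : SVar (ext Γ (quantCut xs y A B)) → L.Term (SVar (ext Γ (quantCut xs y A B)))}
    (hσ : IsMGU _ (Sym2.map (quantLeaf Γ xs y A B) '' θ) σ)
    (hn : ¬ Precedes _ (Sym2.map (quantLeaf Γ xs y A B) '' θ) (quantEx Γ xs y A B)
      (quantAll Γ xs y A B)) :
    (∃ τ, IsUnifier _ (Sym2.map (pairLeaf Γ xs' A B) '' θ) τ) ∧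
    ∀ u w, Precedes _ (Sym2.map (pairLeaf Γ xs' A B) '' θ) u w →
      ∃ w', w' ≠ quantAll Γ xs y A B ∧ kindOf _ w' = .all ∧ quantMap Γ xs xs' y A B w' = w ∧
        (Precedes _ (Sym2.map (quantLeaf Γ xs y A B) '' θ) (quantInv Γ xs xs' y A B u) w' ∨
          (Precedes _ (Sym2.map (quantLeaf Γ xs y A B) '' θ) (quantInv Γ xs xs' y A B u)
            (quantAll Γ xs y A B) ∧
          Precedes _ (Sym2.map (quantLeaf Γ xs y A B) '' θ) (quantEx Γ xs y A B) w')) := by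
  set κ := quantSubst Γ xs xs' y A B σ with hκ
  have hκn : ∀ s, s ≠ .inr (quantAll Γ xs y A B) →
      κ s = .var (Sum.map id (quantMap Γ xs xs' y A B) s) := fun s hs => if_neg hs
  -- This is where the absence of a leap inside the cut is used: the replacement term does not
  -- contain the variable it replaces, so one replacement eliminates that variable.
  have hnot : IsNonvacuousEx _ (quantEx Γ xs y A B) →
      ∀ s ∈ vars (σ (.inr (quantEx Γ xs y A B))), s ≠ .inr (quantAll Γ xs y A B) := by
    rintro hv s hs rfl
    exact hn (hσ.precedes hv (kindOf_bodyVertex _) hs)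
  have hκy : IsNonvacuousEx _ (quantEx Γ xs y A B) → κ (.inr (quantAll Γ xs y A B)) =
      (σ (.inr (quantEx Γ xs y A B))).relabel (Sum.map id (quantMap Γ xs xs' y A B)) := fun h => by
    rw [hκ, quantSubst, if_pos rfl, if_pos h]
  have hκy' : ¬ IsNonvacuousEx _ (quantEx Γ xs y A B) → κ (.inr (quantAll Γ xs y A B)) =
      .var (.inl 0) := fun h => by
    rw [hκ, quantSubst, if_pos rfl, if_neg h]
  have hconst : ∀ s, IsConstVar _ s → s ≠ .inr (quantAll Γ xs y A B) →
      IsConstVar (ext Γ (pairCut xs' A B)) (Sum.map id (quantMap Γ xs xs' y A B) s) := by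
    rintro (n | w) hs hsy
    · trivial
    · exact (quantMap_of_isSwitched hxs (.inr hs) fun h => hsy (congrArg _ h)).1.trans hs
  have hrange : IsNonvacuousEx _ (quantEx Γ xs y A B) →
      ∀ s ∈ vars (σ (.inr (quantEx Γ xs y A B))), IsConstVar _ s := fun hv s hs =>
    hσ.1.range (.inr (quantEx Γ xs y A B)) hv s (occurs_iff.2 hs)
  -- After the replacement the two occurrences of `y`, universal in `A` and existential in `B`, have
  -- the same value, as required by the single binder of the new cut.
  have hsubst : y ∈ xs' → (σ (.inr (quantEx Γ xs y A B))).subst κ =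
      (σ (.inr (quantAll Γ xs y A B))).subst κ := by
    intro hy
    have hv := isNonvacuousEx_quantEx (Γ := Γ) (A := A) hxs ((hB y).1 hy)
    have hc : IsConstVar (ext Γ (quantCut xs y A B)) (.inr (quantAll Γ xs y A B)) :=
      kindOf_bodyVertex _
    rw [hσ.1.fixes _ fun h => h.not_isConstVar hc]
    refine Eq.trans ?_ (hκy hv).symm
    rw [relabel_eq_subst]
    exact subst_congr fun s hs => hκn s (hnot hv s hs)
  have hv : ∀ x ∈ xs', ∀ w, (σ (.inr w)).subst κ = (σ (.inr (quantEx Γ xs y A B))).subst κ ∨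
      x ≠ y → (σ (Sum.map id (quantInv Γ xs xs' y A B)
        (if x ∈ xs' then Sum.inr (bindVertex Γ _ xs' x) else .inl x))).subst κ =
        (σ (Function.update (fun x => if x ∈ xs then Sum.inr (bindVertex Γ _ xs x) else .inl x) y
          (.inr w) x)).subst κ := by
    intro x hx' w hw
    rw [if_pos hx', Sum.map_inr, quantInv_bindVertex hx']
    by_cases hxy : x = y
    · subst hxy
      rw [if_pos rfl, Function.update_self]
      exact (hw.resolve_right fun h => h rfl).symm
    · rw [if_neg hxy, Function.update_of_ne hxy, if_pos ((hx x).2 ⟨hx', hxy⟩)]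
  have hargs : ∀ l, (argsOf _ (pairLeaf Γ xs' A B l)).map (fun t => t.subst fun x =>
      (σ (Sum.map id (quantInv Γ xs xs' y A B) x)).subst κ) =
      ((argsOf _ (quantLeaf Γ xs y A B l)).map fun t => t.subst σ).map fun t => t.subst κ := by
    intro l
    simp only [List.map_map, Function.comp_def, subst_subst]
    rcases l with l | l | l
    · rw [argsOf_pairLeaf_inl, argsOf_quantLeaf_inl]
      exact leafArgs_subst_congr _ (fun _ _ => by rfl) (fun _ => by rfl) _
    · rw [argsOf_pairLeaf_left hxs', argsOf_quantLeaf_left hxs]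
      refine leafArgs_subst_congr _ (fun x hxA => ?_) (fun w => by simp) _
      refine hv x ((hA x).2 hxA) _ ?_
      by_cases hxy : x = y
      · subst hxy
        exact .inl (hsubst ((hA x).2 hxA)).symm
      · exact .inr hxy
    · rw [argsOf_pairLeaf_right hxs', argsOf_quantLeaf_right hxs]
      exact leafArgs_subst_congr _ (fun x hxB => hv x ((hB x).2 hxB) _ (.inl rfl))
        (fun w => by simp) _
  obtain ⟨hu, hp⟩ := unifier_transfer (θ' := Sym2.map (pairLeaf Γ xs' A B) '' θ) hσ.1
    (quantInv Γ xs xs' y A B) κ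
    (fun w hw => by
      obtain ⟨h1, h2, h3⟩ := quantInv_of_isSwitched (xs := xs) (y := y) hxs' (.inr hw)
      refine ⟨h1.trans hw, ?_⟩
      rw [hκn _ fun h => h2 (Sum.inr_injective h), Sum.map_inr, h3])
    (fun n => hκn _ fun h => by cases h)
    (fun w hw => isNonvacuousEx_quantInv hxs hxs' hA hB hx hw)
    (by
      intro s hs z hz
      by_cases hsy : s = .inr (quantAll Γ xs y A B)
      · subst hsy
        by_cases hv : IsNonvacuousEx _ (quantEx Γ xs y A B)
        · rw [hκy hv] at hz
          obtain ⟨s, hs, rfl⟩ := mem_vars_relabel.1 hz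
          exact hconst s (hrange hv s hs) (hnot hv s hs)
        · rw [hκy' hv] at hz
          obtain rfl : z = _ := hz
          trivial
      · rw [hκn s hsy] at hz
        obtain rfl : z = _ := hz
        exact hconst s hs hsy)
    (forall_mem_map_image fun l l' hl => by
      rw [hargs, hargs, hσ.1.equalizes _ _ ⟨_, hl, rfl⟩])
  refine ⟨hu, fun u w huw => ?_⟩
  obtain ⟨hu, s, hs, hsu, hws⟩ := hp u w huw
  by_cases hsy : s = .inr (quantAll Γ xs y A B)
  · subst hsy
    by_cases hv : IsNonvacuousEx _ (quantEx Γ xs y A B)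
    · rw [hκy hv] at hws
      obtain ⟨s, hs', hw⟩ := mem_vars_relabel.1 hws
      rcases s with n | w'
      · cases hw
      · obtain rfl : w = _ := Sum.inr_injective hw
        have hk := hrange hv _ hs'
        exact ⟨w', fun h => hnot hv _ hs' (congrArg _ h), hk, rfl,
          .inr ⟨hσ.precedes hu hs hsu, hσ.precedes hv hk hs'⟩⟩
    · rw [hκy' hv] at hws
      cases hws
  · rw [hκn s hsy] at hws
    rcases s with n | w'
    · cases hws
    · obtain rfl : w = _ := Sum.inr_injective hws
      exact ⟨w', fun h => hsy (congrArg _ h), hs, rfl, .inl (hσ.precedes hu hs hsu)⟩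

/-- Reduction of a quantifier cut preserves correctness. -/
theorem Correct.quantifier [Finite J] (hxs : xs.Nodup) (hxs' : xs'.Nodup)
    (hA : ∀ x, x ∈ xs' ↔ x ∈ A.fv) (hB : ∀ x, x ∈ xs' ↔ x ∈ B.fv)
    (hx : ∀ x, x ∈ xs ↔ x ∈ xs' ∧ x ≠ y) {θ : Set (Sym2 (SLeaf Γ ⊕ (A.Leaf ⊕ B.Leaf)))}
    (hθ : ∀ l, s(l, l) ∉ θ)
    (h : Correct (ext Γ (quantCut xs y A B)) (Sym2.map (quantLeaf Γ xs y A B) '' θ)) :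
    Correct (ext Γ (pairCut xs' A B)) (Sym2.map (pairLeaf Γ xs' A B) '' θ) := by
  have := Fintype.ofFinite J
  have hinj : Function.Injective (quantLeaf Γ xs y A B) := extLeaf_bijective.1
  have hinj' : Function.Injective (pairLeaf Γ xs' A B) := extLeaf_bijective.1
  obtain ⟨hb, hc⟩ := h.balanced_and_allConn (notMem_map_image hinj hθ)
  obtain ⟨σ, hσ⟩ := exists_isMGU h.1
  have hs := hb.sparse
  obtain ⟨hu, hp⟩ := quant_transfer hxs hxs' hA hB hx hσ
    (not_precedes_of_conn hs hc (conn_quantEx_quantAll _))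
  refine correct_of_allConn hu ?_ ?_
  -- Quantifiers contribute nothing to the excess, and the links are unchanged.
  · rw [balanced_iff, sum_excess_ext, ncard_map_image, excess_exs] at hb ⊢
    · simpa [excess] using hb
    · exact hinj'
    · exact hinj
  -- Composite leaps through the cut are added to the old graph before contracting it, so that every
  -- leap after the reduction has a preimage.
  · have hc' := hs.conn_augment isSwitched_quantAll (conn_quantEx_quantAll _) hc
    refine conn_of_map (F := Fixed _ _) (Sw := IsSwitched _)
      (In := fun u w => Source _ _ u w ∨
        (Source _ _ u (quantAll Γ xs y A B) ∧ Source _ _ (quantEx Γ xs y A B) w))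
      (quantMap Γ xs xs' y A B) (quantInv Γ xs xs' y A B) hc'
      (fun a b => fixed_quantMap hxs) ?_ ?_
    · intro w
      have : quantMap Γ xs xs' y A B (quantInv Γ xs xs' y A B w) = w := by
        rcases pair_cases hxs' w with ⟨w, rfl⟩ | ⟨x, hx', rfl⟩ | rfl | ⟨a, rfl⟩ | ⟨b, rfl⟩
        · rfl
        · rw [quantInv_bindVertex hx']
          split_ifs with hxy
          · rw [quantMap_quantEx, hxy]
          · rw [quantMap_bindVertex ((hx x).2 ⟨hx', hxy⟩)]
        · simp
        · simp
        · simp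
      rw [this]
      exact .refl _
    · intro w hw
      by_cases hwy : w = quantAll Γ xs y A B
      · subst hwy
        -- The universal quantifier of the cut is no longer switched. Its argument edge is chosen,
        -- as that one collapses to a fixed path.
        refine .inl ⟨bodyVertex Γ xs (tensorLeft _ (allBody y A.root)), .inl (.inl ?_), ?_⟩
        · exact sArg_bodyVertex_iff.2 ⟨_, rfl, isArg_tensorLeft.2 ⟨_, rfl, rfl⟩⟩
        · rw [quantMap_quantAll, quantMap_bodyVertex]
          exact .trans _ _ _ (.rel _ _ (fixed_tensorLeft _)) (conn_pairCut _ y).symm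
      · obtain ⟨h1, h2⟩ := quantMap_of_isSwitched (xs' := xs') hxs hw hwy
        have hw' : IsSwitched _ (quantMap Γ xs xs' y A B w) := by
          unfold IsSwitched at hw ⊢
          rwa [h1]
        refine .inr ⟨hw', ?_⟩
        rintro a (h | h)
        · have := sArg_quantInv (xs := xs) (y := y) hxs' hw' h
          rw [h2] at this
          exact .inl (.inl this)
        · obtain ⟨w', hne, hk, hw', h'⟩ := hp _ _ h
          obtain rfl : w' = w := by
            rw [← h2, ← hw', (quantMap_of_isSwitched (xs' := xs') hxs (.inr hk) hne).2]
          exact h'.imp Or.inr fun h => ⟨Or.inr h.1, Or.inr h.2⟩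

end Quantifier

/-! ### Multiplicative cuts -/

section Embeds

open Formula

variable {L : FirstOrder.Language.{u, v}} {ι ι' : Type}

/-- The map `e` embeds the parse tree of `D` as a subformula of the sequent `S`. -/
structure Embeds (S : ι → Formula L) (D : Formula L) (e : D.Vertex → SVertex S) : Prop where
  kindOf_eq : ∀ c, kindOf S (e c) = D.kind c
  sArg_iff : ∀ a c, SArg S a (e c) ↔ ∃ a', a = e a' ∧ D.IsArg a' c

variable {S : ι → Formula L} {S' : ι' → Formula L} {A B D : Formula L}

theorem embeds_bodyVertex (S : ι → Formula L) (C : Formula L) (xs : List ℕ) :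
    Embeds (ext S (exs xs C)) C (bodyVertex S xs) :=
  ⟨kindOf_bodyVertex, fun _ _ => sArg_bodyVertex_iff⟩

theorem Embeds.old {e : D.Vertex → SVertex S} (h : Embeds S D e) (E : Formula L) :
    Embeds (ext S E) D fun w => oldVertex E (e w) := by
  refine ⟨h.kindOf_eq, fun a c => sArg_oldVertex_iff.trans ⟨?_, ?_⟩⟩
  · rintro ⟨a, rfl, ha⟩
    obtain ⟨a, rfl, h'⟩ := (h.sArg_iff _ _).1 ha
    exact ⟨a, rfl, h'⟩
  · rintro ⟨a, rfl, h'⟩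
    exact ⟨_, rfl, (h.sArg_iff _ _).2 ⟨a, rfl, h'⟩⟩

theorem Embeds.comp {e : D.Vertex → SVertex S} (h : Embeds S D e) {i : A.Vertex → D.Vertex}
    (hk : ∀ c, D.kind (i c) = A.kind c)
    (hi : ∀ a c, D.IsArg a (i c) ↔ ∃ a', a = i a' ∧ A.IsArg a' c) :
    Embeds S A fun a => e (i a) := by
  refine ⟨fun c => (h.kindOf_eq _).trans (hk c), fun a c => (h.sArg_iff _ _).trans ⟨?_, ?_⟩⟩
  · rintro ⟨a, rfl, ha⟩
    obtain ⟨a, rfl, h'⟩ := (hi _ _).1 ha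
    exact ⟨a, rfl, h'⟩
  · rintro ⟨a, rfl, h'⟩
    exact ⟨_, rfl, (hi _ _).2 ⟨a, rfl, h'⟩⟩

theorem Embeds.tensorLeft {e : (tensor A B).Vertex → SVertex S} (h : Embeds S (tensor A B) e) :
    Embeds S A fun a => e (tensorLeft B a) :=
  h.comp (fun _ => rfl) fun _ _ => isArg_tensorLeft

theorem Embeds.tensorRight {e : (tensor A B).Vertex → SVertex S} (h : Embeds S (tensor A B) e) :
    Embeds S B fun b => e (tensorRight A b) :=
  h.comp (fun _ => rfl) fun _ _ => isArg_tensorRight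

theorem Embeds.parLeft {e : (par A B).Vertex → SVertex S} (h : Embeds S (par A B) e) :
    Embeds S A fun a => e (parLeft B a) :=
  h.comp (fun _ => rfl) fun _ _ => isArg_parLeft

theorem Embeds.parRight {e : (par A B).Vertex → SVertex S} (h : Embeds S (par A B) e) :
    Embeds S B fun b => e (parRight A b) :=
  h.comp (fun _ => rfl) fun _ _ => isArg_parRight

theorem Embeds.isSwitched_iff {e : D.Vertex → SVertex S} {e' : D.Vertex → SVertex S'}
    (h : Embeds S D e) (h' : Embeds S' D e') (c : D.Vertex) :
    IsSwitched S (e c) ↔ IsSwitched S' (e' c) := by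
  rw [IsSwitched, IsSwitched, h.kindOf_eq, h'.kindOf_eq]

theorem Embeds.exists_of_sArg {e : D.Vertex → SVertex S} {e' : D.Vertex → SVertex S'}
    (h : Embeds S D e) (h' : Embeds S' D e') {a : SVertex S} {c : D.Vertex}
    (hac : SArg S a (e c)) : ∃ a', a = e a' ∧ SArg S' (e' a') (e' c) := by
  obtain ⟨a, rfl, k⟩ := (h.sArg_iff _ _).1 hac
  exact ⟨a, rfl, (h'.sArg_iff _ _).2 ⟨a, rfl, k⟩⟩

end Embeds

/-- Rearrangement of a sum. -/
def multSum {X X₁ X₂ X₃ X₄ : Type} : (X ⊕ (X₁ ⊕ X₃)) ⊕ (X₂ ⊕ X₄) → X ⊕ ((X₁ ⊕ X₂) ⊕ (X₃ ⊕ X₄))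
  | .inl (.inl l) => .inl l
  | .inl (.inr (.inl l)) => .inr (.inl (.inl l))
  | .inl (.inr (.inr l)) => .inr (.inr (.inl l))
  | .inr (.inl l) => .inr (.inl (.inr l))
  | .inr (.inr l) => .inr (.inr (.inr l))

theorem multSum_injective {X X₁ X₂ X₃ X₄ : Type} :
    Function.Injective (multSum (X := X) (X₁ := X₁) (X₂ := X₂) (X₃ := X₃) (X₄ := X₄)) := by
  rintro ((l | l | l) | l | l) ((l' | l' | l') | l' | l') hl <;> simp_all [multSum]

section Multiplicative

open Formula

variable {L : FirstOrder.Language.{u, v}} {J : Type}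

/-- The encoding of the cut between `A ⊗ B` and `A' ⅋ B'`, with bound variables `xs`. -/
abbrev multCut (xs : List ℕ) (A B A' B' : Formula L) : Formula L :=
  exs xs (.tensor (.tensor A B) (.par A' B'))

variable (Γ : J → Formula L) (xs xsA xsB : List ℕ) (A B A' B' : Formula L)

/-- The sequent with a cut between `A` and `A'` and one between `B` and `B'`. -/
abbrev splitSequent : Option (Option J) → Formula L :=
  ext (ext Γ (pairCut xsA A A')) (pairCut xsB B B')

/-- The root of a multiplicative cut. -/
def multTop : SVertex (ext Γ (multCut xs A B A' B')) :=
  bodyVertex Γ xs (tensorTop (.tensor A B) (.par A' B'))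

/-- The root of `A ⊗ B` in a multiplicative cut. -/
def multTensor : SVertex (ext Γ (multCut xs A B A' B')) :=
  bodyVertex Γ xs (tensorLeft (.par A' B') (tensorTop A B))

/-- The root of `A' ⅋ B'` in a multiplicative cut. -/
def multPar : SVertex (ext Γ (multCut xs A B A' B')) :=
  bodyVertex Γ xs (tensorRight (.tensor A B) (parTop A' B'))

/-- The vertices of `A` in a multiplicative cut. -/
def multA (a : A.Vertex) : SVertex (ext Γ (multCut xs A B A' B')) :=
  bodyVertex Γ xs (tensorLeft (.par A' B') (tensorLeft B a))

/-- The vertices of `B` in a multiplicative cut. -/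
def multB (b : B.Vertex) : SVertex (ext Γ (multCut xs A B A' B')) :=
  bodyVertex Γ xs (tensorLeft (.par A' B') (tensorRight A b))

/-- The vertices of `A'` in a multiplicative cut. -/
def multA' (a : A'.Vertex) : SVertex (ext Γ (multCut xs A B A' B')) :=
  bodyVertex Γ xs (tensorRight (.tensor A B) (parLeft B' a))

/-- The vertices of `B'` in a multiplicative cut. -/
def multB' (b : B'.Vertex) : SVertex (ext Γ (multCut xs A B A' B')) :=
  bodyVertex Γ xs (tensorRight (.tensor A B) (parRight A' b))

/-- The root of the cut between `A` and `A'`. -/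
def splitTopA : SVertex (splitSequent Γ xsA xsB A B A' B') :=
  oldVertex _ (bodyVertex Γ xsA (tensorTop A A'))

/-- The root of the cut between `B` and `B'`. -/
def splitTopB : SVertex (splitSequent Γ xsA xsB A B A' B') :=
  bodyVertex _ xsB (tensorTop B B')

/-- The variable `x` of the cut between `A` and `A'`. -/
def splitBindA (x : ℕ) : SVertex (splitSequent Γ xsA xsB A B A' B') :=
  oldVertex _ (bindVertex Γ (tensor A A') xsA x)

/-- The variable `x` of the cut between `B` and `B'`. -/
def splitBindB (x : ℕ) : SVertex (splitSequent Γ xsA xsB A B A' B') :=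
  bindVertex _ (tensor B B') xsB x

/-- The vertices of `A` after a multiplicative reduction. -/
def splitA (a : A.Vertex) : SVertex (splitSequent Γ xsA xsB A B A' B') :=
  oldVertex _ (bodyVertex Γ xsA (tensorLeft A' a))

/-- The vertices of `A'` after a multiplicative reduction. -/
def splitA' (a : A'.Vertex) : SVertex (splitSequent Γ xsA xsB A B A' B') :=
  oldVertex _ (bodyVertex Γ xsA (tensorRight A a))

/-- The vertices of `B` after a multiplicative reduction. -/
def splitB (b : B.Vertex) : SVertex (splitSequent Γ xsA xsB A B A' B') :=
  bodyVertex _ xsB (tensorLeft B' b)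

/-- The vertices of `B'` after a multiplicative reduction. -/
def splitB' (b : B'.Vertex) : SVertex (splitSequent Γ xsA xsB A B A' B') :=
  bodyVertex _ xsB (tensorRight B b)

/-- Reduction of a multiplicative cut, on vertices. -/
def splitMap : SVertex (ext Γ (multCut xs A B A' B')) → SVertex (splitSequent Γ xsA xsB A B A' B') :=
  exsElim (fun w => oldVertex _ (oldVertex _ w)) (fun _ => splitTopA Γ xsA xsB A B A' B') <|
    tensorElim (splitTopA Γ xsA xsB A B A' B')
      (tensorElim (splitTopA Γ xsA xsB A B A' B') (splitA Γ xsA xsB A B A' B')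
        (splitB Γ xsA xsB A B A' B'))
      (parElim (splitTopA Γ xsA xsB A B A' B') (splitA' Γ xsA xsB A B A' B')
        (splitB' Γ xsA xsB A B A' B'))

/-- The vertices after the reduction of a multiplicative cut, as vertices before it. -/
def splitInv : SVertex (splitSequent Γ xsA xsB A B A' B') → SVertex (ext Γ (multCut xs A B A' B')) :=
  exsElim
    (exsElim (oldVertex _) (bindVertex Γ _ xs) <| tensorElim (multTop Γ xs A B A' B')
      (multA Γ xs A B A' B') (multA' Γ xs A B A' B'))
    (bindVertex Γ _ xs) <| tensorElim (multTop Γ xs A B A' B')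
      (multB Γ xs A B A' B') (multB' Γ xs A B A' B')

/-- The leaves of the context and of a multiplicative cut. -/
def multLeaf (l : (SLeaf Γ ⊕ (A.Leaf ⊕ A'.Leaf)) ⊕ (B.Leaf ⊕ B'.Leaf)) :
    SLeaf (ext Γ (multCut xs A B A' B')) :=
  extLeaf Γ (.tensor (.tensor A B) (.par A' B')) xs (multSum l)

/-- The leaves of the context and of two cuts. -/
def splitLeaf : (SLeaf Γ ⊕ (A.Leaf ⊕ A'.Leaf)) ⊕ (B.Leaf ⊕ B'.Leaf) →
    SLeaf (splitSequent Γ xsA xsB A B A' B') :=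
  fun l => extLeaf _ (.tensor B B') xsB (l.map (extLeaf Γ (.tensor A A') xsA) id)

variable {Γ xs xsA xsB A B A' B'}

theorem splitLeaf_bijective : Function.Bijective (splitLeaf Γ xsA xsB A B A' B') :=
  extLeaf_bijective.comp (Sum.map_bijective.2 ⟨extLeaf_bijective, Function.bijective_id⟩)

theorem multLeaf_injective : Function.Injective (multLeaf Γ xs A B A' B') :=
  fun _ _ h => multSum_injective (extLeaf_bijective.1 h)

theorem mult_cases (hxs : xs.Nodup) (w : SVertex (ext Γ (multCut xs A B A' B'))) :
    (∃ a, w = oldVertex _ a) ∨ (∃ x ∈ xs, w = bindVertex Γ _ xs x) ∨ w = multTop Γ xs A B A' B' ∨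
      w = multTensor Γ xs A B A' B' ∨ w = multPar Γ xs A B A' B' ∨
      (∃ a, w = multA Γ xs A B A' B' a) ∨ (∃ a, w = multB Γ xs A B A' B' a) ∨
      (∃ a, w = multA' Γ xs A B A' B' a) ∨ ∃ a, w = multB' Γ xs A B A' B' a := by
  rcases exs_cases hxs w with h | h | ⟨c, rfl⟩
  · exact .inl h
  · exact .inr (.inl h)
  · refine .inr (.inr ?_)
    rcases tensor_cases c with rfl | ⟨c, rfl⟩ | ⟨c, rfl⟩
    · exact .inl rfl
    · rcases tensor_cases c with rfl | ⟨c, rfl⟩ | ⟨c, rfl⟩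
      · exact .inr (.inl rfl)
      · exact .inr (.inr (.inr (.inl ⟨c, rfl⟩)))
      · exact .inr (.inr (.inr (.inr (.inl ⟨c, rfl⟩))))
    · rcases par_cases c with rfl | ⟨c, rfl⟩ | ⟨c, rfl⟩
      · exact .inr (.inr (.inl rfl))
      · exact .inr (.inr (.inr (.inr (.inr (.inl ⟨c, rfl⟩)))))
      · exact .inr (.inr (.inr (.inr (.inr (.inr ⟨c, rfl⟩)))))

theorem split_cases (hxsA : xsA.Nodup) (hxsB : xsB.Nodup)
    (w : SVertex (splitSequent Γ xsA xsB A B A' B')) :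
    (∃ a, w = oldVertex _ (oldVertex _ a)) ∨ (∃ x ∈ xsA, w = splitBindA Γ xsA xsB A B A' B' x) ∨
      (∃ x ∈ xsB, w = splitBindB Γ xsA xsB A B A' B' x) ∨ w = splitTopA Γ xsA xsB A B A' B' ∨
      w = splitTopB Γ xsA xsB A B A' B' ∨
      (∃ a, w = splitA Γ xsA xsB A B A' B' a) ∨ (∃ a, w = splitB Γ xsA xsB A B A' B' a) ∨
      (∃ a, w = splitA' Γ xsA xsB A B A' B' a) ∨ ∃ a, w = splitB' Γ xsA xsB A B A' B' a := by
  rcases pair_cases hxsB w with ⟨w, rfl⟩ | h | h | ⟨a, rfl⟩ | ⟨b, rfl⟩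
  · rcases pair_cases hxsA w with ⟨w, rfl⟩ | ⟨x, hx, rfl⟩ | rfl | ⟨a, rfl⟩ | ⟨b, rfl⟩
    · exact .inl ⟨w, rfl⟩
    · exact .inr (.inl ⟨x, hx, rfl⟩)
    · exact .inr (.inr (.inr (.inl rfl)))
    · exact .inr (.inr (.inr (.inr (.inr (.inl ⟨a, rfl⟩)))))
    · exact .inr (.inr (.inr (.inr (.inr (.inr (.inr (.inl ⟨b, rfl⟩)))))))
  · exact .inr (.inr (.inl h))
  · exact .inr (.inr (.inr (.inr (.inl h))))
  · exact .inr (.inr (.inr (.inr (.inr (.inr (.inl ⟨a, rfl⟩))))))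
  · exact .inr (.inr (.inr (.inr (.inr (.inr (.inr (.inr ⟨b, rfl⟩)))))))

theorem embeds_multA : Embeds _ A (multA Γ xs A B A' B') :=
  (embeds_bodyVertex _ _ _).tensorLeft.tensorLeft

theorem embeds_multB : Embeds _ B (multB Γ xs A B A' B') :=
  (embeds_bodyVertex _ _ _).tensorLeft.tensorRight

theorem embeds_multA' : Embeds _ A' (multA' Γ xs A B A' B') :=
  (embeds_bodyVertex _ _ _).tensorRight.parLeft

theorem embeds_multB' : Embeds _ B' (multB' Γ xs A B A' B') :=
  (embeds_bodyVertex _ _ _).tensorRight.parRight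

theorem embeds_splitA : Embeds _ A (splitA Γ xsA xsB A B A' B') :=
  (embeds_bodyVertex _ _ _).tensorLeft.old _

theorem embeds_splitA' : Embeds _ A' (splitA' Γ xsA xsB A B A' B') :=
  (embeds_bodyVertex _ _ _).tensorRight.old _

theorem embeds_splitB : Embeds _ B (splitB Γ xsA xsB A B A' B') :=
  (embeds_bodyVertex _ _ _).tensorLeft

theorem embeds_splitB' : Embeds _ B' (splitB' Γ xsA xsB A B A' B') :=
  (embeds_bodyVertex _ _ _).tensorRight

section SplitMap

theorem splitMap_bindVertex {x : ℕ} (hx : x ∈ xs) :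
    splitMap Γ xs xsA xsB A B A' B' (bindVertex Γ _ xs x) = splitTopA Γ xsA xsB A B A' B' :=
  exsElim_bindVertex _ _ _ hx

@[simp] theorem splitMap_multTop :
    splitMap Γ xs xsA xsB A B A' B' (multTop Γ xs A B A' B') = splitTopA Γ xsA xsB A B A' B' :=
  exsElim_bodyVertex _ _ _ _

@[simp] theorem splitMap_multTensor :
    splitMap Γ xs xsA xsB A B A' B' (multTensor Γ xs A B A' B') = splitTopA Γ xsA xsB A B A' B' :=
  exsElim_bodyVertex _ _ _ _

@[simp] theorem splitMap_multPar :
    splitMap Γ xs xsA xsB A B A' B' (multPar Γ xs A B A' B') = splitTopA Γ xsA xsB A B A' B' :=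
  exsElim_bodyVertex _ _ _ _

@[simp] theorem splitMap_multA (a : A.Vertex) :
    splitMap Γ xs xsA xsB A B A' B' (multA Γ xs A B A' B' a) = splitA Γ xsA xsB A B A' B' a :=
  exsElim_bodyVertex _ _ _ _

@[simp] theorem splitMap_multB (b : B.Vertex) :
    splitMap Γ xs xsA xsB A B A' B' (multB Γ xs A B A' B' b) = splitB Γ xsA xsB A B A' B' b :=
  exsElim_bodyVertex _ _ _ _

@[simp] theorem splitMap_multA' (a : A'.Vertex) :
    splitMap Γ xs xsA xsB A B A' B' (multA' Γ xs A B A' B' a) = splitA' Γ xsA xsB A B A' B' a :=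
  exsElim_bodyVertex _ _ _ _

@[simp] theorem splitMap_multB' (b : B'.Vertex) :
    splitMap Γ xs xsA xsB A B A' B' (multB' Γ xs A B A' B' b) = splitB' Γ xsA xsB A B A' B' b :=
  exsElim_bodyVertex _ _ _ _

theorem splitInv_splitBindA {x : ℕ} (hx : x ∈ xsA) :
    splitInv Γ xs xsA xsB A B A' B' (splitBindA Γ xsA xsB A B A' B' x) = bindVertex Γ _ xs x :=
  exsElim_bindVertex (Γ := Γ) (oldVertex _) _ _ hx

theorem splitInv_splitBindB {x : ℕ} (hx : x ∈ xsB) :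
    splitInv Γ xs xsA xsB A B A' B' (splitBindB Γ xsA xsB A B A' B' x) = bindVertex Γ _ xs x :=
  exsElim_bindVertex _ _ _ hx

@[simp] theorem splitInv_splitTopA :
    splitInv Γ xs xsA xsB A B A' B' (splitTopA Γ xsA xsB A B A' B') = multTop Γ xs A B A' B' :=
  exsElim_bodyVertex (Γ := Γ) (oldVertex _) _ _ (tensorTop A A')

@[simp] theorem splitInv_splitTopB :
    splitInv Γ xs xsA xsB A B A' B' (splitTopB Γ xsA xsB A B A' B') = multTop Γ xs A B A' B' :=
  exsElim_bodyVertex _ _ _ _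

@[simp] theorem splitInv_splitA (a : A.Vertex) :
    splitInv Γ xs xsA xsB A B A' B' (splitA Γ xsA xsB A B A' B' a) = multA Γ xs A B A' B' a :=
  exsElim_bodyVertex (Γ := Γ) (oldVertex _) _ _ (tensorLeft A' a)

@[simp] theorem splitInv_splitA' (a : A'.Vertex) :
    splitInv Γ xs xsA xsB A B A' B' (splitA' Γ xsA xsB A B A' B' a) = multA' Γ xs A B A' B' a :=
  exsElim_bodyVertex (Γ := Γ) (oldVertex _) _ _ (tensorRight A a)

@[simp] theorem splitInv_splitB (b : B.Vertex) :
    splitInv Γ xs xsA xsB A B A' B' (splitB Γ xsA xsB A B A' B' b) = multB Γ xs A B A' B' b :=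
  exsElim_bodyVertex _ _ _ _

@[simp] theorem splitInv_splitB' (b : B'.Vertex) :
    splitInv Γ xs xsA xsB A B A' B' (splitB' Γ xsA xsB A B A' B' b) = multB' Γ xs A B A' B' b :=
  exsElim_bodyVertex _ _ _ _

end SplitMap

theorem splitMap_vertexOf (l : (SLeaf Γ ⊕ (A.Leaf ⊕ A'.Leaf)) ⊕ (B.Leaf ⊕ B'.Leaf)) :
    splitMap Γ xs xsA xsB A B A' B' (vertexOf _ (multLeaf Γ xs A B A' B' l)) =
      vertexOf _ (splitLeaf Γ xsA xsB A B A' B' l) := by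
  rcases l with (l | l | l) | l | l
  · rfl
  · refine (congrArg (splitMap Γ xs xsA xsB A B A' B') (vertexOf_extLeaf_inr _)).trans
      ((splitMap_multA _).trans ?_)
    exact congrArg (oldVertex _) (vertexOf_extLeaf_inr (C := .tensor A A') (.inl l)).symm
  · refine (congrArg (splitMap Γ xs xsA xsB A B A' B') (vertexOf_extLeaf_inr _)).trans
      ((splitMap_multA' _).trans ?_)
    exact congrArg (oldVertex _) (vertexOf_extLeaf_inr (C := .tensor A A') (.inr l)).symm
  · refine (congrArg (splitMap Γ xs xsA xsB A B A' B') (vertexOf_extLeaf_inr _)).trans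
      ((splitMap_multB _).trans ?_)
    exact (vertexOf_extLeaf_inr (C := .tensor B B') (.inl l)).symm
  · refine (congrArg (splitMap Γ xs xsA xsB A B A' B') (vertexOf_extLeaf_inr _)).trans
      ((splitMap_multB' _).trans ?_)
    exact (vertexOf_extLeaf_inr (C := .tensor B B') (.inr l)).symm

theorem argsOf_splitLeaf_left (hxsA : xsA.Nodup) (l : A.Leaf ⊕ A'.Leaf) :
    argsOf _ (splitLeaf Γ xsA xsB A B A' B' (.inl (.inr l))) =
      (Formula.tensor A A').leafArgs
        (fun x => if x ∈ xsA then Sum.inr (splitBindA Γ xsA xsB A B A' B' x) else .inl x)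
        (fun w => .inr (oldVertex _ (bodyVertex Γ xsA w))) l :=
  leafArgs_exsLeaf hxsA _ _ _

/-- The renaming goes from new to old: a variable shared by both sides of the connective acquires
two independent copies, and identifying them gives back the old terms. The old mgu therefore yields
a unifier that treats the copies alike. -/
theorem argsOf_multLeaf (hxs : xs.Nodup) (hxsA : xsA.Nodup) (hxsB : xsB.Nodup)
    (hA : ∀ x, x ∈ xsA ↔ x ∈ A.fv) (hA' : ∀ x, x ∈ xsA ↔ x ∈ A'.fv)
    (hB : ∀ x, x ∈ xsB ↔ x ∈ B.fv) (hB' : ∀ x, x ∈ xsB ↔ x ∈ B'.fv)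
    (hx : ∀ x, x ∈ xs ↔ x ∈ xsA ∨ x ∈ xsB)
    (l : (SLeaf Γ ⊕ (A.Leaf ⊕ A'.Leaf)) ⊕ (B.Leaf ⊕ B'.Leaf)) :
    argsOf _ (multLeaf Γ xs A B A' B' l) = (argsOf _ (splitLeaf Γ xsA xsB A B A' B' l)).map
      fun t => t.relabel (Sum.map id (splitInv Γ xs xsA xsB A B A' B')) := by
  have keyA : ∀ x ∈ xsA, Sum.map id (splitInv Γ xs xsA xsB A B A' B')
      (if x ∈ xsA then Sum.inr (splitBindA Γ xsA xsB A B A' B' x) else .inl x) =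
      if x ∈ xs then Sum.inr (bindVertex Γ _ xs x) else .inl x := fun x h => by
    rw [if_pos h, if_pos ((hx x).2 (.inl h)), Sum.map_inr, splitInv_splitBindA h]
  have keyB : ∀ x ∈ xsB, Sum.map id (splitInv Γ xs xsA xsB A B A' B')
      (if x ∈ xsB then Sum.inr (splitBindB Γ xsA xsB A B A' B' x) else .inl x) =
      if x ∈ xs then Sum.inr (bindVertex Γ _ xs x) else .inl x := fun x h => by
    rw [if_pos h, if_pos ((hx x).2 (.inr h)), Sum.map_inr, splitInv_splitBindB h]
  have h : ∀ l, argsOf _ (extLeaf Γ (.tensor (.tensor A B) (.par A' B')) xs (.inr l)) = _ :=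
    argsOf_extLeaf_inr hxs
  rcases l with (l | l | l) | l | l
  · exact (leafArgs_relabel (Γ l.1) (ρ := Sum.inl)
      (q := fun w => Sum.inr (oldVertex _ (oldVertex _ ⟨l.1, w⟩)))
      (fun _ _ => by rfl) (fun _ => by rfl) l.2).symm
  · rw [argsOf_splitLeaf_left hxsA]
    refine (h _).trans (leafArgs_relabel A (fun x hxA => ?_) (fun w => ?_) l).symm
    · exact keyA x ((hA x).2 hxA)
    · exact congrArg Sum.inr (splitInv_splitA w)
  · rw [argsOf_splitLeaf_left hxsA]
    refine (h _).trans (leafArgs_relabel A' (fun x hxA => ?_) (fun w => ?_) l).symm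
    · exact keyA x ((hA' x).2 hxA)
    · exact congrArg Sum.inr (splitInv_splitA' w)
  · have h' := argsOf_extLeaf_inr (Γ := ext Γ (pairCut xsA A A')) (C := .tensor B B') hxsB (.inl l)
    refine (h _).trans (Eq.trans ?_ (congrArg _ h').symm)
    refine (leafArgs_relabel B (fun x hxA => ?_) (fun w => ?_) l).symm
    · exact keyB x ((hB x).2 hxA)
    · exact congrArg Sum.inr (splitInv_splitB w)
  · have h' := argsOf_extLeaf_inr (Γ := ext Γ (pairCut xsA A A')) (C := .tensor B B') hxsB (.inr l)
    refine (h _).trans (Eq.trans ?_ (congrArg _ h').symm)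
    refine (leafArgs_relabel B' (fun x hxA => ?_) (fun w => ?_) l).symm
    · exact keyB x ((hB' x).2 hxA)
    · exact congrArg Sum.inr (splitInv_splitB' w)

end Multiplicative

/-! ### Switchings under multiplicative reduction -/

section Multiplicative

open Formula

variable {L : FirstOrder.Language.{u, v}} {J : Type} {Γ : J → Formula L} {xs xsA xsB : List ℕ}
  {A B A' B' : Formula L}

/-- The vertices of a multiplicative cut outside of the four subformulas. -/
def IsSpine (w : SVertex (ext Γ (multCut xs A B A' B'))) : Prop :=
  (∃ x ∈ xs, w = bindVertex Γ _ xs x) ∨ w = multTop Γ xs A B A' B' ∨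
    w = multTensor Γ xs A B A' B' ∨ w = multPar Γ xs A B A' B'

theorem isSwitched_multPar : IsSwitched _ (multPar Γ xs A B A' B') := .inl (kindOf_bodyVertex _)

theorem not_isSwitched_multTop : ¬ IsSwitched _ (multTop Γ xs A B A' B') := by
  simp [multTop]

theorem not_isSwitched_multTensor : ¬ IsSwitched _ (multTensor Γ xs A B A' B') := by
  simp [multTensor]

theorem IsSpine.conn {w : SVertex (ext Γ (multCut xs A B A' B'))} (h : IsSpine w)
    (θ : Set (Sym2 (SLeaf (ext Γ (multCut xs A B A' B'))))) :
    Conn (Fixed _ θ) w (multPar Γ xs A B A' B') := by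
  have h1 : Conn (Fixed _ θ) (multTop Γ xs A B A' B') (multPar Γ xs A B A' B') :=
    .symm _ _ (.rel _ _ (fixed_bodyVertex (isArg_tensorTop.2 (.inr rfl)) (.inl rfl)))
  rcases h with ⟨x, hx, rfl⟩ | rfl | rfl | rfl
  · exact (conn_bindVertex θ x).trans _ _ _ h1
  · exact h1
  · exact .trans _ _ _ (.rel _ _ (fixed_bodyVertex (isArg_tensorTop.2 (.inl rfl)) (.inl rfl))) h1
  · exact .refl _

section Fixed

variable (θ : Set (Sym2 (SLeaf (splitSequent Γ xsA xsB A B A' B'))))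

theorem fixed_splitA : Fixed _ θ (splitA Γ xsA xsB A B A' B' A.root)
    (splitTopA Γ xsA xsB A B A' B') :=
  fixed_oldVertex (sArg_bodyVertex_iff.2 ⟨_, rfl, isArg_tensorTop.2 (.inl rfl)⟩) (by simp)

theorem fixed_splitA' : Fixed _ θ (splitA' Γ xsA xsB A B A' B' A'.root)
    (splitTopA Γ xsA xsB A B A' B') :=
  fixed_oldVertex (sArg_bodyVertex_iff.2 ⟨_, rfl, isArg_tensorTop.2 (.inr rfl)⟩) (by simp)

theorem fixed_splitB : Fixed _ θ (splitB Γ xsA xsB A B A' B' B.root)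
    (splitTopB Γ xsA xsB A B A' B') :=
  fixed_bodyVertex (isArg_tensorTop.2 (.inl rfl)) (.inl rfl)

theorem fixed_splitB' : Fixed _ θ (splitB' Γ xsA xsB A B A' B' B'.root)
    (splitTopB Γ xsA xsB A B A' B') :=
  fixed_bodyVertex (isArg_tensorTop.2 (.inr rfl)) (.inl rfl)

theorem conn_splitBindB (x : ℕ) : Conn (Fixed _ θ) (splitBindB Γ xsA xsB A B A' B' x)
    (splitTopB Γ xsA xsB A B A' B') :=
  conn_bindVertex θ x

theorem conn_splitBindA (x : ℕ) : Conn (Fixed _ θ) (splitBindA Γ xsA xsB A B A' B' x)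
    (splitTopA Γ xsA xsB A B A' B') := by
  refine (conn_bindVertex (Γ := Γ) (C := .tensor A A') (xs := xsA) ∅ x).map (oldVertex _) ?_
  rintro a b (h | ⟨l, l', h, -⟩)
  · exact .rel _ _ (fixed_oldVertex h.1 h.2)
  · exact h.elim

end Fixed

/-- The spine is sent to the root of the cut on `A`, so the only fixed edge that needs the two new
cut roots to be joined is the one from the root of `B` to its tensor. Its target lies on the spine,
as the splitting argument requires. -/
theorem fixed_splitMap (hxs : xs.Nodup)
    {θ : Set (Sym2 ((SLeaf Γ ⊕ (A.Leaf ⊕ A'.Leaf)) ⊕ (B.Leaf ⊕ B'.Leaf)))}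
    {a b : SVertex (ext Γ (multCut xs A B A' B'))}
    (h : Fixed _ (Sym2.map (multLeaf Γ xs A B A' B') '' θ) a b) :
    Conn (Fixed _ (Sym2.map (splitLeaf Γ xsA xsB A B A' B') '' θ))
        (splitMap Γ xs xsA xsB A B A' B' a) (splitMap Γ xs xsA xsB A B A' B' b) ∨
      IsSpine b ∧
      Conn (fun u v => Fixed _ (Sym2.map (splitLeaf Γ xsA xsB A B A' B') '' θ) u v ∨
          (u = splitTopA Γ xsA xsB A B A' B' ∧ v = splitTopB Γ xsA xsB A B A' B'))
        (splitMap Γ xs xsA xsB A B A' B' a) (splitMap Γ xs xsA xsB A B A' B' b) := by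
  rcases h with ⟨h, hb⟩ | ⟨l, l', ⟨e, he, hl⟩, rfl, rfl⟩
  · rcases mult_cases hxs b with ⟨b, rfl⟩ | ⟨x, hx, rfl⟩ | rfl | rfl | rfl | ⟨c, rfl⟩ | ⟨c, rfl⟩ |
      ⟨c, rfl⟩ | ⟨c, rfl⟩
    · obtain ⟨a, rfl, k⟩ := sArg_oldVertex_iff.1 h
      exact .inl (.rel _ _ (fixed_oldVertex (sArg_oldVertex_iff.2 ⟨a, rfl, k⟩) hb))
    · left
      rw [splitMap_bindVertex hx]
      rcases sArg_bindVertex hxs hx h with rfl | ⟨z, hz, rfl⟩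
      · have := splitMap_multTop (Γ := Γ) (xs := xs) (xsA := xsA) (xsB := xsB) (A := A) (B := B)
          (A' := A') (B' := B')
        exact this ▸ .refl _
      · rw [splitMap_bindVertex hz]
        exact .refl _
    · left
      obtain ⟨a, rfl, k⟩ := sArg_bodyVertex_iff.1 h
      rcases isArg_tensorTop.1 k with rfl | rfl
      · exact (splitMap_multTensor (Γ := Γ) (xs := xs)).trans
          (splitMap_multTop (Γ := Γ) (xs := xs)).symm ▸ .refl _
      · exact (splitMap_multPar (Γ := Γ) (xs := xs)).trans
          (splitMap_multTop (Γ := Γ) (xs := xs)).symm ▸ .refl _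
    · obtain ⟨a, rfl, k⟩ := sArg_bodyVertex_iff.1 h
      obtain ⟨a, rfl, k'⟩ := isArg_tensorLeft.1 k
      rw [splitMap_multTensor]
      rcases isArg_tensorTop.1 k' with rfl | rfl
      · left
        exact (splitMap_multA (Γ := Γ) (xs := xs) A.root).symm ▸ .rel _ _ (fixed_splitA _)
      · refine .inr ⟨.inr (.inr (.inl rfl)), ?_⟩
        refine (splitMap_multB (Γ := Γ) (xs := xs) B.root).symm ▸ .trans _ _ _
          (.rel _ _ (.inl (fixed_splitB _))) (.symm _ _ (.rel _ _ (.inr ⟨rfl, rfl⟩)))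
    · exact (hb isSwitched_multPar).elim
    · obtain ⟨a, rfl, k⟩ := embeds_multA.exists_of_sArg embeds_splitA h
      rw [splitMap_multA, splitMap_multA]
      exact .inl (.rel _ _ (.inl ⟨k, fun h' => hb ((embeds_multA.isSwitched_iff embeds_splitA _).2 h')⟩))
    · obtain ⟨a, rfl, k⟩ := embeds_multB.exists_of_sArg embeds_splitB h
      rw [splitMap_multB, splitMap_multB]
      exact .inl (.rel _ _ (.inl ⟨k, fun h' => hb ((embeds_multB.isSwitched_iff embeds_splitB _).2 h')⟩))
    · obtain ⟨a, rfl, k⟩ := embeds_multA'.exists_of_sArg embeds_splitA' h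
      rw [splitMap_multA', splitMap_multA']
      exact .inl (.rel _ _ (.inl ⟨k,
        fun h' => hb ((embeds_multA'.isSwitched_iff embeds_splitA' _).2 h')⟩))
    · obtain ⟨a, rfl, k⟩ := embeds_multB'.exists_of_sArg embeds_splitB' h
      rw [splitMap_multB', splitMap_multB']
      exact .inl (.rel _ _ (.inl ⟨k,
        fun h' => hb ((embeds_multB'.isSwitched_iff embeds_splitB' _).2 h')⟩))
  · left
    induction e using Sym2.ind with
    | _ m m' =>
      have key : ∀ {m m'}, s(m, m') ∈ θ →
          Conn (Fixed _ (Sym2.map (splitLeaf Γ xsA xsB A B A' B') '' θ))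
          (splitMap Γ xs xsA xsB A B A' B' (vertexOf _ (multLeaf Γ xs A B A' B' m)))
          (splitMap Γ xs xsA xsB A B A' B' (vertexOf _ (multLeaf Γ xs A B A' B' m'))) := by
        intro m m' h
        rw [splitMap_vertexOf, splitMap_vertexOf]
        exact .rel _ _ (.inr ⟨_, _, ⟨_, h, rfl⟩, rfl, rfl⟩)
      rcases Sym2.eq_iff.1 hl with ⟨rfl, rfl⟩ | ⟨rfl, rfl⟩
      · exact key he
      · exact (key he).symm

theorem splitInv_of_kindOf (hxsA : xsA.Nodup) (hxsB : xsB.Nodup)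
    (hx : ∀ x, x ∈ xs ↔ x ∈ xsA ∨ x ∈ xsB) {w : SVertex (splitSequent Γ xsA xsB A B A' B')} :
    (kindOf _ w = .all ∨ kindOf _ w = .ex →
      kindOf _ (splitInv Γ xs xsA xsB A B A' B' w) = kindOf _ w) ∧
    (¬ IsSpine (splitInv Γ xs xsA xsB A B A' B' w) →
      splitMap Γ xs xsA xsB A B A' B' (splitInv Γ xs xsA xsB A B A' B' w) = w) := by
  rcases split_cases hxsA hxsB w with ⟨w, rfl⟩ | ⟨x, h, rfl⟩ | ⟨x, h, rfl⟩ | rfl | rfl | ⟨c, rfl⟩ |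
      ⟨c, rfl⟩ | ⟨c, rfl⟩ | ⟨c, rfl⟩
  · exact ⟨fun _ => rfl, fun _ => rfl⟩
  · rw [splitInv_splitBindA h]
    have hxx := (hx x).2 (.inl h)
    exact ⟨fun _ => (kindOf_bindVertex hxx).trans (kindOf_bindVertex (Γ := Γ) h).symm,
      fun hn => (hn (.inl ⟨x, hxx, rfl⟩)).elim⟩
  · rw [splitInv_splitBindB h]
    have hxx := (hx x).2 (.inr h)
    exact ⟨fun _ => (kindOf_bindVertex hxx).trans (kindOf_bindVertex h).symm,
      fun hn => (hn (.inl ⟨x, hxx, rfl⟩)).elim⟩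
  · rw [splitInv_splitTopA]
    exact ⟨fun h => by simp [splitTopA] at h, fun hn => (hn (.inr (.inl rfl))).elim⟩
  · rw [splitInv_splitTopB]
    exact ⟨fun h => by simp [splitTopB] at h, fun hn => (hn (.inr (.inl rfl))).elim⟩
  · rw [splitInv_splitA, splitMap_multA]
    exact ⟨fun _ => (embeds_multA.kindOf_eq c).trans (embeds_splitA.kindOf_eq c).symm, fun _ => rfl⟩
  · rw [splitInv_splitB, splitMap_multB]
    exact ⟨fun _ => (embeds_multB.kindOf_eq c).trans (embeds_splitB.kindOf_eq c).symm, fun _ => rfl⟩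
  · rw [splitInv_splitA', splitMap_multA']
    exact ⟨fun _ => (embeds_multA'.kindOf_eq c).trans (embeds_splitA'.kindOf_eq c).symm,
      fun _ => rfl⟩
  · rw [splitInv_splitB', splitMap_multB']
    exact ⟨fun _ => (embeds_multB'.kindOf_eq c).trans (embeds_splitB'.kindOf_eq c).symm,
      fun _ => rfl⟩

theorem IsSpine.not_all {w : SVertex (ext Γ (multCut xs A B A' B'))} (h : IsSpine w) :
    kindOf _ w ≠ .all := by
  intro hk
  rcases h with ⟨x, hx, rfl⟩ | rfl | rfl | rfl
  · exact not_isSwitched_bindVertex hx (.inr hk)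
  · exact not_isSwitched_multTop (.inr hk)
  · exact not_isSwitched_multTensor (.inr hk)
  · simp [multPar] at hk

theorem splitMap_of_isSwitched (hxs : xs.Nodup) {w : SVertex (ext Γ (multCut xs A B A' B'))}
    (hw : IsSwitched _ w) (hwp : w ≠ multPar Γ xs A B A' B') :
    kindOf _ (splitMap Γ xs xsA xsB A B A' B' w) = kindOf _ w ∧
    splitInv Γ xs xsA xsB A B A' B' (splitMap Γ xs xsA xsB A B A' B' w) = w ∧
    ∀ a, SArg _ a (splitMap Γ xs xsA xsB A B A' B' w) →
      SArg _ (splitInv Γ xs xsA xsB A B A' B' a) w := by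
  rcases mult_cases hxs w with ⟨b, rfl⟩ | ⟨x, hx, rfl⟩ | rfl | rfl | rfl | ⟨c, rfl⟩ | ⟨c, rfl⟩ |
      ⟨c, rfl⟩ | ⟨c, rfl⟩
  · refine ⟨rfl, rfl, fun a h => ?_⟩
    obtain ⟨a, rfl, k⟩ := sArg_oldVertex_iff.1 h
    obtain ⟨a, rfl, k'⟩ := sArg_oldVertex_iff.1 k
    exact sArg_oldVertex_iff.2 ⟨a, rfl, k'⟩
  · exact (not_isSwitched_bindVertex hx hw).elim
  · exact (not_isSwitched_multTop hw).elim
  · exact (not_isSwitched_multTensor hw).elim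
  · exact (hwp rfl).elim
  · rw [splitMap_multA, splitInv_splitA]
    refine ⟨(embeds_splitA.kindOf_eq c).trans (embeds_multA.kindOf_eq c).symm, rfl, fun a h => ?_⟩
    obtain ⟨a, rfl, k⟩ := embeds_splitA.exists_of_sArg embeds_multA h
    rwa [splitInv_splitA]
  · rw [splitMap_multB, splitInv_splitB]
    refine ⟨(embeds_splitB.kindOf_eq c).trans (embeds_multB.kindOf_eq c).symm, rfl, fun a h => ?_⟩
    obtain ⟨a, rfl, k⟩ := embeds_splitB.exists_of_sArg embeds_multB h
    rwa [splitInv_splitB]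
  · rw [splitMap_multA', splitInv_splitA']
    refine ⟨(embeds_splitA'.kindOf_eq c).trans (embeds_multA'.kindOf_eq c).symm, rfl, fun a h => ?_⟩
    obtain ⟨a, rfl, k⟩ := embeds_splitA'.exists_of_sArg embeds_multA' h
    rwa [splitInv_splitA']
  · rw [splitMap_multB', splitInv_splitB']
    refine ⟨(embeds_splitB'.kindOf_eq c).trans (embeds_multB'.kindOf_eq c).symm, rfl, fun a h => ?_⟩
    obtain ⟨a, rfl, k⟩ := embeds_splitB'.exists_of_sArg embeds_multB' h
    rwa [splitInv_splitB']

/-- A round trip moves only the binders and the root of the cut on `B`, up to fixed paths and the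
auxiliary edge between the roots, and binders of the cut on `A`, up to fixed paths alone. -/
theorem conn_splitMap_splitInv (hxsA : xsA.Nodup) (hxsB : xsB.Nodup)
    (hx : ∀ x, x ∈ xs ↔ x ∈ xsA ∨ x ∈ xsB)
    (θ : Set (Sym2 (SLeaf (splitSequent Γ xsA xsB A B A' B'))))
    (w : SVertex (splitSequent Γ xsA xsB A B A' B')) :
    Conn (fun u v => Fixed _ θ u v ∨
        (u = splitTopA Γ xsA xsB A B A' B' ∧ v = splitTopB Γ xsA xsB A B A' B'))
      w (splitMap Γ xs xsA xsB A B A' B' (splitInv Γ xs xsA xsB A B A' B' w)) := by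
  have lift : ∀ {a b}, Conn (Fixed _ θ) a b → Conn (fun u v => Fixed _ θ u v ∨
      (u = splitTopA Γ xsA xsB A B A' B' ∧ v = splitTopB Γ xsA xsB A B A' B')) a b :=
    fun h => h.mono fun _ _ h => .rel _ _ (.inl h)
  have hBA : Conn (fun u v => Fixed _ θ u v ∨
      (u = splitTopA Γ xsA xsB A B A' B' ∧ v = splitTopB Γ xsA xsB A B A' B'))
      (splitTopB Γ xsA xsB A B A' B') (splitTopA Γ xsA xsB A B A' B') :=
    .symm _ _ (.rel _ _ (.inr ⟨rfl, rfl⟩))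
  rcases split_cases hxsA hxsB w with ⟨w, rfl⟩ | ⟨x, h, rfl⟩ | ⟨x, h, rfl⟩ | rfl | rfl | ⟨c, rfl⟩ |
      ⟨c, rfl⟩ | ⟨c, rfl⟩ | ⟨c, rfl⟩
  · exact .refl _
  · rw [splitInv_splitBindA h, splitMap_bindVertex ((hx x).2 (.inl h))]
    exact lift (conn_splitBindA θ x)
  · rw [splitInv_splitBindB h, splitMap_bindVertex ((hx x).2 (.inr h))]
    exact (lift (conn_splitBindB θ x)).trans _ _ _ hBA
  · simpa using .refl _
  · simpa using hBA
  · simpa using .refl _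
  · simpa using .refl _
  · simpa using .refl _
  · simpa using .refl _

/-- Reduction of a multiplicative cut preserves correctness. -/
theorem Correct.multiplicative [Finite J] (hxs : xs.Nodup) (hxsA : xsA.Nodup) (hxsB : xsB.Nodup)
    (hA : ∀ x, x ∈ xsA ↔ x ∈ A.fv) (hA' : ∀ x, x ∈ xsA ↔ x ∈ A'.fv)
    (hB : ∀ x, x ∈ xsB ↔ x ∈ B.fv) (hB' : ∀ x, x ∈ xsB ↔ x ∈ B'.fv)
    (hx : ∀ x, x ∈ xs ↔ x ∈ xsA ∨ x ∈ xsB)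
    {θ : Set (Sym2 ((SLeaf Γ ⊕ (A.Leaf ⊕ A'.Leaf)) ⊕ (B.Leaf ⊕ B'.Leaf)))}
    (hθ : ∀ l, s(l, l) ∉ θ)
    (h : Correct (ext Γ (multCut xs A B A' B')) (Sym2.map (multLeaf Γ xs A B A' B') '' θ)) :
    Correct (splitSequent Γ xsA xsB A B A' B')
      (Sym2.map (splitLeaf Γ xsA xsB A B A' B') '' θ) := by
  have := Fintype.ofFinite J
  obtain ⟨hb, hc⟩ := h.balanced_and_allConn (notMem_map_image multLeaf_injective hθ)
  obtain ⟨σ, hσ⟩ := exists_isMGU h.1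
  have hs := hb.sparse
  have hinv := fun w => splitInv_of_kindOf (Γ := Γ) (A := A) (B := B) (A' := A') (B' := B') (w := w)
    hxsA hxsB hx
  have hnp : ∀ {w}, kindOf (ext Γ (multCut xs A B A' B')) w = .all →
      w ≠ multPar Γ xs A B A' B' := by
    rintro w hw rfl
    simp [multPar] at hw
  let E := Equiv.ofBijective _ (splitLeaf_bijective (Γ := Γ) (xsA := xsA) (xsB := xsB) (A := A)
    (B := B) (A' := A') (B' := B'))
  obtain ⟨hu, hp⟩ := precedes_transfer (θ' := Sym2.map (splitLeaf Γ xsA xsB A B A' B') '' θ) hσ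
    (splitMap Γ xs xsA xsB A B A' B') (splitInv Γ xs xsA xsB A B A' B')
    (fun l => multLeaf Γ xs A B A' B' (E.symm l)) (fun w => (hinv w).1)
    (fun w hw => (hinv w).2 fun h => h.not_all (((hinv w).1 (.inl hw)).trans hw))
    (fun w hw => by
      obtain ⟨h1, h2, -⟩ := splitMap_of_isSwitched (xsA := xsA) (xsB := xsB) hxs (.inr hw) (hnp hw)
      exact ⟨h1.trans hw, h2⟩)
    (fun l => by
      obtain ⟨l, rfl⟩ := E.surjective l
      rw [E.symm_apply_apply]
      exact argsOf_multLeaf hxs hxsA hxsB hA hA' hB hB' hx l)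
    (forall_mem_map_image
      (k := fun l => (argsOf _ (multLeaf Γ xs A B A' B' (E.symm l))).map fun t => t.subst σ)
      fun l l' hl => by
        have : ∀ l, E.symm (splitLeaf Γ xsA xsB A B A' B' l) = l := E.symm_apply_apply
        simp only [this]
        exact hσ.1.equalizes _ _ ⟨_, hl, rfl⟩)
  refine correct_of_allConn hu ?_ ?_
  · rw [balanced_iff, sum_excess_ext, ncard_map_image, excess_exs] at hb ⊢
    · rw [sum_excess_ext, excess_exs]
      simp only [excess] at hb ⊢
      -- Before, the two tensors each subtract one within a single formula; after, each of the two
      -- cuts has its own tensor, so the total excess is the same.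
      linarith
    · exact splitLeaf_bijective.1
    · exact multLeaf_injective
  -- The sources tried for the par are its two arguments. Their images are attached to the roots of
  -- different new cuts, so the path between them joins these cuts.
  · refine hs.conn_split (splitMap Γ xs xsA xsB A B A' B') (splitInv Γ xs xsA xsB A B A' B') IsSpine
      (p := multPar Γ xs A B A' B') (a₀ := multA' Γ xs A B A' B' A'.root)
      (b₀ := multB' Γ xs A B A' B' B'.root) (ta := splitTopA Γ xsA xsB A B A' B')
      (tb := splitTopB Γ xsA xsB A B A' B') hc isSwitched_multPar (fun a ha => ha.conn _)
      ?_ ?_ ?_ ?_ ?_ (fun a b hab => ?_) (fun a b hab _ hKb => ?_)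
      (conn_splitMap_splitInv hxsA hxsB hx _) (fun w => (hinv w).2) (fun w hw hwp => ?_)
    · exact .inl (sArg_bodyVertex_iff.2 ⟨_, rfl, isArg_tensorRight.2 ⟨parLeft B' A'.root, rfl, (rfl : _ = _)⟩⟩)
    · exact .inl (sArg_bodyVertex_iff.2 ⟨_, rfl, isArg_tensorRight.2 ⟨parRight A' B'.root, rfl, (rfl : _ = _)⟩⟩)
    · rw [splitMap_multA']
      exact .rel _ _ (fixed_splitA' _)
    · rw [splitMap_multB']
      exact .rel _ _ (fixed_splitB' _)
    · rw [splitMap_multPar]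
      exact .refl _
    · rcases fixed_splitMap hxs hab with h | ⟨-, h⟩
      · exact h.mono fun _ _ h => .rel _ _ (.inl h)
      · exact h
    · exact (fixed_splitMap hxs hab).resolve_right fun h => hKb h.1
    · obtain ⟨h1, h2, h3⟩ := splitMap_of_isSwitched (xsA := xsA) (xsB := xsB) hxs hw hwp
      refine ⟨by unfold IsSwitched at hw ⊢; rwa [h1], ?_⟩
      rintro a (h | h)
      · exact .inl (h3 a h)
      · have := hp _ _ h
        rw [h2] at this
        exact .inr this

end Multiplicative

/-! ### Atomic cuts -/

section Atomic

open Formula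

variable {L : FirstOrder.Language.{u, v}} {J : Type} {Γ : J → Formula L} {xs : List ℕ} {n : ℕ}
  {R R' : L.Relations n} {ts : Fin n → L.Term ℕ}

/-- The encoding of the cut between two atoms, with bound variables `xs`. -/
abbrev atomCut (xs : List ℕ) (R R' : L.Relations n) (ts : Fin n → L.Term ℕ) : Formula L :=
  exs xs (.tensor (.atom R ts) (.atom R' ts))

/-- The leaves of the context and of an atomic cut. -/
def atomLeaf (Γ : J → Formula L) (xs : List ℕ) (R R' : L.Relations n) (ts : Fin n → L.Term ℕ) :
    SLeaf Γ ⊕ (Unit ⊕ Unit) → SLeaf (ext Γ (atomCut xs R R' ts)) :=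
  extLeaf Γ (.tensor (.atom R ts) (.atom R' ts)) xs

/-- An atomic cut consists of existential quantifiers, a tensor and two leaves, so removing it
affects no switched vertex. -/
theorem exists_oldVertex_of_isSwitched (hxs : xs.Nodup)
    {w : SVertex (ext Γ (atomCut xs R R' ts))} (hw : IsSwitched _ w) :
    ∃ a, w = oldVertex _ a := by
  rcases exs_cases hxs w with h | ⟨x, hx, rfl⟩ | ⟨c, rfl⟩
  · exact h
  · exact (not_isSwitched_bindVertex hx hw).elim
  · rw [isSwitched_bodyVertex] at hw
    rcases tensor_cases c with rfl | ⟨c, rfl⟩ | ⟨c, rfl⟩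
    · simp at hw
    · rcases hw with hw | hw <;> cases hw
    · rcases hw with hw | hw <;> cases hw

theorem argsOf_atomLeaf_inr (hxs : xs.Nodup) :
    argsOf _ (atomLeaf Γ xs R R' ts (.inr (.inl ()))) =
      argsOf _ (atomLeaf Γ xs R R' ts (.inr (.inr ()))) :=
  (argsOf_extLeaf_inr (C := .tensor (.atom R ts) (.atom R' ts)) hxs (.inl ())).trans
    (argsOf_extLeaf_inr (C := .tensor (.atom R ts) (.atom R' ts)) hxs (.inr ())).symm

theorem atomLeaf_injective : Function.Injective (atomLeaf Γ xs R R' ts) := extLeaf_bijective.1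

/-- The linking before the reduction of an atomic cut. -/
def atomLinking {X : Type} (θ : Set (Sym2 X)) (a d : X) : Set (Sym2 (X ⊕ (Unit ⊕ Unit))) :=
  Sym2.map Sum.inl '' θ ∪ {s(.inl a, .inr (.inl ())), s(.inr (.inr ()), .inl d)}

theorem ncard_atomLinking {X : Type} [Finite X] (θ : Set (Sym2 X)) (a d : X) :
    (atomLinking θ a d).ncard = θ.ncard + 2 := by
  rw [atomLinking, Set.ncard_union_eq, ncard_map_image Sum.inl_injective, Set.ncard_pair]
  · simp
  · rw [Set.disjoint_left]
    rintro _ ⟨e, -, rfl⟩ h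
    induction e using Sym2.ind with
    | _ x y => simp at h

theorem notMem_atomLinking {X : Type} {θ : Set (Sym2 X)} (hθ : ∀ l, s(l, l) ∉ θ) (a d : X)
    (l : X ⊕ (Unit ⊕ Unit)) : s(l, l) ∉ atomLinking θ a d := by
  rintro (h | h)
  · exact notMem_map_image Sum.inl_injective hθ l h
  · rcases l with l | l | l <;> simp at h

/-- Reduction of an atomic cut preserves correctness. -/
theorem Correct.atomic [Finite J] (hxs : xs.Nodup) {θ : Set (Sym2 (SLeaf Γ))} {a d : SLeaf Γ}
    (hθ : ∀ l, s(l, l) ∉ θ) (had : s(a, d) ∉ θ)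
    (h : Correct (ext Γ (atomCut xs R R' ts))
      (Sym2.map (atomLeaf Γ xs R R' ts) '' atomLinking θ a d)) :
    Correct Γ (θ ∪ {s(a, d)}) := by
  have := Fintype.ofFinite J
  obtain ⟨hb, hc⟩ := h.balanced_and_allConn
    (notMem_map_image atomLeaf_injective (notMem_atomLinking hθ a d))
  obtain ⟨σ, hσ⟩ := exists_isMGU h.1
  -- The whole cut is contracted onto the leaf `a`. The link from `a` to the cut collapses, and the
  -- link from the cut to `d` becomes the new link.
  let f : SVertex (ext Γ (atomCut xs R R' ts)) → SVertex Γ := extElim id fun _ => vertexOf Γ a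
  have heq : ∀ l l', s(l, l') ∈ atomLinking θ a d →
      (argsOf _ (atomLeaf Γ xs R R' ts l)).map (fun t => t.subst σ) =
        (argsOf _ (atomLeaf Γ xs R R' ts l')).map fun t => t.subst σ :=
    fun l l' hl => hσ.1.equalizes _ _ ⟨_, hl, rfl⟩
  have hold : ∀ l l', s(l, l') ∈ θ → s(.inl l, .inl l') ∈ atomLinking θ a d :=
    fun l l' hl => .inl ⟨_, hl, rfl⟩
  -- The two atoms of the cut carry the same terms under the same binders, so equality passes
  -- through the cut.
  have hadl : (argsOf _ (atomLeaf Γ xs R R' ts (.inl a))).map (fun t => t.subst σ) =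
      (argsOf _ (atomLeaf Γ xs R R' ts (.inl d))).map fun t => t.subst σ := by
    rw [heq (.inl a) (.inr (.inl ())) (.inr (.inl rfl)), argsOf_atomLeaf_inr hxs]
    exact heq _ _ (.inr (.inr rfl))
  obtain ⟨hu, hp⟩ := precedes_transfer (θ' := θ ∪ {s(a, d)}) hσ f (oldVertex _)
    (fun l => atomLeaf Γ xs R R' ts (.inl l)) (fun _ _ => rfl) (fun _ _ => rfl)
    (fun w hw => by
      obtain ⟨w, rfl⟩ := exists_oldVertex_of_isSwitched hxs (.inr hw)
      exact ⟨hw, rfl⟩)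
    (fun l => (leafArgs_relabel (Γ l.1) (ρ := Sum.inl) (g := Sum.map id (oldVertex _))
      (q := fun w => Sum.inr (⟨l.1, w⟩ : SVertex Γ)) (fun _ _ => by rfl) (fun _ => by rfl) l.2).symm)
    (by
      rintro l l' (hl | hl)
      · exact heq _ _ (hold l l' hl)
      · rcases Sym2.eq_iff.1 hl with ⟨rfl, rfl⟩ | ⟨rfl, rfl⟩
        · exact hadl
        · exact hadl.symm)
  refine correct_of_allConn hu ?_ ?_
  -- The cut has excess one, and two links are replaced by one. For this the new link must not
  -- already be present.
  · rw [balanced_iff, sum_excess_ext, ncard_map_image atomLeaf_injective, excess_exs,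
      ncard_atomLinking] at hb
    rw [balanced_iff, Set.union_singleton, Set.ncard_insert_of_notMem had]
    simp only [excess] at hb
    push_cast at hb ⊢
    linarith
  · refine conn_of_map (F := Fixed _ _) (Sw := IsSwitched _) f (oldVertex _) hc (fun u w huw => ?_)
      (fun w => .refl _) (fun w hw => .inr ?_)
    · have hlink : ∀ {l l'}, s(l, l') ∈ θ ∪ {s(a, d)} →
          Conn (Fixed Γ (θ ∪ {s(a, d)})) (vertexOf Γ l) (vertexOf Γ l') := fun h =>
        .rel _ _ (.inr ⟨_, _, h, rfl, rfl⟩)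
      rcases huw with ⟨h, hw⟩ | ⟨l, l', ⟨e, he, hl⟩, rfl, rfl⟩
      · rcases ext_vertex_cases w with ⟨w, rfl⟩ | ⟨w, rfl⟩
        · obtain ⟨u, rfl, k⟩ := sArg_oldVertex_iff.1 h
          exact .rel _ _ (.inl ⟨k, hw⟩)
        · obtain ⟨u, rfl, -⟩ := sArg_newVertex_iff.1 h
          exact .refl _
      · have key : ∀ m m', s(m, m') ∈ atomLinking θ a d → Conn (Fixed Γ (θ ∪ {s(a, d)}))
            (f (vertexOf _ (atomLeaf Γ xs R R' ts m)))
            (f (vertexOf _ (atomLeaf Γ xs R R' ts m'))) := by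
          have hinl : ∀ l, f (vertexOf _ (atomLeaf Γ xs R R' ts (.inl l))) = vertexOf Γ l :=
            fun _ => rfl
          have hinr : ∀ l, f (vertexOf _ (atomLeaf Γ xs R R' ts (.inr l))) = vertexOf Γ a :=
            fun _ => rfl
          rintro m m' (⟨e, he, hm⟩ | hm | hm)
          · induction e using Sym2.ind with
            | _ k k' =>
              rcases Sym2.eq_iff.1 hm with ⟨rfl, rfl⟩ | ⟨rfl, rfl⟩
              · rw [hinl, hinl]
                exact hlink (.inl he)
              · rw [hinl, hinl]
                exact (hlink (.inl he)).symm
          · rcases Sym2.eq_iff.1 hm with ⟨rfl, rfl⟩ | ⟨rfl, rfl⟩ <;> rw [hinl, hinr] <;>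
              exact .refl _
          · rcases Sym2.eq_iff.1 hm with ⟨rfl, rfl⟩ | ⟨rfl, rfl⟩ <;> rw [hinl, hinr]
            · exact hlink (.inr rfl)
            · exact (hlink (.inr rfl)).symm
        induction e using Sym2.ind with
        | _ m m' =>
          rcases Sym2.eq_iff.1 hl with ⟨rfl, rfl⟩ | ⟨rfl, rfl⟩
          · exact key _ _ he
          · exact (key _ _ he).symm
    · obtain ⟨w, rfl⟩ := exists_oldVertex_of_isSwitched hxs hw
      refine ⟨hw, fun u hu => ?_⟩
      rcases hu with h | h
      · exact .inl (sArg_oldVertex_iff.2 ⟨u, rfl, h⟩)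
      · exact .inr (hp _ _ h)

end Atomic

/-! ### Cut sequents -/

namespace Formula

variable {L : FirstOrder.Language.{u, v}} [PredDuality L]

theorem fv_dual (A : Formula L) : A.dual.fv = A.fv := by
  induction A with
  | atom R ts => rfl
  | tensor A B ihA ihB => simp only [dual, fv, ihA, ihB]
  | par A B ihA ihB => simp only [dual, fv, ihA, ihB]
  | all x A ih => simp only [dual, fv, ih]
  | ex x A ih => simp only [dual, fv, ih]

end Formula

/-! ### Linkings and bijections of leaves -/

section Linking

variable {L : FirstOrder.Language.{u, v}} [PredDuality L] {X Y : Type}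
  {pred : X → Σ n, L.Relations n} {pred' : Y → Σ n, L.Relations n} {θ : Set (Sym2 X)}

/-- A degenerate link would make a predicate symbol its own dual. This is where duality having no
fixed points is used. -/
theorem IsLinking.notMem (h : IsLinking pred θ) (l : X) : s(l, l) ∉ θ := fun hl => by
  exact PredDuality.neg_ne (pred l).2 (eq_of_heq (Sigma.ext_iff.1 (h.dual l l hl)).2).symm

/-- A linking, along a bijection of the leaves. -/
theorem IsLinking.preimage (h : IsLinking pred θ) {φ : Y → X} (hφ : Function.Bijective φ)
    (hp : ∀ l, pred (φ l) = pred' l) : IsLinking pred' {e | e.map φ ∈ θ} := by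
  refine ⟨fun l l' hl => ?_, fun e he e' he' l hl hl' => ?_, fun l => ?_⟩
  · rw [← hp, ← hp]
    exact h.dual _ _ hl
  · exact Sym2.map.injective hφ.1 (h.disjoint _ he _ he' (φ l) (Sym2.mem_map.2 ⟨l, hl, rfl⟩)
      (Sym2.mem_map.2 ⟨l, hl', rfl⟩))
  · obtain ⟨e, he, hl⟩ := h.covers (φ l)
    obtain ⟨x, rfl⟩ := Sym2.mem_iff_exists.1 hl
    obtain ⟨m, rfl⟩ := hφ.2 x
    exact ⟨s(l, m), he, Sym2.mem_mk_left _ _⟩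

end Linking

/-- The identity. -/
def SeqIso.refl {L : FirstOrder.Language.{u, v}} {ι : Type} (Γ : ι → Formula L) : SeqIso Γ Γ :=
  ofFIso (Equiv.refl ι) fun i => FIso.refl (Γ i)

namespace CutSequent

variable {L : FirstOrder.Language.{u, v}} [PredDuality L]

instance (Δ : CutSequent L) : Finite Δ.ι := Δ.finite_ι

instance (Δ : CutSequent L) : Finite Δ.κ := Δ.finite_κ

theorem encodeLeaf_injective (Δ : CutSequent L) : Function.Injective Δ.encodeLeaf := by
  rintro (⟨i, l⟩ | ⟨k, l⟩) (⟨i', l'⟩ | ⟨k', l'⟩) h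
  · obtain rfl : i = i' := Sum.inl_injective (congrArg Sigma.fst h)
    obtain rfl : l = l' := eq_of_heq (Sigma.ext_iff.1 h).2
    rfl
  · cases congrArg Sigma.fst h
  · cases congrArg Sigma.fst h
  · obtain rfl : k = k' := Sum.inr_injective (congrArg Sigma.fst h)
    obtain rfl : l = l' := (Formula.exsLeaf_bijective _).1 (eq_of_heq (Sigma.ext_iff.1 h).2)
    rfl

/-- A unification net is preserved if, up to isomorphism, correctness of the encoding is. -/
theorem IsUnet.map {Δ Δ' : CutSequent L} {θ : Set (Sym2 Δ.Leaf)} (h : Δ.IsUnet θ)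
    {φ : Δ'.Leaf → Δ.Leaf} (hφ : Function.Surjective φ) (hpred : ∀ l, Δ.leafPred (φ l) = Δ'.leafPred l)
    {ι ι' Y : Type} [Finite ι] [Finite ι'] {S : ι → Formula L} {S' : ι' → Formula L}
    (I : SeqIso Δ.encode S) (I' : SeqIso Δ'.encode S') {p : Y → SLeaf S} {p' : Y → SLeaf S'}
    (ψ : Δ'.Leaf → Y) (hI : ∀ l, I.leaf (Δ.encodeLeaf (φ l)) = p (ψ l))
    (hI' : ∀ l, I'.leaf (Δ'.encodeLeaf l) = p' (ψ l)) (hp : Function.Injective p)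
    (hp' : Function.Injective p')
    (hcorrect : ∀ Θ : Set (Sym2 Y), (∀ l, s(l, l) ∉ Θ) → Correct S (Sym2.map p '' Θ) →
      Correct S' (Sym2.map p' '' Θ)) :
    Δ'.IsUnet {e | e.map φ ∈ θ} := by
  have hψ : Function.Injective ψ := fun l l' h =>
    Δ'.encodeLeaf_injective (I'.leaf.injective (by rw [hI', hI', h]))
  have hφi : Function.Injective φ := fun l l' h =>
    hψ (hp (by rw [← hI, ← hI, h]))
  have hlink := h.1.preimage ⟨hφi, hφ⟩ hpred
  refine ⟨hlink, ?_⟩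
  have hθ : θ = Sym2.map φ '' {e | e.map φ ∈ θ} := by
    refine Set.Subset.antisymm (fun e he => ?_) (Set.image_subset_iff.2 fun _ h => h)
    induction e using Sym2.ind with
    | _ x y =>
      obtain ⟨⟨x, rfl⟩, y, rfl⟩ := hφ x, hφ y
      exact ⟨s(x, y), he, rfl⟩
  have h1 := I.correct (notMem_map_image Δ.encodeLeaf_injective h.1.notMem) h.2
  have hdiag := notMem_map_image hψ hlink.notMem
  -- The linking is viewed on the common set `Y` of leaves, of which both concrete sequents are
  -- images.
  have h2 := hcorrect _ hdiag (by
    convert h1 using 1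
    conv_rhs => rw [hθ]
    simp only [Set.image_image, Sym2.map_map]
    refine Set.image_congr fun e _ => ?_
    congr 1
    funext l
    exact (hI l).symm)
  have h3 := I'.symm.correct (notMem_map_image hp' hdiag) h2
  convert h3 using 1
  simp only [Set.image_image, Sym2.map_map]
  refine Set.image_congr fun e _ => ?_
  congr 1
  funext l
  exact ((Equiv.symm_apply_eq _).2 (hI' l).symm).symm

/-! ### Encodings of cut sequents with added cuts -/

section AddCut

variable (Γ : CutSequent L) {A B C D DA DB : Formula L}

/-- The indices of the formulas of an encoding, when a cut is added. -/
def addCutIndex (ι κ : Type) : ι ⊕ Option κ ≃ Option (ι ⊕ κ) where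
  toFun
    | .inl i => some (.inl i)
    | .inr none => none
    | .inr (some k) => some (.inr k)
  invFun
    | none => .inr none
    | some (.inl i) => .inl i
    | some (.inr k) => .inr (some k)
  left_inv := by rintro (i | _ | k) <;> rfl
  right_inv := by rintro (_ | i | k) <;> rfl

/-- The encoding of a cut sequent with an added cut. -/
def addCutIso (G : FIso (.tensor C C.dual) D) :
    SeqIso (Γ.addCut C).encode (ext Γ.encode (Formula.exs (C.fv.sort (· ≤ ·)) D)) :=
  SeqIso.ofFIso (addCutIndex Γ.ι Γ.κ) fun i => match i with
    | .inl i => FIso.refl (Γ.concl i)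
    | .inr none => G.exs (C.fv.sort (· ≤ ·))
    | .inr (some k) => FIso.refl (Γ.cuts k).encodeCut

theorem addCutIso_oldLeaf (G : FIso (.tensor C C.dual) D) (l : Γ.Leaf) :
    (Γ.addCutIso G).leaf ((Γ.addCut C).encodeLeaf (Γ.oldLeaf C l)) =
      extLeaf Γ.encode D (C.fv.sort (· ≤ ·)) (.inl (Γ.encodeLeaf l)) := by
  rcases l with ⟨i, l⟩ | ⟨k, l⟩ <;> rfl

theorem addCutIso_newLeaf (G : FIso (.tensor C C.dual) D) (l : C.Leaf ⊕ C.dual.Leaf) :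
    (Γ.addCutIso G).leaf ((Γ.addCut C).encodeLeaf (Γ.newLeaf C l)) =
      extLeaf Γ.encode D (C.fv.sort (· ≤ ·)) (.inr (G.leaf l)) :=
  Sigma.ext rfl (heq_of_eq (G.exs_leaf _ l))

/-- The encoding of a cut sequent with two added cuts. -/
def addCutsIso (GA : FIso (.tensor A A.dual) DA) (GB : FIso (.tensor B B.dual) DB) :
    SeqIso ((Γ.addCut A).addCut B).encode
      (ext (ext Γ.encode (Formula.exs (A.fv.sort (· ≤ ·)) DA))
        (Formula.exs (B.fv.sort (· ≤ ·)) DB)) :=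
  SeqIso.ofFIso ((addCutIndex Γ.ι (Option Γ.κ)).trans (Equiv.optionCongr (addCutIndex Γ.ι Γ.κ)))
    fun i => match i with
    | .inl i => FIso.refl (Γ.concl i)
    | .inr none => GB.exs (B.fv.sort (· ≤ ·))
    | .inr (some none) => GA.exs (A.fv.sort (· ≤ ·))
    | .inr (some (some k)) => FIso.refl (Γ.cuts k).encodeCut

/-- The leaves of a cut sequent with an added cut. -/
def addCutSum {T : Type} (g : C.Leaf ⊕ C.dual.Leaf → T) : (Γ.addCut C).Leaf → SLeaf Γ.encode ⊕ T
  | .inl l => .inl (Γ.encodeLeaf (.inl l))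
  | .inr ⟨some k, l⟩ => .inl (Γ.encodeLeaf (.inr ⟨k, l⟩))
  | .inr ⟨none, l⟩ => .inr (g l)

/-- The leaves of a cut sequent with two added cuts. -/
def addCutsSum {T T' : Type} (g : A.Leaf ⊕ A.dual.Leaf → T) (g' : B.Leaf ⊕ B.dual.Leaf → T') :
    ((Γ.addCut A).addCut B).Leaf → (SLeaf Γ.encode ⊕ T) ⊕ T'
  | .inl l => .inl (.inl (Γ.encodeLeaf (.inl l)))
  | .inr ⟨some (some k), l⟩ => .inl (.inl (Γ.encodeLeaf (.inr ⟨k, l⟩)))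
  | .inr ⟨some none, l⟩ => .inl (.inr (g l))
  | .inr ⟨none, l⟩ => .inr (g' l)

end AddCut

/-! ### Compound reductions of cut sequents -/

section Reduction

variable (Γ : CutSequent L) (A B : Formula L) (x : ℕ)

theorem tensorLeaf_surjective : Function.Surjective (Γ.tensorLeaf A B) := by
  rintro (l | ⟨_ | k, l⟩)
  · exact ⟨.inl l, rfl⟩
  · rcases l with (l | l) | l | l
    · exact ⟨.inr ⟨some none, .inl l⟩, rfl⟩
    · exact ⟨.inr ⟨none, .inl l⟩, rfl⟩
    · exact ⟨.inr ⟨some none, .inr l⟩, rfl⟩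
    · exact ⟨.inr ⟨none, .inr l⟩, rfl⟩
  · exact ⟨.inr ⟨some (some k), l⟩, rfl⟩

theorem parLeaf_surjective : Function.Surjective (Γ.parLeaf A B) := by
  rintro (l | ⟨_ | k, l⟩)
  · exact ⟨.inl l, rfl⟩
  · rcases l with (l | l) | l | l
    · exact ⟨.inr ⟨some none, .inl l⟩, rfl⟩
    · exact ⟨.inr ⟨none, .inl l⟩, rfl⟩
    · exact ⟨.inr ⟨some none, .inr l⟩, rfl⟩
    · exact ⟨.inr ⟨none, .inr l⟩, rfl⟩
  · exact ⟨.inr ⟨some (some k), l⟩, rfl⟩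

theorem allLeaf_surjective : Function.Surjective (Γ.allLeaf x A) := by
  rintro (l | ⟨_ | k, l⟩)
  · exact ⟨.inl l, rfl⟩
  · exact ⟨.inr ⟨none, l⟩, rfl⟩
  · exact ⟨.inr ⟨some k, l⟩, rfl⟩

theorem exLeaf_surjective : Function.Surjective (Γ.exLeaf x A) := by
  rintro (l | ⟨_ | k, l⟩)
  · exact ⟨.inl l, rfl⟩
  · exact ⟨.inr ⟨none, l⟩, rfl⟩
  · exact ⟨.inr ⟨some k, l⟩, rfl⟩

variable {Γ A B x}

open Formula in
theorem IsUnet.all {θ : Set (Sym2 (Γ.addCut (.all x A)).Leaf)}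
    (h : (Γ.addCut (.all x A)).IsUnet θ) :
    (Γ.addCut A).IsUnet {e | e.map (Γ.allLeaf x A) ∈ θ} := by
  refine h.map (Γ.allLeaf_surjective A x) ?_ (Γ.addCutIso (FIso.refl _)) (Γ.addCutIso (FIso.refl _))
    (p := quantLeaf Γ.encode _ x A A.dual) (p' := pairLeaf Γ.encode _ A A.dual)
    (Γ.addCutSum id) ?_ ?_ extLeaf_bijective.1 extLeaf_bijective.1 fun Θ hΘ hc =>
      hc.quantifier (Finset.sort_nodup _ _) (Finset.sort_nodup _ _) (fun z => by simp)
        (fun z => by simp [fv_dual]) (fun z => by simp [fv, and_comm]) hΘ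
  · rintro (l | ⟨_ | k, l | l⟩) <;> rfl
  · rintro (l | ⟨_ | k, l⟩)
    · rfl
    · exact Γ.addCutIso_newLeaf (C := .all x A) (FIso.refl _) l
    · rfl
  · rintro (l | ⟨_ | k, l⟩)
    · rfl
    · exact Γ.addCutIso_newLeaf (C := A) (FIso.refl _) l
    · rfl

-- Here the cut is named by its existential formula. Commuting the tensor of the encoding puts the
-- universal one on the left, as in the other case.
open Formula in
theorem IsUnet.ex {θ : Set (Sym2 (Γ.addCut (.ex x A)).Leaf)}
    (h : (Γ.addCut (.ex x A)).IsUnet θ) :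
    (Γ.addCut A).IsUnet {e | e.map (Γ.exLeaf x A) ∈ θ} := by
  refine h.map (Γ.exLeaf_surjective A x) ?_ (Γ.addCutIso (FIso.tensorComm _ _))
    (Γ.addCutIso (FIso.tensorComm _ _))
    (p := quantLeaf Γ.encode _ x A.dual A) (p' := pairLeaf Γ.encode _ A.dual A)
    (Γ.addCutSum Sum.swap) ?_ ?_ extLeaf_bijective.1 extLeaf_bijective.1 fun Θ hΘ hc =>
      hc.quantifier (Finset.sort_nodup _ _) (Finset.sort_nodup _ _) (fun z => by simp [fv_dual])
        (fun z => by simp) (fun z => by simp [fv, and_comm]) hΘ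
  · rintro (l | ⟨_ | k, l | l⟩) <;> rfl
  · rintro (l | ⟨_ | k, l⟩)
    · rfl
    · exact Γ.addCutIso_newLeaf (C := .ex x A) (FIso.tensorComm _ _) l
    · rfl
  · rintro (l | ⟨_ | k, l⟩)
    · rfl
    · exact Γ.addCutIso_newLeaf (C := A) (FIso.tensorComm _ _) l
    · rfl

open Formula in
theorem IsUnet.tensor {θ : Set (Sym2 (Γ.addCut (.tensor A B)).Leaf)}
    (h : (Γ.addCut (.tensor A B)).IsUnet θ) :
    ((Γ.addCut A).addCut B).IsUnet {e | e.map (Γ.tensorLeaf A B) ∈ θ} := by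
  refine h.map (Γ.tensorLeaf_surjective A B) ?_ (Γ.addCutIso (FIso.refl _))
    (Γ.addCutsIso (FIso.refl _) (FIso.refl _))
    (p := multLeaf Γ.encode _ A B A.dual B.dual) (p' := splitLeaf Γ.encode _ _ A B A.dual B.dual)
    (Γ.addCutsSum id id) ?_ ?_ multLeaf_injective splitLeaf_bijective.1 fun Θ hΘ hc =>
      hc.multiplicative (Finset.sort_nodup _ _) (Finset.sort_nodup _ _) (Finset.sort_nodup _ _)
        (fun z => by simp) (fun z => by simp [fv_dual]) (fun z => by simp)
        (fun z => by simp [fv_dual]) (fun z => by simp [fv]) hΘ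
  · rintro (l | ⟨_ | _ | k, l | l⟩) <;> rfl
  · rintro (l | ⟨_ | _ | k, l⟩)
    · rfl
    · rcases l with l | l <;> exact Γ.addCutIso_newLeaf (C := .tensor A B) (FIso.refl _) _
    · rcases l with l | l <;> exact Γ.addCutIso_newLeaf (C := .tensor A B) (FIso.refl _) _
    · rfl
  · rintro (l | ⟨_ | _ | k, l⟩)
    · rfl
    · exact Sigma.ext rfl (heq_of_eq ((FIso.refl (.tensor B B.dual)).exs_leaf _ l))
    · exact Sigma.ext rfl (heq_of_eq ((FIso.refl (.tensor A A.dual)).exs_leaf _ l))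
    · rfl

-- As the cut is named by the par, commuting the tensors of all encodings involved brings it to the
-- form with the tensor formula on the left.
open Formula in
theorem IsUnet.par {θ : Set (Sym2 (Γ.addCut (.par A B)).Leaf)}
    (h : (Γ.addCut (.par A B)).IsUnet θ) :
    ((Γ.addCut A).addCut B).IsUnet {e | e.map (Γ.parLeaf A B) ∈ θ} := by
  refine h.map (Γ.parLeaf_surjective A B) ?_ (Γ.addCutIso (FIso.tensorComm _ _))
    (Γ.addCutsIso (FIso.tensorComm _ _) (FIso.tensorComm _ _))
    (p := multLeaf Γ.encode _ A.dual B.dual A B) (p' := splitLeaf Γ.encode _ _ A.dual B.dual A B)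
    (Γ.addCutsSum Sum.swap Sum.swap) ?_ ?_ multLeaf_injective splitLeaf_bijective.1 fun Θ hΘ hc =>
      hc.multiplicative (Finset.sort_nodup _ _) (Finset.sort_nodup _ _) (Finset.sort_nodup _ _)
        (fun z => by simp [fv_dual]) (fun z => by simp) (fun z => by simp [fv_dual])
        (fun z => by simp) (fun z => by simp [fv]) hΘ
  · rintro (l | ⟨_ | _ | k, l | l⟩) <;> rfl
  · rintro (l | ⟨_ | _ | k, l⟩)
    · rfl
    · rcases l with l | l <;> exact Γ.addCutIso_newLeaf (C := .par A B) (FIso.tensorComm _ _) _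
    · rcases l with l | l <;> exact Γ.addCutIso_newLeaf (C := .par A B) (FIso.tensorComm _ _) _
    · rfl
  · rintro (l | ⟨_ | _ | k, l⟩)
    · rfl
    · exact Sigma.ext rfl (heq_of_eq ((FIso.tensorComm B B.dual).exs_leaf _ l))
    · exact Sigma.ext rfl (heq_of_eq ((FIso.tensorComm A A.dual).exs_leaf _ l))
    · rfl

end Reduction

/-! ### Invariance under reindexing -/

section Reindex

variable (Δ : CutSequent L) {ι κ : Type} (e : ι ≃ Δ.ι) (f : κ ≃ Δ.κ)

theorem reindexLeaf_bijective : Function.Bijective (Δ.reindexLeaf e f) := by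
  constructor
  · rintro (⟨i, l⟩ | ⟨k, l⟩) (⟨i', l'⟩ | ⟨k', l'⟩) h
    · have h := Sum.inl_injective h
      obtain rfl : i = i' := e.injective (congrArg Sigma.fst h)
      obtain rfl : l = l' := eq_of_heq (Sigma.ext_iff.1 h).2
      rfl
    · cases h
    · cases h
    · have h := Sum.inr_injective h
      obtain rfl : k = k' := f.injective (congrArg Sigma.fst h)
      obtain rfl : l = l' := eq_of_heq (Sigma.ext_iff.1 h).2
      rfl
  · rintro (⟨i, l⟩ | ⟨k, l⟩)
    · obtain ⟨i, rfl⟩ := e.surjective i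
      exact ⟨.inl ⟨i, l⟩, rfl⟩
    · obtain ⟨k, rfl⟩ := f.surjective k
      exact ⟨.inr ⟨k, l⟩, rfl⟩

theorem leafPred_reindexLeaf (l : (Δ.reindex e f).Leaf) :
    Δ.leafPred (Δ.reindexLeaf e f l) = (Δ.reindex e f).leafPred l := by
  rcases l with l | ⟨k, l | l⟩ <;> rfl

/-- The encoding of a reindexed cut sequent. -/
def reindexIso : SeqIso (Δ.reindex e f).encode Δ.encode :=
  SeqIso.ofFIso (Equiv.sumCongr e f) fun i => match i with
    | .inl i => FIso.refl (Δ.concl (e i))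
    | .inr k => FIso.refl (Δ.cuts (f k)).encodeCut

theorem reindexIso_leaf (l : (Δ.reindex e f).Leaf) :
    (Δ.reindexIso e f).leaf ((Δ.reindex e f).encodeLeaf l) =
      Δ.encodeLeaf (Δ.reindexLeaf e f l) := by
  rcases l with l | ⟨k, l⟩ <;> rfl

variable {Δ}

theorem IsUnet.reindex {θ : Set (Sym2 Δ.Leaf)} (h : Δ.IsUnet θ) :
    (Δ.reindex e f).IsUnet {l | l.map (Δ.reindexLeaf e f) ∈ θ} :=
  h.map (Δ.reindexLeaf_bijective e f).2 (Δ.leafPred_reindexLeaf e f) (SeqIso.refl _)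
    (Δ.reindexIso e f) (p := id) (p' := id) (fun l => Δ.encodeLeaf (Δ.reindexLeaf e f l))
    (fun _ => rfl) (Δ.reindexIso_leaf e f) Function.injective_id Function.injective_id
    fun _ _ h => h

/-- Stripping the renaming from the source of a reduction step is what lets the induction hypothesis
apply to the underlying step. -/
theorem IsUnet.of_reindex {θ : Set (Sym2 Δ.Leaf)}
    (h : (Δ.reindex e f).IsUnet {l | l.map (Δ.reindexLeaf e f) ∈ θ}) : Δ.IsUnet θ := by
  let E := Equiv.ofBijective _ (Δ.reindexLeaf_bijective e f)
  have hE : ∀ l, Δ.reindexLeaf e f (E.symm l) = l := E.apply_symm_apply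
  have := finite_ι (Δ.reindex e f)
  have := finite_κ (Δ.reindex e f)
  have h1 := h.map (φ := E.symm) E.symm.surjective
    (fun l => by rw [← Δ.leafPred_reindexLeaf, hE]) (SeqIso.refl _) (Δ.reindexIso e f).symm
    (p := id) (p' := id) (fun l => (Δ.reindex e f).encodeLeaf (E.symm l)) (fun _ => rfl)
    (fun l => by
      refine (Equiv.symm_apply_eq _).2 ?_
      rw [id, reindexIso_leaf, hE]) Function.injective_id Function.injective_id fun _ _ h => h
  convert h1 using 1
  ext l
  have : Sym2.map (Δ.reindexLeaf e f) (Sym2.map E.symm l) = l := by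
    rw [Sym2.map_map, show Δ.reindexLeaf e f ∘ E.symm = id from funext hE, Sym2.map_id, id]
  change l ∈ θ ↔ Sym2.map (Δ.reindexLeaf e f) (Sym2.map E.symm l) ∈ θ
  rw [this]

end Reindex

/-! ### Atomic reductions of cut sequents -/

section Atomic

variable {Γ : CutSequent L} {n : ℕ} {R : L.Relations n} {ts : Fin n → L.Term ℕ}

theorem oldLeaf_injective (Γ : CutSequent L) (A : Formula L) :
    Function.Injective (Γ.oldLeaf A) := by
  rintro (l | ⟨k, l⟩) (l' | ⟨k', l'⟩) h
  · exact congrArg _ (Sum.inl_injective h)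
  · cases h
  · cases h
  · have h := Sum.inr_injective h
    obtain rfl : k = k' := Option.some_injective _ (congrArg Sigma.fst h)
    obtain rfl : l = l' := eq_of_heq (Sigma.ext_iff.1 h).2
    rfl

theorem oldLeaf_ne_newLeaf {A : Formula L} (l : Γ.Leaf) (l' : A.Leaf ⊕ A.dual.Leaf) :
    Γ.oldLeaf A l ≠ Γ.newLeaf A l' := by
  rcases l with l | ⟨k, l⟩
  · exact Sum.inl_ne_inr
  · intro h
    cases congrArg Sigma.fst (Sum.inr_injective h)

theorem leafPred_oldLeaf (A : Formula L) (l : Γ.Leaf) :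
    (Γ.addCut A).leafPred (Γ.oldLeaf A l) = Γ.leafPred l := by
  rcases l with l | ⟨k, l | l⟩ <;> rfl

/-- Cases for the leaves of a cut sequent with an added atomic cut. -/
theorem atom_leaf_cases (l : (Γ.addCut (.atom R ts)).Leaf) :
    (∃ m, l = Γ.oldLeaf (.atom R ts) m) ∨ l = Γ.newLeaf (.atom R ts) (.inl ()) ∨
      l = Γ.newLeaf (.atom R ts) (.inr ()) := by
  rcases l with l | ⟨_ | k, l⟩
  · exact .inl ⟨.inl l, rfl⟩
  · rcases l with l | l
    · exact .inr (.inl rfl)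
    · exact .inr (.inr rfl)
  · exact .inl ⟨.inr ⟨k, l⟩, rfl⟩

variable {θ : Set (Sym2 (Γ.addCut (.atom R ts)).Leaf)} {a d : Γ.Leaf}

/-- A linking consists of links of the context and the two links of an atomic cut. -/
theorem eq_of_atomic (h : IsLinking (Γ.addCut (.atom R ts)).leafPred θ)
    (hab : s(Γ.oldLeaf (.atom R ts) a, Γ.newLeaf (.atom R ts) (.inl ())) ∈ θ)
    (hcd : s(Γ.newLeaf (.atom R ts) (.inr ()), Γ.oldLeaf (.atom R ts) d) ∈ θ) :
    θ = Sym2.map (Γ.oldLeaf (.atom R ts)) '' {e | e.map (Γ.oldLeaf (.atom R ts)) ∈ θ} ∪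
      {s(Γ.oldLeaf (.atom R ts) a, Γ.newLeaf (.atom R ts) (.inl ())),
        s(Γ.newLeaf (.atom R ts) (.inr ()), Γ.oldLeaf (.atom R ts) d)} := by
  -- Each leaf of the cut already lies on one of the two given links, so disjointness forces any
  -- link at it to be that one.
  have new : ∀ l l', s(Γ.newLeaf (.atom R ts) l, l') ∈ θ →
      s(Γ.newLeaf (.atom R ts) l, l') ∈ ({s(Γ.oldLeaf (.atom R ts) a,
        Γ.newLeaf (.atom R ts) (.inl ())), s(Γ.newLeaf (.atom R ts) (.inr ()),
          Γ.oldLeaf (.atom R ts) d)} : Set (Sym2 (Γ.addCut (.atom R ts)).Leaf)) := by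
    rintro (l | l) l' hl
    · exact .inl (h.disjoint _ hl _ hab _ (Sym2.mem_mk_left _ _) (Sym2.mem_mk_right _ _))
    · exact .inr (h.disjoint _ hl _ hcd _ (Sym2.mem_mk_left _ _) (Sym2.mem_mk_left _ _))
  refine Set.Subset.antisymm (fun e he => ?_) ?_
  · induction e using Sym2.ind with
    | _ l l' =>
      rcases atom_leaf_cases l with ⟨m, rfl⟩ | rfl | rfl
      · rcases atom_leaf_cases l' with ⟨m', rfl⟩ | rfl | rfl
        · exact .inl ⟨s(m, m'), he, rfl⟩
        · rw [Sym2.eq_swap (a := Γ.oldLeaf _ m)] at he ⊢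
          exact .inr (new _ _ he)
        · rw [Sym2.eq_swap (a := Γ.oldLeaf _ m)] at he ⊢
          exact .inr (new _ _ he)
      · exact .inr (new _ _ he)
      · exact .inr (new _ _ he)
  · rintro e (⟨e, he, rfl⟩ | rfl | rfl)
    · exact he
    · exact hab
    · exact hcd

/-- The links of the context do not meet the leaves linked to an atomic cut. -/
theorem notMem_of_atomic (h : IsLinking (Γ.addCut (.atom R ts)).leafPred θ)
    (hab : s(Γ.oldLeaf (.atom R ts) a, Γ.newLeaf (.atom R ts) (.inl ())) ∈ θ)
    (hcd : s(Γ.newLeaf (.atom R ts) (.inr ()), Γ.oldLeaf (.atom R ts) d) ∈ θ)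
    {e : Sym2 Γ.Leaf} (he : e.map (Γ.oldLeaf (.atom R ts)) ∈ θ) : a ∉ e ∧ d ∉ e := by
  constructor
  · intro hl
    have := h.disjoint _ he _ hab _ (Sym2.mem_map.2 ⟨a, hl, rfl⟩) (Sym2.mem_mk_left _ _)
    obtain ⟨x, -, hx⟩ := Sym2.mem_map.1 (this ▸ Sym2.mem_mk_right _ _)
    exact oldLeaf_ne_newLeaf _ _ hx
  · intro hl
    have := h.disjoint _ he _ hcd _ (Sym2.mem_map.2 ⟨d, hl, rfl⟩) (Sym2.mem_mk_right _ _)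
    obtain ⟨x, -, hx⟩ := Sym2.mem_map.1 (this ▸ Sym2.mem_mk_left _ _)
    exact oldLeaf_ne_newLeaf _ _ hx

/-- Duality across the two old links gives `a` the dual of `R` and `d` the symbol `R` itself, by
involutivity, so the new link is admissible. -/
theorem _root_.UNet.IsLinking.atomic (h : IsLinking (Γ.addCut (.atom R ts)).leafPred θ)
    (hab : s(Γ.oldLeaf (.atom R ts) a, Γ.newLeaf (.atom R ts) (.inl ())) ∈ θ)
    (hcd : s(Γ.newLeaf (.atom R ts) (.inr ()), Γ.oldLeaf (.atom R ts) d) ∈ θ) :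
    IsLinking Γ.leafPred ({e | e.map (Γ.oldLeaf (.atom R ts)) ∈ θ} ∪ {s(a, d)}) := by
  have ha : Γ.leafPred a = ⟨n, PredDuality.neg R⟩ := by
    rw [← leafPred_oldLeaf (.atom R ts)]
    exact h.dual _ _ (Sym2.eq_swap ▸ hab)
  have hd : Γ.leafPred d = ⟨n, R⟩ := by
    rw [← leafPred_oldLeaf (.atom R ts)]
    refine (h.dual _ _ hcd).trans ?_
    exact congrArg (Sigma.mk n) (PredDuality.neg_neg R)
  refine ⟨?_, ?_, fun l => ?_⟩
  · rintro l l' (hl | hl)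
    · rw [← leafPred_oldLeaf (.atom R ts) l, ← leafPred_oldLeaf (.atom R ts) l']
      exact h.dual _ _ hl
    · rcases Sym2.eq_iff.1 hl with ⟨rfl, rfl⟩ | ⟨rfl, rfl⟩
      · rw [ha, hd]
        exact congrArg (Sigma.mk n) (PredDuality.neg_neg R).symm
      · rw [ha, hd]
  · rintro e (he | rfl) e' (he' | rfl) l hl hl'
    · exact Sym2.map.injective (Γ.oldLeaf_injective _) (h.disjoint _ he _ he' _
        (Sym2.mem_map.2 ⟨l, hl, rfl⟩) (Sym2.mem_map.2 ⟨l, hl', rfl⟩))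
    · rcases Sym2.mem_iff.1 hl' with rfl | rfl
      · exact ((notMem_of_atomic h hab hcd he).1 hl).elim
      · exact ((notMem_of_atomic h hab hcd he).2 hl).elim
    · rcases Sym2.mem_iff.1 hl with rfl | rfl
      · exact ((notMem_of_atomic h hab hcd he').1 hl').elim
      · exact ((notMem_of_atomic h hab hcd he').2 hl').elim
    · rfl
  · obtain ⟨e, he, hl⟩ := h.covers (Γ.oldLeaf (.atom R ts) l)
    rw [eq_of_atomic h hab hcd] at he
    rcases he with ⟨e, he, rfl⟩ | rfl | rfl
    · obtain ⟨m, hm, hml⟩ := Sym2.mem_map.1 hl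
      exact ⟨e, .inl he, Γ.oldLeaf_injective _ hml ▸ hm⟩
    · refine ⟨_, .inr rfl, Sym2.mem_iff.2 (.inl (Γ.oldLeaf_injective (.atom R ts) ?_))⟩
      exact (Sym2.mem_iff.1 hl).resolve_right (oldLeaf_ne_newLeaf _ _)
    · refine ⟨_, .inr rfl, Sym2.mem_iff.2 (.inr (Γ.oldLeaf_injective (.atom R ts) ?_))⟩
      exact (Sym2.mem_iff.1 hl).resolve_left (oldLeaf_ne_newLeaf _ _)

-- The set of leaves shrinks here, so transport along a bijection of leaves does not apply. The old
-- linking is instead rewritten as the context links plus the two links at the cut.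
open Formula in
theorem IsUnet.atomic (h : (Γ.addCut (.atom R ts)).IsUnet θ)
    (hab : s(Γ.oldLeaf (.atom R ts) a, Γ.newLeaf (.atom R ts) (.inl ())) ∈ θ)
    (hcd : s(Γ.newLeaf (.atom R ts) (.inr ()), Γ.oldLeaf (.atom R ts) d) ∈ θ) :
    Γ.IsUnet ({e | e.map (Γ.oldLeaf (.atom R ts)) ∈ θ} ∪ {s(a, d)}) := by
  have hlink := h.1.atomic hab hcd
  refine ⟨hlink, ?_⟩
  let I := Γ.addCutIso (C := .atom R ts) (FIso.refl _)
  have hc := I.correct (notMem_map_image (encodeLeaf_injective _) h.1.notMem) h.2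
  have hold : ∀ l, I.leaf ((Γ.addCut (.atom R ts)).encodeLeaf (Γ.oldLeaf _ l)) =
      atomLeaf Γ.encode _ R (PredDuality.neg R) ts (.inl (Γ.encodeLeaf l)) :=
    Γ.addCutIso_oldLeaf _
  have hnew : ∀ l, I.leaf ((Γ.addCut (.atom R ts)).encodeLeaf (Γ.newLeaf (.atom R ts) l)) =
      atomLeaf Γ.encode _ R (PredDuality.neg R) ts (.inr l) :=
    Γ.addCutIso_newLeaf (C := .atom R ts) (FIso.refl _)
  have hset : Sym2.map I.leaf '' (Sym2.map (Γ.addCut (.atom R ts)).encodeLeaf '' θ) =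
      Sym2.map (atomLeaf Γ.encode _ R (PredDuality.neg R) ts) ''
        atomLinking (Sym2.map Γ.encodeLeaf '' {e | e.map (Γ.oldLeaf (.atom R ts)) ∈ θ})
          (Γ.encodeLeaf a) (Γ.encodeLeaf d) := by
    conv_lhs => rw [eq_of_atomic h.1 hab hcd]
    simp only [atomLinking, Set.image_union, Set.image_pair, Set.image_image, Sym2.map_map,
      Sym2.map_mk, hold, hnew]
    congr 1
    refine Set.image_congr fun e _ => ?_
    congr 1
    funext l
    exact hold l
  rw [Set.image_union, Set.image_singleton]
  refine Correct.atomic (Finset.sort_nodup _ _)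
    (notMem_map_image Γ.encodeLeaf_injective fun l hl => hlink.notMem l (.inl hl)) ?_ (hset ▸ hc)
  rintro ⟨e, he, hed⟩
  obtain rfl : e = s(a, d) := Sym2.map.injective Γ.encodeLeaf_injective hed
  exact (notMem_of_atomic h.1 hab hcd he).1 (Sym2.mem_mk_left _ _)

end Atomic

end CutSequent

end UNet

/-- Reducing a cut (atomic, multiplicative or quantifier) in a unification net yields a
unification net. -/
theorem mainTheorem4 {L : FirstOrder.Language.{u, v}} [UNet.PredDuality L]
    (Δ Δ' : UNet.CutSequent L) (θ : Set (Sym2 Δ.Leaf)) (θ' : Set (Sym2 Δ'.Leaf))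
    (hnet : Δ.IsUnet θ) (hred : UNet.CutReduction Δ θ Δ' θ') :
    Δ'.IsUnet θ' := by
  induction hred with
  | atomic Γ R ts θ a d hab hcd => exact hnet.atomic hab hcd
  | tensor Γ A B θ => exact hnet.tensor
  | par Γ A B θ => exact hnet.par
  | all Γ x A θ => exact hnet.all
  | ex Γ x A θ => exact hnet.ex
  -- The renaming is undone before the step and the other one is performed after it.
  | reindex Δ Δ' θ θ' e f e' f' _ ih => exact (ih (hnet.of_reindex e f)).reindex e' f'
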